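/- Let $M$ be a smooth manifold (finite-dimensional, Hausdorff, second countable, without boundary). **Elliptic divisors.** A *real divisor* on $M$ is a pair $(R,q)$ of a smooth real line bundle $R\to M$ and a smooth section $q$ with nowhere dense zero set; its *associated ideal* is $I_q=\{\varphi(q):\varphi\in\Gamma(R^*)\}\subseteq C^\infty(M)$, and $I_q(U)\subseteq C^\infty(U)$ is defined in the same way for open $U\subseteq M$. A function $f\in C^\infty(U)$ defines a *smooth elliptic divisor* $\langle f\rangle$ on $U$ if $D_f=f^{-1}(0)$ is a (possibly empty) submanifold of codimension two which consists of critical points of $f$, and the normal Hessian of $f$ along $D_f$ is positive definite. Functions $f_1,\dots,f_j\in C^\infty(U)$ represent *local normal crossing divisors* on $U$ if each $f_i$ defines a smooth elliptic divisor, the loci $D_i=f_i^{-1}(0)$ intersect transversely, and $I_q(U)=\langle f_1\rangle\cdots\langle f_j\rangle$. The divisor $|D|=(R,q)$ is a (self-crossing) *elliptic divisor* if every point of $M$ has an open neighbourhood with such $f_1,\dots,f_j$ for some $j\ge 0$. The *intersection number* of a point is the least such $j$ over all its neighbourhoods, the intersection number of the divisor is the maximum of those of the points of $M$, and $D[n]$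 is the set of points with intersection number exactly $n$. Let $|D|=(R,q)$ be an elliptic divisor on $M$ with intersection number $n$, so that $D[n]$ is an embedded submanifold of codimension $2n$, closed in $M$. **The elliptic tangent bundle.** $\mathcal A_{|D|}\to TM$ is the Lie algebroid over $M$ whose sections are the vector fields on $M$ that preserve the ideal $I_q$. Its fibre at $x$ is $\Gamma(\mathcal A_{|D|})/\mathfrak m_x\Gamma(\mathcal A_{|D|})$, where $\mathfrak m_x\subset C^\infty(M)$ is the ideal of functions vanishing at $x$. Over $D[n]$ its anchor takes values in $TD[n]$, and $\mathcal A_{|D|}|_{D[n]}$ is a Lie algebroid over $D[n]$, with the bracket and the anchor induced by extending sections to $\mathcal A_{|D|}$. **The structure group reduction.** Let $ND[n]=TM|_{D[n]}/TD[n]$ and let $G=(O(2)\times\mathbb R_+)^n\rtimes S_n$ act on $(\mathbb R^2)^n$ by isometries and positive scalings of the summands and by permutations of the summands. Let $P$ be the set of frames $u:(\mathbb R^2)^n\to N_xD[n]$, $x\in D[n]$, for which there are non-negative functions $f_1,\dots,f_n$, defined near $x$ and representing local normal crossing divisors, such that for each $i$ the restriction of $u$ to the $i$-th summand is an orthonormal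 frame of $N_xD_i\subseteq\bigoplus_{k}N_xD_k\cong N_xD[n]$ for the normal Hessian of $f_i$. Then $P\to D[n]$ is a principal $G$-bundle, a structure group reduction of the frame bundle of $ND[n]$. Its *Atiyah algebroid* is $\mathrm{At}(P)=TP/G$: its sections are the $G$-invariant vector fields on $P$ with their Lie bracket, and its anchor is induced by the differential of $P\to D[n]$. **Lemma.** There is an isomorphism of Lie algebroids over $D[n]$ (covering the identity) $$\mathcal A_{|D|}\big|_{D[n]}\;\simeq\;\mathrm{At}(P).$$ That is, there is an isomorphism $\Gamma(\mathcal A_{|D|}|_{D[n]})\simeq\Gamma(\mathrm{At}(P))$ of $C^\infty(D[n])$-modules (equivalently, of vector bundles over $D[n]$) which preserves brackets and anchors. -/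

import Mathlib

open scoped Manifold ContDiff Topology InnerProductSpace Bundle
open Bundle

noncomputable section

set_option linter.unusedSectionVars false

namespace EllipticDivisor

/-! ### Smooth functions and tangent spaces of subsets of manifolds -/

section Subsets

variable {F H X : Type*} [NormedAddCommGroup F] [NormedSpace ℝ F] [TopologicalSpace H]
  [TopologicalSpace X] [ChartedSpace H X]

/-- The algebra `C^∞(S)` of smooth functions on a subset `S` of a manifold `X`: the functions
`S → ℝ` that near each point of `S` are the restriction of a smooth function defined on an open
subset of `X`.  If `S` is an embedded submanifold, this is its usual algebra of smooth functions. -/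
def smoothFunctions (J : ModelWithCorners ℝ F H) (S : Set X) : Subalgebra ℝ (S → ℝ) where
  carrier := {h | ∀ p : S, ∃ U : Set X, IsOpen U ∧ (p : X) ∈ U ∧ ∃ k : X → ℝ,
    ContMDiffOn J 𝓘(ℝ, ℝ) ∞ k U ∧ ∀ y : S, (y : X) ∈ U → h y = k y}
  mul_mem' := by
    intro a b ha hb p
    obtain ⟨U, hU, hpU, k, hk, hak⟩ := ha p
    obtain ⟨W, hW, hpW, l, hl, hbl⟩ := hb p
    refine ⟨U ∩ W, hU.inter hW, ⟨hpU, hpW⟩, fun x => k x * l x,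
      (hk.mono Set.inter_subset_left).mul (hl.mono Set.inter_subset_right), ?_⟩
    intro y hy
    simp [hak y hy.1, hbl y hy.2]
  add_mem' := by
    intro a b ha hb p
    obtain ⟨U, hU, hpU, k, hk, hak⟩ := ha p
    obtain ⟨W, hW, hpW, l, hl, hbl⟩ := hb p
    refine ⟨U ∩ W, hU.inter hW, ⟨hpU, hpW⟩, fun x => k x + l x,
      (hk.mono Set.inter_subset_left).add (hl.mono Set.inter_subset_right), ?_⟩
    intro y hy
    simp [hak y hy.1, hbl y hy.2]
  algebraMap_mem' := by
    intro r p
    exact ⟨Set.univ, isOpen_univ, trivial, fun _ => r, contMDiffOn_const, fun _ _ => rfl⟩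

/-- The type `C^∞(S)` of smooth functions on `S`. -/
def SmoothFun (J : ModelWithCorners ℝ F H) (S : Set X) : Type _ := ↥(smoothFunctions J S)

instance (J : ModelWithCorners ℝ F H) (S : Set X) : CommRing (SmoothFun J S) :=
  inferInstanceAs (CommRing ↥(smoothFunctions J S))

instance (J : ModelWithCorners ℝ F H) (S : Set X) : Algebra ℝ (SmoothFun J S) :=
  inferInstanceAs (Algebra ℝ ↥(smoothFunctions J S))

instance (J : ModelWithCorners ℝ F H) (S : Set X) : Module ℝ (SmoothFun J S) := Algebra.toModule

instance (J : ModelWithCorners ℝ F H) (S : Set X) : FunLike (SmoothFun J S) S ℝ where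
  coe h := h.1
  coe_injective _ _ h := Subtype.ext h

/-- The vector fields on an embedded submanifold `S`, as the derivations of `C^∞(S)`; the Lie
bracket is the commutator. -/
abbrev VectorFields (J : ModelWithCorners ℝ F H) (S : Set X) : Type _ :=
  Derivation ℝ (SmoothFun J S) (SmoothFun J S)

end Subsets

section Manifold

variable {E : Type*} [NormedAddCommGroup E] [NormedSpace ℝ E]
  {M : Type*} [TopologicalSpace M] [ChartedSpace E M]

/-- The tangent space at `x` of a subset `Z` of `M`: the tangent vectors annihilated by the
differentials of all smooth functions near `x` that vanish on `Z`.  For a submanifold `Z` and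
`x ∈ Z` this is `T_x Z ⊆ T_x M`. -/
def tangentTo (Z : Set M) (x : M) : Submodule ℝ (TangentSpace 𝓘(ℝ, E) x) where
  carrier := {v | ∀ (U : Set M) (h : M → ℝ), IsOpen U → x ∈ U → ContMDiffOn 𝓘(ℝ, E) 𝓘(ℝ, ℝ) ∞ h U →
    (∀ y ∈ U ∩ Z, h y = 0) → mfderiv 𝓘(ℝ, E) 𝓘(ℝ, ℝ) h x v = 0}
  add_mem' := by
    intro a b ha hb U h hU hx hs hz
    rw [map_add, ha U h hU hx hs hz, hb U h hU hx hs hz, add_zero]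
  zero_mem' := by
    intro U h _ _ _ _
    exact map_zero _
  smul_mem' := by
    intro c a ha U h hU hx hs hz
    rw [map_smul, ha U h hU hx hs hz, smul_zero]

variable (E) in
/-- `Z` is a (possibly empty) embedded submanifold of codimension `k`: it is locally the zero set
of a submersion to `ℝ^k`. -/
def IsSubmanifoldOfCodim (k : ℕ) (Z : Set M) : Prop :=
  ∀ x ∈ Z, ∃ (U : Set M) (h : M → EuclideanSpace ℝ (Fin k)), IsOpen U ∧ x ∈ U ∧
    ContMDiffOn 𝓘(ℝ, E) 𝓘(ℝ, EuclideanSpace ℝ (Fin k)) ∞ h U ∧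
    Function.Surjective (mfderiv 𝓘(ℝ, E) 𝓘(ℝ, EuclideanSpace ℝ (Fin k)) h x) ∧
    ∀ y ∈ U, y ∈ Z ↔ h y = 0

/-- The Hessian of `f` at `x`, a bilinear form on `T_x M`, computed in the preferred chart at `x`
(the chart through which `T_x M` is identified with `E`).  It does not depend on the chart
if `x` is a critical point of `f`, and it is used at such points only. -/
def hessian (f : M → ℝ) (x : M) :
    TangentSpace 𝓘(ℝ, E) x →L[ℝ] TangentSpace 𝓘(ℝ, E) x →L[ℝ] ℝ :=
  (fderiv ℝ (fderiv ℝ (f ∘ (extChartAt 𝓘(ℝ, E) x).symm)) (extChartAt 𝓘(ℝ, E) x x) :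
    E →L[ℝ] E →L[ℝ] ℝ)

/-- The zeros of `f` in `U`. -/
def zerosIn (U : Set M) (f : M → ℝ) : Set M := {x | x ∈ U ∧ f x = 0}

variable (E) in
/-- The function `f` defines a smooth elliptic divisor on the open set `U` (on the trivial line
bundle): its zero set is a submanifold of codimension two which consists of critical points, and
the normal Hessian, i.e. the form induced by the Hessian on `T_x M / T_x Z`, is positive definite.
-/
structure IsSmoothElliptic (U : Set M) (f : M → ℝ) : Prop where
  smooth : ContMDiffOn 𝓘(ℝ, E) 𝓘(ℝ, ℝ) ∞ f U
  codim_two : IsSubmanifoldOfCodim E 2 (zerosIn U f)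
  critical : ∀ x ∈ zerosIn U f, mfderiv 𝓘(ℝ, E) 𝓘(ℝ, ℝ) f x = 0
  definite : ∀ x ∈ zerosIn U f, ∀ v : TangentSpace 𝓘(ℝ, E) x,
    v ∉ tangentTo (zerosIn U f) x → 0 < hessian f x v v

/-! ### Real divisors and elliptic divisors -/

section Divisors

variable {R : M → Type*} [TopologicalSpace (TotalSpace ℝ R)]
  [∀ x, AddCommGroup (R x)] [∀ x, Module ℝ (R x)] [∀ x, TopologicalSpace (R x)]
  [FiberBundle ℝ R]

variable (E)

/-- `(R, q)` is a real divisor: `q` is a smooth section of the line bundle `R` with nowhere dense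
zero set. -/
def IsRealDivisor (q : ∀ x, R x) : Prop :=
  ContMDiff 𝓘(ℝ, E) (𝓘(ℝ, E).prod 𝓘(ℝ, ℝ)) ∞ (fun x => TotalSpace.mk' ℝ x (q x)) ∧
    IsNowhereDense {x | q x = 0}

/-- `φ` is a smooth section over `U` of the dual line bundle `R^*`, i.e. a smooth function on
the total space of `R` over `U` that is linear on the fibres. -/
def IsSmoothDualSection (U : Set M) (φ : ∀ x, R x →ₗ[ℝ] ℝ) : Prop :=
  ContMDiffOn (𝓘(ℝ, E).prod 𝓘(ℝ, ℝ)) 𝓘(ℝ, ℝ) ∞ (fun v : TotalSpace ℝ R => φ v.1 v.2)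
    {v | v.1 ∈ U}

/-- The associated ideal `I_q ⊆ C^∞(M)`, the image of `q : Γ(R^*) → C^∞(M)`. -/
def ideal (q : ∀ x, R x) : Ideal C^∞⟮𝓘(ℝ, E), M; 𝓘(ℝ, ℝ), ℝ⟯ where
  carrier := {h | ∃ φ : ∀ x, R x →ₗ[ℝ] ℝ, IsSmoothDualSection E Set.univ φ ∧ ∀ x, h x = φ x (q x)}
  add_mem' := by
    rintro a b ⟨φ, hφ, ha⟩ ⟨ψ, hψ, hb⟩
    refine ⟨fun x => φ x + ψ x, ?_, fun x => ?_⟩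
    · exact ContMDiffOn.add hφ hψ
    · simp [ha x, hb x]
  zero_mem' := ⟨fun _ => 0, contMDiffOn_const, fun _ => rfl⟩
  smul_mem' := by
    rintro c a ⟨φ, hφ, ha⟩
    refine ⟨fun x => c x • φ x, ?_, fun x => ?_⟩
    · have hc : ContMDiffOn (𝓘(ℝ, E).prod 𝓘(ℝ, ℝ)) 𝓘(ℝ, ℝ) ∞
          (fun v : TotalSpace ℝ R => c v.1) {v | v.1 ∈ (Set.univ : Set M)} :=
        (c.contMDiff.comp (contMDiff_proj R)).contMDiffOn
      exact ContMDiffOn.mul hc hφ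
    · simp [ha x]

/-- The functions `f_1, …, f_j` generate local normal crossing elliptic divisors
`I_i = ⟨f_i⟩` for `(R, q)` on `U`: each `f_i` defines a smooth elliptic divisor, the vanishing loci
intersect transversely (at every `x`, the map from `T_x M` to the sum of the normal spaces at `x` of
the loci through `x` is onto), and `I_q(U) = I_1 ⋯ I_j = ⟨f_1 ⋯ f_j⟩` as ideals of `C^∞(U)`. -/
structure IsLocalNormalCrossing (q : ∀ x, R x) (U : Set M) {j : ℕ} (f : Fin j → M → ℝ) : Prop where
  elliptic : ∀ i, IsSmoothElliptic E U (f i)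
  transverse : ∀ x ∈ U, ∀ v : Fin j → TangentSpace 𝓘(ℝ, E) x, ∃ w : TangentSpace 𝓘(ℝ, E) x,
    ∀ i, f i x = 0 → w - v i ∈ tangentTo (zerosIn U (f i)) x
  ideal_eq : ∀ h : M → ℝ, ContMDiffOn 𝓘(ℝ, E) 𝓘(ℝ, ℝ) ∞ h U →
    ((∃ φ : ∀ x, R x →ₗ[ℝ] ℝ, IsSmoothDualSection E U φ ∧ ∀ x ∈ U, h x = φ x (q x)) ↔
      ∃ a : M → ℝ, ContMDiffOn 𝓘(ℝ, E) 𝓘(ℝ, ℝ) ∞ a U ∧ ∀ x ∈ U, h x = a x * ∏ i, f i x)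

/-- `(R, q)` is a (self-crossing) elliptic divisor. -/
def IsElliptic (q : ∀ x, R x) : Prop :=
  IsRealDivisor E q ∧ ∀ p : M, ∃ U : Set M, IsOpen U ∧ p ∈ U ∧
    ∃ (j : ℕ) (f : Fin j → M → ℝ), IsLocalNormalCrossing E q U f

/-- The intersection number of a point `p`: the least number of local normal crossing elliptic
divisors near `p`. -/
def pointIntersectionNumber (q : ∀ x, R x) (p : M) : ℕ :=
  sInf {j : ℕ | ∃ U : Set M, IsOpen U ∧ p ∈ U ∧
    ∃ f : Fin j → M → ℝ, IsLocalNormalCrossing E q U f}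

/-- The divisor has intersection number `n`: the maximum of the intersection numbers of the points
of `M` is `n`. -/
def HasIntersectionNumber (q : ∀ x, R x) (n : ℕ) : Prop :=
  IsGreatest (Set.range (pointIntersectionNumber E q)) n

/-- The stratum `D[n]` of points with intersection number exactly `n`. -/
def stratum (q : ∀ x, R x) (n : ℕ) : Set M :=
  {p | pointIntersectionNumber E q p = n}

/-! ### The elliptic tangent bundle and its restriction to a stratum -/

/-- The sections of the elliptic tangent bundle `𝒜`: the vector fields on `M` (as derivations of
`C^∞(M)`) that preserve the ideal `I_q`.  The anchor is the inclusion into all vector fields. -/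
def ellipticFields (q : ∀ x, R x) :
    LieRinehartSubalgebra C^∞⟮𝓘(ℝ, E), M; 𝓘(ℝ, ℝ), ℝ⟯
      (Derivation ℝ C^∞⟮𝓘(ℝ, E), M; 𝓘(ℝ, ℝ), ℝ⟯ C^∞⟮𝓘(ℝ, E), M; 𝓘(ℝ, ℝ), ℝ⟯) where
  carrier := {X | ∀ f ∈ ideal E q, X f ∈ ideal E q}
  add_mem' := by
    intro X Y hX hY f hf
    exact (ideal E q).add_mem (hX f hf) (hY f hf)
  zero_mem' := by
    intro f _
    exact (ideal E q).zero_mem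
  smul_mem' := by
    intro c X hX f hf
    exact (ideal E q).mul_mem_left c (hX f hf)
  lie_mem' := by
    intro X Y hX hY f hf
    rw [Derivation.commutator_apply]
    exact (ideal E q).sub_mem (hX _ (hY f hf)) (hY _ (hX f hf))

/-- The maximal ideal of smooth functions on `M` that vanish at `x`. -/
def vanishingAt {M : Type*} [TopologicalSpace M] [ChartedSpace E M] (x : M) :
    Ideal C^∞⟮𝓘(ℝ, E), M; 𝓘(ℝ, ℝ), ℝ⟯ where
  carrier := {f | f x = 0}
  add_mem' := by
    intro a b ha hb
    simp only [Set.mem_ofPred_eq] at ha hb ⊢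
    simp [ha, hb]
  zero_mem' := rfl
  smul_mem' := by
    intro c a ha
    simp only [Set.mem_ofPred_eq] at ha ⊢
    simp [ha]

instance (q : ∀ x, R x) : AddCommGroup ↥(ellipticFields E q) := inferInstance

instance (q : ∀ x, R x) : Module C^∞⟮𝓘(ℝ, E), M; 𝓘(ℝ, ℝ), ℝ⟯ ↥(ellipticFields E q) := inferInstance

/-- The submodule `𝔪_x Γ(𝒜)` of `Γ(𝒜)`. -/
def vanishingSections (q : ∀ x, R x) (x : M) :
    Submodule C^∞⟮𝓘(ℝ, E), M; 𝓘(ℝ, ℝ), ℝ⟯ ↥(ellipticFields E q) :=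
  vanishingAt E x • (⊤ : Submodule C^∞⟮𝓘(ℝ, E), M; 𝓘(ℝ, ℝ), ℝ⟯ ↥(ellipticFields E q))

/-- The fibre `𝒜_x = Γ(𝒜) / 𝔪_x Γ(𝒜)` of the elliptic tangent bundle at `x`. -/
def EllipticFiber (q : ∀ x, R x) (x : M) : Type _ :=
  ↥(ellipticFields E q) ⧸ vanishingSections E q x

instance (q : ∀ x, R x) (x : M) : AddCommGroup (EllipticFiber E q x) :=
  inferInstanceAs (AddCommGroup (↥(ellipticFields E q) ⧸ vanishingSections E q x))

instance (q : ∀ x, R x) (x : M) :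
    Module C^∞⟮𝓘(ℝ, E), M; 𝓘(ℝ, ℝ), ℝ⟯ (EllipticFiber E q x) :=
  inferInstanceAs (Module C^∞⟮𝓘(ℝ, E), M; 𝓘(ℝ, ℝ), ℝ⟯
    (↥(ellipticFields E q) ⧸ vanishingSections E q x))

instance (q : ∀ x, R x) (x : M) : Module ℝ (EllipticFiber E q x) :=
  Module.compHom _ (algebraMap ℝ C^∞⟮𝓘(ℝ, E), M; 𝓘(ℝ, ℝ), ℝ⟯)

/-- The value in the fibre `𝒜_x` of a section of the elliptic tangent bundle. -/
def valueAt (q : ∀ x, R x) (x : M) :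
    ↥(ellipticFields E q) →ₗ[C^∞⟮𝓘(ℝ, E), M; 𝓘(ℝ, ℝ), ℝ⟯] EllipticFiber E q x :=
  (vanishingSections E q x).mkQ

theorem valueAt_smul (q : ∀ x, R x) (x : M) (g : C^∞⟮𝓘(ℝ, E), M; 𝓘(ℝ, ℝ), ℝ⟯)
    (X : ellipticFields E q) : valueAt E q x (g • X) =
      (g x : ℝ) • valueAt E q x X := by
  have h2 : g • X - algebraMap ℝ C^∞⟮𝓘(ℝ, E), M; 𝓘(ℝ, ℝ), ℝ⟯ (g x) • X =
      (g - algebraMap ℝ C^∞⟮𝓘(ℝ, E), M; 𝓘(ℝ, ℝ), ℝ⟯ (g x)) • X := (sub_smul _ _ _).symm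
  refine (Submodule.Quotient.eq _).2 ?_
  exact h2 ▸ Submodule.smul_mem_smul (sub_self (g x)) trivial

/-- The section `X` of `𝒜` agrees near the point `x` of `S` with the family `s` of elements of the
fibres of `𝒜` over `S`. -/
def RepresentsNear (q : ∀ x, R x) {S : Set M} (X : ellipticFields E q)
    (s : ∀ x : S, EllipticFiber E q x) (x : S) : Prop :=
  ∃ U : Set M, IsOpen U ∧ (x : M) ∈ U ∧ ∀ y : S, (y : M) ∈ U → s y = valueAt E q y X


variable [FiniteDimensional ℝ E] [T2Space M] [IsManifold 𝓘(ℝ, E) ∞ M]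

/-- A smooth function near `x` agrees near `x` with a globally defined smooth function. -/
theorem exists_global_extension {U : Set M} (hU : IsOpen U) {x : M} (hx : x ∈ U) {k : M → ℝ}
    (hk : ContMDiffOn 𝓘(ℝ, E) 𝓘(ℝ, ℝ) ∞ k U) :
    ∃ (g : C^∞⟮𝓘(ℝ, E), M; 𝓘(ℝ, ℝ), ℝ⟯) (W : Set M), IsOpen W ∧ x ∈ W ∧ W ⊆ U ∧
      ∀ y ∈ W, g y = k y := by
  obtain ⟨f, -, hf⟩ := (SmoothBumpFunction.nhds_basis_tsupport (I := 𝓘(ℝ, E)) x).mem_iff.1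
    (hU.mem_nhds hx)
  have hs : ContMDiff 𝓘(ℝ, E) 𝓘(ℝ, ℝ) ∞ (fun y => f y • k y) := by
    intro y
    by_cases hy : y ∈ tsupport f
    · exact f.contMDiffAt.smul ((hk y (hf hy)).contMDiffAt (hU.mem_nhds (hf hy)))
    · have h0 : (fun y => f y • k y) =ᶠ[𝓝 y] fun _ => 0 := by
        filter_upwards [(isClosed_tsupport f).isOpen_compl.mem_nhds hy] with z hz
        rw [image_eq_zero_of_notMem_tsupport hz, zero_smul]
      exact contMDiffAt_const.congr_of_eventuallyEq h0
  obtain ⟨W, hW, hWo, hxW⟩ := mem_nhds_iff.1 f.eventuallyEq_one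
  refine ⟨⟨_, hs⟩, W ∩ U, hWo.inter hU, ⟨hxW, hx⟩, Set.inter_subset_right, fun y hy => ?_⟩
  have h1 : f y = 1 := hW hy.1
  change f y • k y = k y
  rw [h1, one_smul]

/-- Families of elements of the fibres over `S` form a module over `C^∞(S)`, pointwise. -/
instance restrictedModule (q : ∀ x, R x) (S : Set M) :
    Module (SmoothFun 𝓘(ℝ, E) S) (∀ x : S, EllipticFiber E q x) where
  smul h s := fun x => h.1 x • s x
  one_smul s := funext fun x => one_smul ℝ (s x)
  mul_smul a b s := funext fun x => mul_smul (a.1 x) (b.1 x) (s x)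
  smul_zero a := funext fun x => smul_zero (a.1 x)
  smul_add a s t := funext fun x => smul_add (a.1 x) (s x) (t x)
  add_smul a b s := funext fun x => add_smul (a.1 x) (b.1 x) (s x)
  zero_smul s := funext fun x => zero_smul ℝ (s x)

/-- The module `Γ(𝒜|_S)` over `C^∞(S)` of sections of the restriction of the elliptic tangent bundle
to `S`: the families of elements of the fibres `𝒜_x`, `x ∈ S`, that near each point of `S` are the
restriction of a section of `𝒜`. -/
def restrictedSections (q : ∀ x, R x) (S : Set M) :
    Submodule (SmoothFun 𝓘(ℝ, E) S) (∀ x : S, EllipticFiber E q x) where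
  carrier := {s | ∀ x : S, ∃ X : ellipticFields E q, RepresentsNear E q X s x}
  add_mem' := by
    intro s t hs ht x
    obtain ⟨X, U, hU, hxU, hX⟩ := hs x
    obtain ⟨Y, W, hW, hxW, hY⟩ := ht x
    refine ⟨X + Y, U ∩ W, hU.inter hW, ⟨hxU, hxW⟩, fun y hy => ?_⟩
    rw [Pi.add_apply, hX y hy.1, hY y hy.2, map_add]
  zero_mem' := fun x => ⟨0, Set.univ, isOpen_univ, trivial, fun y _ => (map_zero (valueAt E q y)).symm⟩
  smul_mem' := by
    intro h s hs x
    obtain ⟨X, U, hU, hxU, hX⟩ := hs x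
    obtain ⟨W, hW, hxW, k, hk, hhk⟩ := h.2 x
    obtain ⟨g, W', hW', hxW', hsub, hg⟩ := exists_global_extension E hW hxW hk
    refine ⟨g • X, U ∩ W', hU.inter hW', ⟨hxU, hxW'⟩, fun y hy => ?_⟩
    have h1 : (h • s) y = (h.1 y) • s y := rfl
    have h2 : h.1 y = g y := by rw [hhk y (hsub hy.2), hg y hy.2]
    rw [h1, hX y hy.1, h2]
    exact (valueAt_smul E q y g X).symm

/-! ### The structure group and the reduction of the frame bundle of the normal bundle -/

/-- The model `(ℝ²)^n` of the fibres of the normal bundle of the stratum `D[n]`. -/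
abbrev NormalModel (n : ℕ) : Type := Fin n → EuclideanSpace ℝ (Fin 2)

/-- The group `(O(2) × ℝ_+)^n ⋊ S_n`, as the group of those linear automorphisms of `(ℝ²)^n`
which permute the `n` summands and are the composition of an isometry and a positive
scaling on each of them. -/
def structureGroup (n : ℕ) : Subgroup (NormalModel n ≃L[ℝ] NormalModel n) where
  carrier := {g | ∃ (σ : Equiv.Perm (Fin n)) (c : Fin n → ℝ)
    (A : Fin n → (EuclideanSpace ℝ (Fin 2) ≃ₗᵢ[ℝ] EuclideanSpace ℝ (Fin 2))),
    (∀ i, 0 < c i) ∧ ∀ (v : NormalModel n) (i : Fin n), g v (σ i) = c i • A i (v i)}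
  mul_mem' := by
    rintro g h ⟨σ, c, A, hc, hg⟩ ⟨τ, d, B, hd, hh⟩
    refine ⟨σ * τ, fun i => c (τ i) * d i, fun i => (B i).trans (A (τ i)),
      fun i => mul_pos (hc _) (hd _), fun v i => ?_⟩
    have : (g * h) v = g (h v) := rfl
    rw [this, Equiv.Perm.mul_apply, hg, hh, map_smul, smul_smul]
    rfl
  one_mem' := ⟨1, fun _ => 1, fun _ => LinearIsometryEquiv.refl ℝ _, fun _ => one_pos,
    fun v i => by
      rw [one_smul]; rfl⟩
  inv_mem' := by
    rintro g ⟨σ, c, A, hc, hg⟩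
    refine ⟨σ⁻¹, fun i => (c (σ⁻¹ i))⁻¹, fun i => (A (σ⁻¹ i)).symm,
      fun i => inv_pos.2 (hc _), fun v i => ?_⟩
    obtain ⟨w, rfl⟩ := g.surjective v
    have h1 : (g⁻¹ : NormalModel n ≃L[ℝ] NormalModel n) (g w) = w := g.symm_apply_apply w
    have h2 := hg w (σ⁻¹ i)
    rw [show σ (σ⁻¹ i) = i from σ.apply_symm_apply i] at h2
    rw [h1, h2, map_smul, smul_smul, inv_mul_cancel₀ (hc _).ne', one_smul,
      LinearIsometryEquiv.symm_apply_apply]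

/-- The total space of the smooth vector bundle `Hom(TM, (ℝ²)^n)` over `M`. -/
abbrev HomBundle (E : Type*) [NormedAddCommGroup E] [NormedSpace ℝ E]
    (M : Type*) [TopologicalSpace M] [ChartedSpace E M] (n : ℕ) : Type _ :=
  TotalSpace (E →L[ℝ] NormalModel n)
    (fun x : M => TangentSpace 𝓘(ℝ, E) x →L[ℝ] Bundle.Trivial M (NormalModel n) x)

/-- The model with corners of the manifold `Hom(TM, (ℝ²)^n)`. -/
abbrev homModel (n : ℕ) := 𝓘(ℝ, E).prod 𝓘(ℝ, E →L[ℝ] NormalModel n)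

/-- The structure group reduction `P` of the frame bundle of the normal bundle `N D[n]`.
A frame `u : (ℝ²)^n ≃ N_x D[n] = T_x M / T_x D[n]` is recorded by the composition
`θ : T_x M → N_x D[n] → (ℝ²)^n` of the projection and `u⁻¹`; the maps `θ` that occur are the
surjective ones with kernel `T_x D[n]`, and this embeds the frame bundle in `Hom(TM, (ℝ²)^n)`.
The frame `u` lies in `P` if there are local normal crossing elliptic divisors near `x` with
non-negative representatives `f_1, …, f_n` such that the restriction `u_i` of `u` to the `i`-th
summand is an orthonormal frame of `N_x D_i` for the normal Hessian of `f_i`, for all `i`, where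
`N_x D[n] = N_x D_1 ⊕ ⋯ ⊕ N_x D_n`.  That is, `Hess f_i` is the pullback under the `i`-th component
of `θ` of the standard inner product of `ℝ²`. -/
def reduction (q : ∀ x, R x) (n : ℕ) : Set (HomBundle E M n) :=
  {p | p.1 ∈ stratum E q n ∧ Function.Surjective p.2 ∧
    (∀ v : TangentSpace 𝓘(ℝ, E) p.1, p.2 v = (0 : NormalModel n) ↔ v ∈ tangentTo (stratum E q n) p.1) ∧
    ∃ U : Set M, IsOpen U ∧ p.1 ∈ U ∧ ∃ f : Fin n → M → ℝ,
      IsLocalNormalCrossing E q U f ∧ (∀ i, ∀ y ∈ U, 0 ≤ f i y) ∧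
      ∀ (i : Fin n) (v w : TangentSpace 𝓘(ℝ, E) p.1),
        hessian (f i) p.1 v w = ⟪(p.2 v : NormalModel n) i, (p.2 w : NormalModel n) i⟫_ℝ}

/-- The projection `P → D[n]`. -/
def projection (q : ∀ x, R x) (n : ℕ) (p : reduction E q n) : stratum E q n := ⟨p.1.1, p.2.1⟩


theorem hessian_const_mul (c : ℝ) (f : M → ℝ) (x : M) :
    hessian (E := E) (fun y => c * f y) x = c • hessian f x := by
  have h3 : fderiv ℝ (fderiv ℝ (c • (f ∘ (extChartAt 𝓘(ℝ, E) x).symm)))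
      (extChartAt 𝓘(ℝ, E) x x) =
      c • fderiv ℝ (fderiv ℝ (f ∘ (extChartAt 𝓘(ℝ, E) x).symm)) (extChartAt 𝓘(ℝ, E) x x) := by
    rw [fderiv_const_smul_field]
    exact congrFun (fderiv_const_smul_field (𝕜 := ℝ)
      (f := fderiv ℝ (f ∘ (extChartAt 𝓘(ℝ, E) x).symm)) c) _
  exact h3

theorem zerosIn_const_mul {c : ℝ} (hc : c ≠ 0) (U : Set M) (f : M → ℝ) :
    zerosIn U (fun y => c * f y) = zerosIn U f := by
  ext y
  simp [zerosIn, hc]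

theorem IsSmoothElliptic.const_mul {c : ℝ} (hc : 0 < c) {U : Set M} (hU : IsOpen U) {f : M → ℝ}
    (h : IsSmoothElliptic E U f) : IsSmoothElliptic E U (fun y => c * f y) where
  smooth := contMDiffOn_const.mul h.smooth
  codim_two := by
    rw [zerosIn_const_mul hc.ne']
    exact h.codim_two
  critical := by
    rw [zerosIn_const_mul hc.ne']
    intro x hx
    have h1 : mfderiv 𝓘(ℝ, E) 𝓘(ℝ, ℝ) (c • f) x = c • mfderiv 𝓘(ℝ, E) 𝓘(ℝ, ℝ) f x :=
      const_smul_mfderiv (((h.smooth x hx.1).contMDiffAt (hU.mem_nhds hx.1)).mdifferentiableAt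
        (by simp)) c
    rw [h.critical x hx] at h1
    exact h1.trans (smul_zero c)
  definite := by
    rw [zerosIn_const_mul hc.ne']
    intro x hx v hv
    have h1 : hessian (fun y => c * f y) x v v = c * hessian f x v v := by
      rw [hessian_const_mul]; rfl
    rw [h1]
    exact mul_pos hc (h.definite x hx v hv)

theorem IsLocalNormalCrossing.rescale {q : ∀ x, R x} {U : Set M} (hU : IsOpen U) {n : ℕ} {f : Fin n → M → ℝ}
    (h : IsLocalNormalCrossing E q U f) (σ : Equiv.Perm (Fin n)) (c : Fin n → ℝ)
    (hc : ∀ i, 0 < c i) :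
    IsLocalNormalCrossing E q U (fun i y => c i * f (σ i) y) where
  elliptic i := (h.elliptic (σ i)).const_mul E (hc i) hU
  transverse := by
    intro x hx v
    obtain ⟨w, hw⟩ := h.transverse x hx (fun i => v (σ.symm i))
    refine ⟨w, fun i hi => ?_⟩
    rw [zerosIn_const_mul (hc i).ne']
    have h1 := hw (σ i) ((mul_eq_zero.1 hi).resolve_left (hc i).ne')
    rwa [Equiv.symm_apply_apply] at h1
  ideal_eq := by
    intro k hk
    have hC : 0 < ∏ i, c i := Finset.prod_pos fun i _ => hc i
    have hp : ∀ x, ∏ i, (c i * f (σ i) x) = (∏ i, c i) * ∏ i, f i x := by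
      intro x
      rw [Finset.prod_mul_distrib, Equiv.prod_comp σ (fun i => f i x)]
    rw [h.ideal_eq k hk]
    constructor
    · rintro ⟨a, ha, hka⟩
      refine ⟨fun x => (∏ i, c i)⁻¹ * a x, contMDiffOn_const.mul ha, fun x hx => ?_⟩
      rw [hka x hx, hp]
      field_simp
    · rintro ⟨a, ha, hka⟩
      refine ⟨fun x => (∏ i, c i) * a x, contMDiffOn_const.mul ha, fun x hx => ?_⟩
      rw [hka x hx, hp]
      ring

/-- The automorphism of the vector bundle `Hom(TM, (ℝ²)^n)` which extends the right action
`u ↦ u ∘ g` on frames of the normal bundle. -/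
def actHom {n : ℕ} (g : NormalModel n ≃L[ℝ] NormalModel n) (p : HomBundle E M n) :
    HomBundle E M n :=
  ⟨p.1, ((g⁻¹ : NormalModel n ≃L[ℝ] NormalModel n) : NormalModel n →L[ℝ] NormalModel n).comp p.2⟩

theorem contMDiff_actHom {n : ℕ} (g : NormalModel n ≃L[ℝ] NormalModel n) :
    ContMDiff (homModel E n) (homModel E n) ∞ (actHom E (M := M) g) := by
  intro p
  have hid : ContMDiffAt (homModel E n) (homModel E n) ∞ (fun p : HomBundle E M n => p) p :=
    contMDiffAt_id
  rw [contMDiffAt_hom_bundle] at hid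
  refine (contMDiffAt_hom_bundle _).2 ⟨hid.1, ?_⟩
  have h2 := ((ContinuousLinearMap.compL ℝ E (NormalModel n) (NormalModel n)
    ((g⁻¹ : NormalModel n ≃L[ℝ] NormalModel n) :
      NormalModel n →L[ℝ] NormalModel n)).contMDiff (n := ∞)).contMDiffAt.comp p hid.2
  refine h2.congr_of_eventuallyEq (Filter.Eventually.of_forall fun y => ?_)
  ext v
  simp [actHom, ContinuousLinearMap.inCoordinates]

theorem actHom_mem {q : ∀ x, R x} {n : ℕ} (g : structureGroup n) {p : HomBundle E M n}
    (hp : p ∈ reduction E q n) : actHom E (g : NormalModel n ≃L[ℝ] NormalModel n) p ∈ reduction E q n := by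
  obtain ⟨hx, hsurj, hker, U, hU, hpU, f, hf, hpos, hhess⟩ := hp
  obtain ⟨σ, c, A, hc, hg⟩ := (g⁻¹).2
  have hval : ∀ v, (actHom E (g : NormalModel n ≃L[ℝ] NormalModel n) p).2 v =
      ((g⁻¹ : structureGroup n) : NormalModel n ≃L[ℝ] NormalModel n) (p.2 v) := fun _ => rfl
  refine ⟨hx, ?_, ?_, U, hU, hpU, fun i y => c (σ.symm i) ^ 2 * f (σ.symm i) y,
    hf.rescale E hU σ.symm _ fun i => pow_pos (hc _) 2,
    fun i y hy => mul_nonneg (sq_nonneg _) (hpos _ y hy), ?_⟩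
  · exact (ContinuousLinearEquiv.surjective
      ((g⁻¹ : structureGroup n) : NormalModel n ≃L[ℝ] NormalModel n)).comp hsurj
  · intro v
    rw [hval]
    exact (map_eq_zero_iff _ (ContinuousLinearEquiv.injective
      ((g⁻¹ : structureGroup n) : NormalModel n ≃L[ℝ] NormalModel n))).trans (hker v)
  · intro i v w
    obtain ⟨j, rfl⟩ := σ.surjective i
    rw [hval, hval, hg, hg, hessian_const_mul, Equiv.symm_apply_apply, real_inner_smul_left, real_inner_smul_right, LinearIsometryEquiv.inner_map_map]
    have h3 := hhess j v w
    change c j ^ 2 * hessian (f j) p.1 v w = _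
    rw [h3]
    ring

/-- The right action of the structure group on `P`. -/
def act (q : ∀ x, R x) {n : ℕ} (g : structureGroup n) (p : reduction E q n) : reduction E q n :=
  ⟨actHom E g p, actHom_mem E g p.2⟩

/-- The pullback `R_g^* : C^∞(P) → C^∞(P)` of functions under the action of `g`. -/
def actPullback (q : ∀ x, R x) {n : ℕ} (g : structureGroup n)
    (h : SmoothFun (homModel E n) (reduction E q n)) :
    SmoothFun (homModel E n) (reduction E q n) :=
  ⟨fun p => h.1 (act E q g p), fun p => by
    obtain ⟨U, hU, hpU, k, hk, hhk⟩ := h.2 (act E q g p)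
    have hc := contMDiff_actHom E (M := M) (g : NormalModel n ≃L[ℝ] NormalModel n)
    exact ⟨_, hU.preimage hc.continuous, hpU, _, hk.comp hc.contMDiffOn (fun _ h => h),
      fun y hy => hhk (act E q g y) hy⟩⟩

/-- The pullback `π^* : C^∞(D[n]) → C^∞(P)` of functions under the projection. -/
def projPullback (q : ∀ x, R x) (n : ℕ) :
    SmoothFun 𝓘(ℝ, E) (stratum E q n) →ₐ[ℝ]
      SmoothFun (homModel E n) (reduction E q n) where
  toFun h := ⟨fun p => h.1 (projection E q n p), fun p => by
    obtain ⟨U, hU, hpU, k, hk, hhk⟩ := h.2 (projection E q n p)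
    have hc : ContMDiff (homModel E n) 𝓘(ℝ, E) ∞ (fun p : HomBundle E M n => p.1) :=
      contMDiff_proj _
    exact ⟨_, hU.preimage hc.continuous, hpU, _, hk.comp hc.contMDiffOn (fun _ h => h),
      fun y hy => hhk (projection E q n y) hy⟩⟩
  map_one' := rfl
  map_mul' _ _ := rfl
  map_zero' := rfl
  map_add' _ _ := rfl
  commutes' _ := rfl

/-- The restriction of a smooth function on `M` to a subset. -/
def restrict (S : Set M) (f : C^∞⟮𝓘(ℝ, E), M; 𝓘(ℝ, ℝ), ℝ⟯) : SmoothFun 𝓘(ℝ, E) S :=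
  ⟨fun x => f x, fun _ => ⟨Set.univ, isOpen_univ, trivial, f, f.contMDiff.contMDiffOn,
    fun _ _ => rfl⟩⟩

/-! ### The Atiyah algebroid -/

/-- The sections of the Atiyah algebroid `At(P) = TP / G` of the principal bundle `P → D[n]` with
group `G = (O(2) × ℝ_+)^n ⋊ S_n`: the `G`-invariant vector fields on `P`, with the Lie bracket of
vector fields. -/
def atiyahSections (q : ∀ x, R x) (n : ℕ) :
    LieSubalgebra ℝ (VectorFields (homModel E n) (reduction E q n)) where
  carrier := {D | ∀ (g : structureGroup n) (h : SmoothFun (homModel E n) (reduction E q n)),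
    D (actPullback E q g h) = actPullback E q g (D h)}
  add_mem' := by
    intro D D' hD hD' g h
    rw [Derivation.add_apply, Derivation.add_apply, hD, hD']
    rfl
  zero_mem' := fun _ _ => rfl
  smul_mem' := by
    intro c D hD g h
    rw [Derivation.smul_apply, Derivation.smul_apply, hD]
    rfl
  lie_mem' := by
    intro D D' hD hD' g h
    rw [Derivation.commutator_apply, Derivation.commutator_apply, hD', hD, hD, hD']
    rfl

/-- `Γ(At(P))` is a module over `C^∞(D[n])`, through the pullback of functions to `P`. -/
instance atiyahModule (q : ∀ x, R x) (n : ℕ) :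
    Module (SmoothFun 𝓘(ℝ, E) (stratum E q n)) ↥(atiyahSections E q n) where
  smul f D := ⟨projPullback E q n f • (D : VectorFields (homModel E n) (reduction E q n)), by
    intro g h
    rw [Derivation.smul_apply, Derivation.smul_apply, D.2 g h]
    rfl⟩
  one_smul D := Subtype.ext ((congrArg (· • D.1) (map_one (projPullback E q n))).trans
    (one_smul _ D.1))
  mul_smul a b D := Subtype.ext ((congrArg (· • D.1) (map_mul (projPullback E q n) a b)).trans
    (mul_smul _ _ D.1))
  smul_zero a := Subtype.ext (smul_zero (projPullback E q n a))
  smul_add a D D' := Subtype.ext (smul_add (projPullback E q n a) D.1 D'.1)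
  add_smul a b D := Subtype.ext ((congrArg (· • D.1) (map_add (projPullback E q n) a b)).trans
    (add_smul _ _ D.1))
  zero_smul D := Subtype.ext ((congrArg (· • D.1) (map_zero (projPullback E q n))).trans
    (zero_smul _ D.1))

/-! ### Brackets and anchors -/

/-- `u` is the bracket of the sections `s` and `t` of the restriction of `𝒜` to `S`: if `X` and `Y`
extend `s` and `t` near a point, then `⁅X, Y⁆` extends `u` near that point. -/
def IsRestrictedBracket (q : ∀ x, R x) {S : Set M} (s t u : restrictedSections E q S) : Prop :=
  ∀ (x : S) (X Y : ellipticFields E q), RepresentsNear E q X s.1 x → RepresentsNear E q Y t.1 x →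
    RepresentsNear E q ⁅X, Y⁆ u.1 x

/-- The vector field `Z` on `S` is the image of the section `s` of the restriction of `𝒜` to `S`
under the anchor: if the vector field `X` on `M` extends `s` near a point of `S`, then `X` and `Z`
agree at that point. -/
def IsRestrictedAnchor (q : ∀ x, R x) {S : Set M} (s : restrictedSections E q S)
    (Z : VectorFields 𝓘(ℝ, E) S) : Prop :=
  ∀ (x : S) (X : ellipticFields E q), RepresentsNear E q X s.1 x →
    ∀ f : C^∞⟮𝓘(ℝ, E), M; 𝓘(ℝ, ℝ), ℝ⟯, Z (restrict E S f) x = X.1 f x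

/-- The vector field `Z` on `D[n]` is the image of the section `D` of `At(P)` under the anchor:
the differential of `π : P → D[n]` maps `D` to `Z`. -/
def IsAtiyahAnchor (q : ∀ x, R x) (n : ℕ) (D : atiyahSections E q n)
    (Z : VectorFields 𝓘(ℝ, E) (stratum E q n)) : Prop :=
  ∀ h : SmoothFun 𝓘(ℝ, E) (stratum E q n), D.1 (projPullback E q n h) = projPullback E q n (Z h)

/-- An isomorphism between the Lie algebroids `𝒜|_{D[n]}` and `At(P)` over the identity of `D[n]`:
an isomorphism of the modules of sections over `C^∞(D[n])` (hence of vector bundles) which respects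
the brackets and the anchors. -/
structure LieAlgebroidIso (q : ∀ x, R x) (n : ℕ) where
  toEquiv : ↥(restrictedSections E q (stratum E q n))
    ≃ₗ[SmoothFun 𝓘(ℝ, E) (stratum E q n)] ↥(atiyahSections E q n)
  map_bracket : ∀ s t, IsRestrictedBracket E q s t (toEquiv.symm ⁅toEquiv s, toEquiv t⁆)
  map_anchor : ∀ s, ∃ Z : VectorFields 𝓘(ℝ, E) (stratum E q n),
    IsRestrictedAnchor E q s Z ∧ IsAtiyahAnchor E q n (toEquiv s) Z

end Divisors
end Manifold
end EllipticDivisor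
end

set_option linter.unusedSectionVars false
set_option autoImplicit false

noncomputable section

namespace EllipticDivisor

/-! ### Hadamard's lemma -/

section Hadamard

open MeasureTheory

/-! Local form. Near a point of `D[n]` the Morse–Bott lemma `IsLocalNormalCrossing.exists_sum_sq`
yields coordinates z_1, …, z_n in ℂ and t in ℝ^d such that I_q is generated by |z_1|² ⋯ |z_n|² and
D[n] = {z = 0}; they are recorded in `AdaptedChart`. The rotations and scalings of the single z_i
and the fields ∂/∂t_l preserve the ideal. Conversely, a vector field X that preserves it has X z_i =
ζ_i z_i with smooth complex-valued ζ_i = a_i + i b_i (`AdaptedChart.exists_conformal`). This is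
where analysis enters: invariance only says that z divides conj z · Q · (X z) for a function Q of
the other coordinates that is nonzero on a dense set, and `exists_eq_fst_mul` concludes that z
divides X z. Hence the value of X in the fibre of 𝒜 at a point of D[n] amounts to the numbers ζ_i
and the derivatives X t_l there.

Frames. Two frames in P over the same point differ by a linear automorphism g of (ℝ²)^n with ∏ |(g
w)_i|² = c ∏ |w_i|², because the two local generators of I_q differ by a nonvanishing factor and
their leading terms are products of Hessians. Such a g lies in G (`mem_structureGroup_of_prod`). So
the normal coordinates give a local section of P that reaches all frames under G, and near a given
frame P is parametrised by t and n nonzero complex numbers (`AdaptedChart.frameChart`).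

The isomorphism is linearisation along D[n]. A section X of 𝒜 is tangent to D[n], so it preserves
the functions vanishing there. Its lift to P at a frame u is the tangent vector v with v(f ∘ π) = X
f for all f, and v(dk(u m)) = d(X k)(u m) for all k vanishing on D[n] and all m in (ℝ²)^n
(`IsLift`). In frame coordinates the lift exists, is unique, and has components ζ_i and X t_l when
the chart is centred at u. It therefore vanishes exactly when X vanishes in the fibre of 𝒜, which
makes the map on fibres well defined and injective. Both conditions are natural in the frame and
stable under commutators, which gives G-invariance and compatibility with brackets, while the first
condition is compatibility with anchors. For surjectivity, the components of an invariant field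
along the section of P given by the normal coordinates are taken as coefficients of a section of 𝒜,
and invariance extends the equality from this section to whole fibres (`exists_lift_eq`). -/

theorem contDiff_integral_nat {V : Type} [NormedAddCommGroup V] [NormedSpace ℝ V]
    [FiniteDimensional ℝ V] (m : ℕ) : ∀ {F : Type} [NormedAddCommGroup F] [NormedSpace ℝ F]
    [CompleteSpace F] {g : ℝ × V → F}, ContDiff ℝ ∞ g →
    ContDiff ℝ m (fun v => ∫ t in (0 : ℝ)..1, g (t, v)) := by
  -- Differentiation under the integral; the derivative is dominated by its maximum over the compact
  -- set [0,1] × closed unit ball around v.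
  have key : ∀ {F : Type} [NormedAddCommGroup F] [NormedSpace ℝ F] [CompleteSpace F]
      {g : ℝ × V → F}, ContDiff ℝ ∞ g → ∀ v, HasFDerivAt (fun v => ∫ t in (0 : ℝ)..1, g (t, v))
        (∫ t in (0 : ℝ)..1, (fderiv ℝ g (t, v)).comp (ContinuousLinearMap.inr ℝ ℝ V)) v := by
    intro F _ _ _ g hg v
    have hcd : Continuous fun p : ℝ × V =>
        (fderiv ℝ g p).comp (ContinuousLinearMap.inr ℝ ℝ V) :=
      ((hg.continuous_fderiv (by simp))).clm_comp continuous_const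
    obtain ⟨C, hC⟩ := (isCompact_Icc (a := (0 : ℝ)) (b := 1)).prod
      (isCompact_closedBall v 1) |>.exists_bound_of_continuousOn hcd.continuousOn
    refine intervalIntegral.hasFDerivAt_integral_of_dominated_of_fderiv_le
      (bound := fun _ => C) (F' := fun x t => (fderiv ℝ g (t, x)).comp (ContinuousLinearMap.inr ℝ ℝ V))
      (Metric.closedBall_mem_nhds v one_pos) ?_ ?_ ?_ ?_ ?_ ?_
    · refine Filter.Eventually.of_forall fun x => Continuous.aestronglyMeasurable ?_
      exact hg.continuous.comp (by fun_prop)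
    · exact (hg.continuous.comp (by fun_prop : Continuous fun t : ℝ => (t, v))).intervalIntegrable _ _
    · exact (hcd.comp (by fun_prop : Continuous fun t : ℝ => (t, v))).aestronglyMeasurable
    · refine Filter.Eventually.of_forall fun t ht x hx => hC (t, x) ⟨?_, hx⟩
      rw [Set.uIoc_of_le zero_le_one] at ht
      exact ⟨ht.1.le, ht.2⟩
    · exact intervalIntegrable_const
    · refine Filter.Eventually.of_forall fun t _ x _ => ?_
      have h1 : HasFDerivAt g (fderiv ℝ g (t, x)) (t, x) :=
        (hg.differentiable (by simp) _).hasFDerivAt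
      exact h1.comp x (hasFDerivAt_prodMk_right t x)
  induction m with
  | zero =>
    intro F _ _ _ g hg
    exact contDiff_zero.2 (continuous_iff_continuousAt.2 fun v => (key hg v).continuousAt)
  | succ m ih =>
    intro F _ _ _ g hg
    -- The derivative is an integral of the same kind with values in `V →L[ℝ] F`; this is why the
    -- target space is quantified inside the induction.
    refine (contDiff_succ_iff_hasFDerivAt (n := (m : ℕ))).2 ⟨_, ?_, key hg⟩
    exact ih (g := fun p => (fderiv ℝ g p).comp (ContinuousLinearMap.inr ℝ ℝ V))
      ((hg.fderiv_right (m := ∞) (by simp)).clm_comp contDiff_const)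

theorem contDiff_integral {V F : Type} [NormedAddCommGroup V] [NormedSpace ℝ V]
    [FiniteDimensional ℝ V] [NormedAddCommGroup F] [NormedSpace ℝ F]
    [CompleteSpace F] {g : ℝ × V → F} (hg : ContDiff ℝ ∞ g) :
    ContDiff ℝ ∞ (fun v => ∫ t in (0 : ℝ)..1, g (t, v)) :=
  contDiff_infty.2 fun m => contDiff_integral_nat m hg

/-- Hadamard's lemma with parameters. -/
theorem exists_hadamard {V Y F : Type} [NormedAddCommGroup V] [NormedSpace ℝ V]
    [FiniteDimensional ℝ V] [NormedAddCommGroup Y] [NormedSpace ℝ Y]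
    [FiniteDimensional ℝ Y] [NormedAddCommGroup F] [NormedSpace ℝ F]
    [CompleteSpace F] {g : V × Y → F} (hg : ContDiff ℝ ∞ g) :
    ∃ G : V × Y → V →L[ℝ] F, ContDiff ℝ ∞ G ∧ (∀ v y, g (v, y) = g (0, y) + G (v, y) v) ∧
      ∀ y, G (0, y) = (fderiv ℝ g (0, y)).comp (ContinuousLinearMap.inl ℝ V Y) := by
  have h1 : ContDiff ℝ ∞ fun p : ℝ × V × Y =>
      (fderiv ℝ g (p.1 • p.2.1, p.2.2)).comp (ContinuousLinearMap.inl ℝ V Y) :=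
    ((hg.fderiv_right (m := ∞) (by simp)).comp (by fun_prop)).clm_comp contDiff_const
  refine ⟨fun p => ∫ t in (0 : ℝ)..1,
    (fderiv ℝ g (t • p.1, p.2)).comp (ContinuousLinearMap.inl ℝ V Y),
    contDiff_integral h1, fun v y => ?_, fun y => ?_⟩
  · have hc : Continuous fun t : ℝ =>
        (fderiv ℝ g (t • v, y)).comp (ContinuousLinearMap.inl ℝ V Y) :=
      h1.continuous.comp (by fun_prop : Continuous fun t : ℝ => (t, v, y))
    rw [ContinuousLinearMap.intervalIntegral_apply (hc.intervalIntegrable _ _)]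
    have hd : ∀ t ∈ Set.uIcc (0 : ℝ) 1, HasDerivAt (fun t : ℝ => g (t • v, y))
        (((fderiv ℝ g (t • v, y)).comp (ContinuousLinearMap.inl ℝ V Y)) v) t := by
      intro t _
      have h2 : HasFDerivAt g (fderiv ℝ g (t • v, y)) (t • v, y) :=
        (hg.differentiable (by simp) _).hasFDerivAt
      have h3 : HasDerivAt (fun t : ℝ => (t • v, y)) (v, 0) t := by
        have := ((hasDerivAt_id t).smul_const v).prodMk (hasDerivAt_const t y)
        simpa using this
      exact h2.comp_hasDerivAt t h3
    rw [intervalIntegral.integral_eq_sub_of_hasDerivAt hd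
      ((hc.clm_apply continuous_const).intervalIntegrable _ _)]
    simp
  · simp

end Hadamard

/-! ### Division of smooth functions by a complex coordinate -/

section Division

open ComplexConjugate

/-- The function is homogeneous of degree m - k, and each derivative is a combination of functions
of the same kind of degree one less. After r derivatives the degree is still positive, so everything
extends continuously by zero to the origin. -/
theorem contDiff_conj_pow_mul_inv_pow (r : ℕ) : ∀ (m k : ℕ), k + r + 1 ≤ m →
    ContDiff ℝ r (fun w : ℂ => conj w ^ m * w⁻¹ ^ k) := by
  have hnorm : ∀ (m k : ℕ), k ≤ m → ∀ w : ℂ, w ≠ 0 → ‖conj w ^ m * w⁻¹ ^ k‖ = ‖w‖ ^ (m - k) := by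
    intro m k hmk w hw
    rw [norm_mul, norm_pow, norm_pow, norm_inv, RCLike.norm_conj, inv_pow,
      pow_sub₀ _ (norm_ne_zero_iff.2 hw) hmk]
  have hle : ∀ (m k : ℕ), k + 1 ≤ m → ∀ w : ℂ, ‖conj w ^ m * w⁻¹ ^ k‖ ≤ ‖w‖ ^ (m - k) := by
    intro m k hmk w
    by_cases hw : w = 0
    · subst hw
      have : m ≠ 0 := by omega
      simp [this]
    · exact (hnorm m k (by omega) w hw).le
  let C : ℂ →L[ℝ] ℂ := Complex.conjCLE.toContinuousLinearMap
  -- Away from 0 this is the product rule. At 0 the function is O(|w|^(m-k)) with m - k ≥ 2, so its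
  -- derivative is zero, and so is the stated formula because m - 1 ≠ 0.
  have hder : ∀ (m k : ℕ), k + 2 ≤ m → ∀ w : ℂ, HasFDerivAt (fun w : ℂ => conj w ^ m * w⁻¹ ^ k)
      (((m : ℂ) * (conj w ^ (m - 1) * w⁻¹ ^ k)) • C -
        ((k : ℂ) * (conj w ^ m * w⁻¹ ^ (k + 1))) • ContinuousLinearMap.id ℝ ℂ) w := by
    intro m k hmk w
    by_cases hw : w = 0
    · subst hw
      have h1 : m - 1 ≠ 0 := by omega
      have h2 : m ≠ 0 := by omega
      have h0 : HasFDerivAt (fun w : ℂ => conj w ^ m * w⁻¹ ^ k) (0 : ℂ →L[ℝ] ℂ) 0 := by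
        rw [hasFDerivAt_iff_isLittleO_nhds_zero]
        have : (fun h : ℂ => conj (0 + h) ^ m * (0 + h)⁻¹ ^ k - conj (0 : ℂ) ^ m * (0 : ℂ)⁻¹ ^ k
          - (0 : ℂ →L[ℝ] ℂ) h) =O[𝓝 0] fun h => ‖h‖ ^ (m - k) := by
          refine Asymptotics.isBigO_of_le _ fun h => ?_
          simp only [zero_add, map_zero, ne_eq, h2, not_false_eq_true, zero_pow, zero_mul, sub_zero,
            zero_apply, norm_pow, norm_norm]
          simpa using hle m k (by omega) h
        refine this.trans_isLittleO ?_
        have := (Asymptotics.isLittleO_pow_pow (𝕜 := ℝ) (show 1 < m - k by omega)).comp_tendsto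
          (tendsto_norm_zero (E := ℂ))
        rw [← Asymptotics.isLittleO_norm_right]
        simpa [Function.comp_def] using this
      refine h0.congr_fderiv ?_
      ext z
      simp [h1, h2]
    · have h1 : HasFDerivAt (fun w : ℂ => conj w ^ m) ((m * conj w ^ (m - 1)) • C) w := by
        have hC : HasFDerivAt (fun w : ℂ => conj w) C w := C.hasFDerivAt
        have := (hasDerivAt_pow m (conj w)).hasFDerivAt.restrictScalars ℝ |>.comp w hC
        refine this.congr_fderiv ?_
        ext z
        simp [C, mul_comm]
      have h2 : HasFDerivAt (fun w : ℂ => w⁻¹ ^ k)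
          ((-(k * w⁻¹ ^ (k + 1))) • ContinuousLinearMap.id ℝ ℂ) w := by
        have := ((hasDerivAt_inv hw).pow k).hasFDerivAt.restrictScalars ℝ
        refine this.congr_fderiv ?_
        ext z
        rcases k with _ | k
        · simp
        · simp
          field_simp
          ring
      refine (h1.mul' h2).congr_fderiv ?_
      ext z
      simp [C]
      ring
  induction r with
  | zero =>
    intro m k hmk
    refine contDiff_zero.2 (continuous_iff_continuousAt.2 fun w => ?_)
    by_cases hw : w = 0
    · subst hw
      have h2 : m ≠ 0 := by omega
      have h3 : m - k ≠ 0 := by omega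
      refine tendsto_iff_norm_sub_tendsto_zero.2 ?_
      have h4 : Filter.Tendsto (fun w : ℂ => ‖w‖ ^ (m - k)) (𝓝 0) (𝓝 0) := by
        have := ((continuous_norm (E := ℂ)).fun_pow (m - k)).tendsto 0
        simpa [h3] using this
      refine squeeze_zero (fun _ => norm_nonneg _) (fun w => ?_) h4
      have := hle m k (by omega) w
      simpa [h2] using this
    · refine ContinuousAt.mul ?_ ((continuousAt_inv₀ hw).pow k)
      exact (Complex.continuous_conj.pow m).continuousAt
  | succ r ih =>
    intro m k hmk
    refine (contDiff_succ_iff_hasFDerivAt (n := (r : ℕ))).2 ⟨_, ?_, hder m k (by omega)⟩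
    exact ((contDiff_const.mul (ih (m - 1) k (by omega))).smul contDiff_const).sub
      ((contDiff_const.mul (ih m (k + 1) (by omega))).smul contDiff_const)

variable {Y : Type} [NormedAddCommGroup Y] [NormedSpace ℝ Y] [FiniteDimensional ℝ Y]

/-- Split the real-linear Hadamard quotient into its complex-linear and antilinear parts: L w = w (L
1 - i L i)/2 + conj w (L 1 + i L i)/2. -/
theorem exists_hadamard_complex {g : ℂ × Y → ℂ} (hg : ContDiff ℝ ∞ g) :
    ∃ g₁ g₂ : ℂ × Y → ℂ, ContDiff ℝ ∞ g₁ ∧ ContDiff ℝ ∞ g₂ ∧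
      ∀ w y, g (w, y) = g (0, y) + w * g₁ (w, y) + conj w * g₂ (w, y) := by
  obtain ⟨G, hG, hG1, -⟩ := exists_hadamard hg
  refine ⟨fun p => (G p 1 - Complex.I * G p Complex.I) / 2,
    fun p => (G p 1 + Complex.I * G p Complex.I) / 2, ?_, ?_, fun w y => ?_⟩
  · have h1 := hG.clm_apply (contDiff_const (c := (1 : ℂ)))
    have h2 := hG.clm_apply (contDiff_const (c := Complex.I))
    exact (h1.sub (contDiff_const.mul h2)).div_const 2
  · have h1 := hG.clm_apply (contDiff_const (c := (1 : ℂ)))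
    have h2 := hG.clm_apply (contDiff_const (c := Complex.I))
    exact (h1.add (contDiff_const.mul h2)).div_const 2
  · have h3 : G (w, y) w = w.re * G (w, y) 1 + w.im * G (w, y) Complex.I := by
      conv_lhs => rw [show w = w.re • (1 : ℂ) + w.im • Complex.I by simp]
      rw [map_add, map_smul, map_smul]
      simp
    have hI := Complex.I_sq
    rw [hG1, h3, show conj w = w.re - w.im * Complex.I by
      apply Complex.ext <;> simp]
    linear_combination ((w.im : ℂ) * G (w, y) Complex.I) * hI +
      (G (w, y) 1 - Complex.I * G (w, y) Complex.I) / 2 * Complex.re_add_im w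

/-- The derivative with respect to the conjugate of the complex coordinate. -/
def dbar (g : ℂ × Y → ℂ) (p : ℂ × Y) : ℂ :=
  (fderiv ℝ g p (1, 0) + Complex.I * fderiv ℝ g p (Complex.I, 0)) / 2

theorem contDiff_dbar {g : ℂ × Y → ℂ} (hg : ContDiff ℝ ∞ g) : ContDiff ℝ ∞ (dbar g) := by
  have h := hg.fderiv_right (m := ∞) (by simp)
  exact ((h.clm_apply contDiff_const).add
    (contDiff_const.mul (h.clm_apply contDiff_const))).div_const 2

theorem dbar_add {g h : ℂ × Y → ℂ} (hg : ContDiff ℝ ∞ g) (hh : ContDiff ℝ ∞ h) :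
    dbar (fun p => g p + h p) = fun p => dbar g p + dbar h p := by
  funext p
  have := fderiv_fun_add (hg.differentiable (by simp) p) (hh.differentiable (by simp) p)
  simp only [dbar, this, add_apply]
  ring

theorem dbar_mul {g h : ℂ × Y → ℂ} (hg : ContDiff ℝ ∞ g) (hh : ContDiff ℝ ∞ h) :
    dbar (fun p => g p * h p) = fun p => g p * dbar h p + dbar g p * h p := by
  funext p
  have := fderiv_fun_mul (hg.differentiable (by simp) p) (hh.differentiable (by simp) p)
  simp only [dbar, this, add_apply, smul_apply, smul_eq_mul]
  ring

theorem contDiff_conj_fst : ContDiff ℝ ∞ (fun p : ℂ × Y => conj p.1) :=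
  Complex.conjCLE.contDiff.comp contDiff_fst

theorem dbar_fst : dbar (fun p : ℂ × Y => p.1) = fun _ => 0 := by
  funext p
  have : fderiv ℝ (fun p : ℂ × Y => p.1) p = ContinuousLinearMap.fst ℝ ℂ Y :=
    (ContinuousLinearMap.fst ℝ ℂ Y).fderiv
  simp [dbar, this]

theorem dbar_conj_fst : dbar (fun p : ℂ × Y => conj p.1) = fun _ => 1 := by
  funext p
  have : fderiv ℝ (fun p : ℂ × Y => conj p.1) p =
      Complex.conjCLE.toContinuousLinearMap.comp (ContinuousLinearMap.fst ℝ ℂ Y) :=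
    (Complex.conjCLE.toContinuousLinearMap.comp (ContinuousLinearMap.fst ℝ ℂ Y)).fderiv
  simp [dbar, this]

theorem dbar_snd {c : Y → ℂ} (hc : ContDiff ℝ ∞ c) : dbar (fun p : ℂ × Y => c p.2) = fun _ => 0 := by
  funext p
  have : fderiv ℝ (fun p : ℂ × Y => c p.2) p = (fderiv ℝ c p.2).comp
      (ContinuousLinearMap.snd ℝ ℂ Y) :=
    ((hc.differentiable (by simp) p.2).hasFDerivAt.comp p
      (ContinuousLinearMap.snd ℝ ℂ Y).hasFDerivAt).fderiv
  simp [dbar, this]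

theorem contDiff_dbar_iterate {g : ℂ × Y → ℂ} (hg : ContDiff ℝ ∞ g) (k : ℕ) :
    ContDiff ℝ ∞ (dbar^[k] g) := by
  induction k with
  | zero => exact hg
  | succ k ih => rw [Function.iterate_succ_apply']; exact contDiff_dbar ih

theorem dbar_iterate_add {g h : ℂ × Y → ℂ} (hg : ContDiff ℝ ∞ g) (hh : ContDiff ℝ ∞ h) (k : ℕ) :
    dbar^[k] (fun p => g p + h p) = fun p => dbar^[k] g p + dbar^[k] h p := by
  induction k with
  | zero => rfl
  | succ k ih =>
    rw [Function.iterate_succ_apply', ih, dbar_add (contDiff_dbar_iterate hg k)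
      (contDiff_dbar_iterate hh k)]
    simp only [Function.iterate_succ_apply']

theorem dbar_iterate_fst_mul {g : ℂ × Y → ℂ} (hg : ContDiff ℝ ∞ g) (k : ℕ) :
    dbar^[k] (fun p => p.1 * g p) = fun p => p.1 * dbar^[k] g p := by
  induction k with
  | zero => rfl
  | succ k ih =>
    rw [Function.iterate_succ_apply', ih, dbar_mul contDiff_fst (contDiff_dbar_iterate hg k),
      dbar_fst]
    simp only [Function.iterate_succ_apply', zero_mul, add_zero]

theorem dbar_iterate_mul_snd {g : ℂ × Y → ℂ} (hg : ContDiff ℝ ∞ g) {c : Y → ℂ}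
    (hc : ContDiff ℝ ∞ c) (k : ℕ) :
    dbar^[k] (fun p => c p.2 * g p) = fun p => c p.2 * dbar^[k] g p := by
  induction k with
  | zero => rfl
  | succ k ih =>
    rw [Function.iterate_succ_apply', ih, dbar_mul (g := fun p : ℂ × Y => c p.2) (hc.comp contDiff_snd)
      (contDiff_dbar_iterate hg k), dbar_snd hc]
    simp only [Function.iterate_succ_apply', zero_mul, add_zero]

/-- On w = 0 only the first summand survives, so a factor conj w shifts the ∂̄-derivatives along w =
0 by one. -/
theorem dbar_iterate_conj_mul {g : ℂ × Y → ℂ} (hg : ContDiff ℝ ∞ g) (k : ℕ) :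
    dbar^[k + 1] (fun p => conj p.1 * g p) =
      fun p => (k + 1) * dbar^[k] g p + conj p.1 * dbar^[k + 1] g p := by
  induction k with
  | zero =>
    rw [Function.iterate_succ_apply', Function.iterate_zero_apply,
      dbar_mul contDiff_conj_fst hg, dbar_conj_fst]
    funext p
    simp [add_comm]
  | succ k ih =>
    rw [Function.iterate_succ_apply', ih, dbar_add
      (contDiff_const.mul (contDiff_dbar_iterate hg k))
      (contDiff_conj_fst.mul (contDiff_dbar_iterate hg (k + 1))),
      dbar_mul contDiff_conj_fst (contDiff_dbar_iterate hg (k + 1)), dbar_conj_fst,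
      dbar_mul contDiff_const (contDiff_dbar_iterate hg k)]
    have h0 : dbar (fun _ : ℂ × Y => (k + 1 : ℂ)) = fun _ => 0 :=
      dbar_snd (Y := Y) (c := fun _ => (k + 1 : ℂ)) contDiff_const
    rw [h0]
    funext p
    simp only [Function.iterate_succ_apply']
    push_cast
    ring

/-- Modulo w, the Taylor expansion along w = 0 is a series in conj w with coefficients ∂̄^k g / k!.
One Hadamard step removes the first vanishing coefficient, and the antilinear quotient then has its
derivatives shifted by one. -/
theorem exists_eq_mul_add_conj_pow (N : ℕ) : ∀ {g : ℂ × Y → ℂ}, ContDiff ℝ ∞ g →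
    (∀ k < N, ∀ y, dbar^[k] g (0, y) = 0) → ∃ G ρ : ℂ × Y → ℂ, ContDiff ℝ ∞ G ∧ ContDiff ℝ ∞ ρ ∧
      ∀ p, g p = p.1 * G p + conj p.1 ^ N * ρ p := by
  induction N with
  | zero =>
    intro g hg _
    exact ⟨fun _ => 0, g, contDiff_const, hg, fun p => by simp⟩
  | succ N ih =>
    intro g hg h0
    obtain ⟨g₁, g₂, hg₁, hg₂, hgg⟩ := exists_hadamard_complex hg
    have h00 : ∀ y, g (0, y) = 0 := fun y => h0 0 (by omega) y
    have hg' : g = fun p => p.1 * g₁ p + conj p.1 * g₂ p := by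
      funext p
      have := hgg p.1 p.2
      rw [h00, zero_add] at this
      exact this
    have h2 : ∀ k < N, ∀ y, dbar^[k] g₂ (0, y) = 0 := by
      intro k hk y
      have h3 := h0 (k + 1) (by omega) y
      rw [hg', dbar_iterate_add (contDiff_fst.mul hg₁) (contDiff_conj_fst.mul hg₂),
        dbar_iterate_fst_mul hg₁, dbar_iterate_conj_mul hg₂] at h3
      simp only [zero_mul, map_zero, zero_add, add_zero, mul_eq_zero] at h3
      exact h3.resolve_left (by exact_mod_cast Nat.succ_ne_zero k)
    obtain ⟨G, ρ, hG, hρ, h⟩ := ih hg₂ h2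
    refine ⟨fun p => g₁ p + conj p.1 * G p, ρ, hg₁.add (contDiff_conj_fst.mul hG), hρ, fun p => ?_⟩
    rw [congrFun hg' p, h p]
    ring

/-- If `w` divides `w̄ Π g` where `Π` does not depend on the complex coordinate `w` and vanishes
on a set with dense complement, then it divides `g`. -/
theorem exists_eq_fst_mul {g h : ℂ × Y → ℂ} (hg : ContDiff ℝ ∞ g) (hh : ContDiff ℝ ∞ h)
    {c : Y → ℂ} (hc : ContDiff ℝ ∞ c) (hcd : Dense {y | c y ≠ 0})
    (heq : ∀ p, conj p.1 * (c p.2 * g p) = p.1 * h p) :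
    ∃ ζ : ℂ × Y → ℂ, ContDiff ℝ ∞ ζ ∧ ∀ p, g p = p.1 * ζ p := by
  -- Apply ∂̄^(k+1) to the equation and set w = 0. The right-hand side vanishes and the left-hand
  -- side is (k+1) c(y) ∂̄^k g(0, y), so the claim holds where c ≠ 0 and extends by density.
  have h0 : ∀ k y, dbar^[k] g (0, y) = 0 := by
    intro k
    have h1 : ∀ y, c y ≠ 0 → dbar^[k] g (0, y) = 0 := by
      intro y hy
      have h2 := congrFun (congrArg (dbar^[k + 1]) (funext heq)) (0, y)
      have hcg : ContDiff ℝ ∞ fun p : ℂ × Y => c p.2 * g p := (hc.comp contDiff_snd).mul hg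
      rw [dbar_iterate_fst_mul hh, dbar_iterate_conj_mul hcg, dbar_iterate_mul_snd hg hc] at h2
      simp only [zero_mul, map_zero, add_zero, mul_eq_zero] at h2
      exact (h2.resolve_left (by exact_mod_cast Nat.succ_ne_zero k)).resolve_left hy
    have h3 : Continuous fun y => dbar^[k] g (0, y) :=
      (contDiff_dbar_iterate hg k).continuous.comp (by fun_prop)
    intro y
    exact congrFun (Continuous.ext_on hcd h3 continuous_const fun y hy => h1 y hy) y
  choose G ρ hG hρ hGρ using fun N => exists_eq_mul_add_conj_pow N hg fun k _ => h0 k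
  -- The quotient g / w computed from the expansion to order N. The term conj w^(N+2) / w is of
  -- class C^N, so `ζ (N + 2)` is as well; all of these agree where w ≠ 0, hence everywhere, and `ζ
  -- 2` is smooth.
  let ζ : ℕ → ℂ × Y → ℂ := fun N p => G N p + conj p.1 ^ N * p.1⁻¹ ^ 1 * ρ N p
  have hζ : ∀ N : ℕ, ContDiff ℝ N (ζ (N + 2)) := by
    intro N
    have h1 := (contDiff_conj_pow_mul_inv_pow N (N + 2) 1 (by omega)).comp
      (contDiff_fst (E := ℂ) (F := Y))
    exact ((contDiff_infty.1 (hG _) N)).add (h1.mul (contDiff_infty.1 (hρ _) N))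
  have hmul : ∀ N p, g p = p.1 * ζ (N + 2) p := by
    intro N p
    rw [hGρ (N + 2) p]
    by_cases hp : p.1 = 0
    · simp [hp]
    · simp only [ζ]
      field_simp
  have hd : Dense {p : ℂ × Y | p.1 ≠ 0} := by
    have : {p : ℂ × Y | p.1 ≠ 0} = {0}ᶜ ×ˢ Set.univ := by ext; simp
    rw [this]
    exact (dense_compl_singleton (0 : ℂ)).prod dense_univ
  have hall : ∀ N, ζ (N + 2) = ζ 2 := by
    intro N
    refine Continuous.ext_on hd (hζ N).continuous (hζ 0).continuous fun p hp => ?_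
    exact mul_left_cancel₀ hp ((hmul N p).symm.trans (hmul 0 p))
  exact ⟨ζ 2, contDiff_infty.2 fun N => hall N ▸ hζ N, hmul 0⟩

end Division

/-! ### Smooth functions on coordinate spaces -/

section Cutoff

variable {E : Type*} [NormedAddCommGroup E] [NormedSpace ℝ E]
  {M : Type*} [TopologicalSpace M] [ChartedSpace E M]
  [FiniteDimensional ℝ E] [T2Space M] [IsManifold 𝓘(ℝ, E) ∞ M]

theorem exists_cutoff {U : Set M} (hU : IsOpen U) {x : M} (hx : x ∈ U) :
    ∃ χ : C^∞⟮𝓘(ℝ, E), M; 𝓘(ℝ, ℝ), ℝ⟯, tsupport χ ⊆ U ∧ ∀ᶠ y in 𝓝 x, χ y = 1 := by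
  obtain ⟨f, -, hf⟩ := (SmoothBumpFunction.nhds_basis_tsupport (I := 𝓘(ℝ, E)) x).mem_iff.1
    (hU.mem_nhds hx)
  exact ⟨⟨f, f.contMDiff⟩, hf, f.eventuallyEq_one⟩

theorem contMDiff_cutoff_mul {F H X : Type*} [NormedAddCommGroup F] [NormedSpace ℝ F]
    [TopologicalSpace H] {I : ModelWithCorners ℝ F H} [TopologicalSpace X] [ChartedSpace H X]
    {U : Set X} (hU : IsOpen U) {χ : X → ℝ} (hχ : ContMDiff I 𝓘(ℝ, ℝ) ∞ χ) (hs : tsupport χ ⊆ U)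
    {k : X → ℝ} (hk : ContMDiffOn I 𝓘(ℝ, ℝ) ∞ k U) :
    ContMDiff I 𝓘(ℝ, ℝ) ∞ (fun y => χ y * k y) := by
  intro y
  by_cases hy : y ∈ tsupport χ
  · exact (hχ y).mul ((hk y (hs hy)).contMDiffAt (hU.mem_nhds (hs hy)))
  · have h0 : (fun y => χ y * k y) =ᶠ[𝓝 y] fun _ => 0 := by
      filter_upwards [(isClosed_tsupport χ).isOpen_compl.mem_nhds hy] with z hz
      rw [image_eq_zero_of_notMem_tsupport hz, zero_mul]
    exact contMDiffAt_const.congr_of_eventuallyEq h0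

end Cutoff

/-! ### Division by coordinates, derivations at a point, and division by a product of squared radii.
-/

section Coordinates

variable {ι : Type} [Fintype ι] [DecidableEq ι]

/-- A function vanishing where the coordinates in `s` vanish is a combination of these. -/
theorem exists_eq_sum_coord_mul (s : Finset ι) {k : (ι → ℝ) → ℝ} (hk : ContDiff ℝ ∞ k)
    (h0 : ∀ y, (∀ l ∈ s, y l = 0) → k y = 0) :
    ∃ κ : ι → (ι → ℝ) → ℝ, (∀ l, ContDiff ℝ ∞ (κ l)) ∧ ∀ y, k y = ∑ l ∈ s, y l * κ l y := by
  -- The coordinates in `s` become the Hadamard variables and a full second copy of the coordinates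
  -- serves as parameter.
  let R : (s → ℝ) × (ι → ℝ) → ι → ℝ := fun p l => if h : l ∈ s then p.1 ⟨l, h⟩ else p.2 l
  have hR : ContDiff ℝ ∞ R := by
    refine contDiff_pi.2 fun l => ?_
    by_cases h : l ∈ s
    · simp only [R, h, dif_pos]; fun_prop
    · simp only [R, h, dif_neg, not_false_eq_true]; fun_prop
  obtain ⟨G, hG, h1, -⟩ := exists_hadamard (hk.comp hR)
  have hres : ContDiff ℝ ∞ fun y : ι → ℝ => ((fun l : s => y l), y) := by fun_prop
  refine ⟨fun l y => if h : l ∈ s then G (fun l : s => y l, y) (Pi.single ⟨l, h⟩ 1) else 0,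
    fun l => ?_, fun y => ?_⟩
  · by_cases h : l ∈ s
    · simp only [h, dif_pos]
      exact (hG.comp hres).clm_apply contDiff_const
    · simp only [h, dif_neg, not_false_eq_true]
      exact contDiff_const
  · have h2 := h1 (fun l : s => y l) y
    have h3 : R (fun l : s => y l, y) = y := by
      funext l
      by_cases h : l ∈ s <;> simp [R, h]
    have h4 : k (R (0, y)) = 0 := h0 _ fun l hl => by simp [R, hl]
    simp only [Function.comp_apply, h3, h4, zero_add] at h2
    rw [h2, ← Finset.sum_coe_sort s]
    have h5 : (fun l : s => y l) = ∑ l : s, y l • Pi.single l (1 : ℝ) := by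
      funext l
      simp [Finset.sum_apply, Pi.single_apply]
    conv_lhs => enter [2]; rw [h5]
    rw [map_sum]
    refine Finset.sum_congr rfl fun l _ => ?_
    simp

theorem hasFDerivAt_coord (l : ι) (y : ι → ℝ) :
    HasFDerivAt (fun y : ι → ℝ => y l) (ContinuousLinearMap.proj (R := ℝ) (φ := fun _ : ι => ℝ) l) y :=
  (ContinuousLinearMap.proj (R := ℝ) (φ := fun _ : ι => ℝ) l).hasFDerivAt

/-- A function vanishing to second order where two coordinates vanish is a quadratic form in
these. -/
theorem exists_eq_quadratic {i j : ι} (hij : i ≠ j) {k : (ι → ℝ) → ℝ} (hk : ContDiff ℝ ∞ k)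
    (h0 : ∀ y, y i = 0 → y j = 0 → k y = 0) (h1 : ∀ y, y i = 0 → y j = 0 → fderiv ℝ k y = 0) :
    ∃ a b c : (ι → ℝ) → ℝ, ContDiff ℝ ∞ a ∧ ContDiff ℝ ∞ b ∧ ContDiff ℝ ∞ c ∧
      ∀ y, k y = a y * y i ^ 2 + 2 * b y * (y i * y j) + c y * y j ^ 2 := by
  have hs : ∀ {k : (ι → ℝ) → ℝ}, ContDiff ℝ ∞ k → (∀ y, y i = 0 → y j = 0 → k y = 0) →
      ∃ a b : (ι → ℝ) → ℝ, ContDiff ℝ ∞ a ∧ ContDiff ℝ ∞ b ∧ ∀ y, k y = y i * a y + y j * b y := by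
    intro k hk h0
    obtain ⟨κ, hκ, h⟩ := exists_eq_sum_coord_mul {i, j} hk fun y hy =>
      h0 y (hy i (by simp)) (hy j (by simp))
    exact ⟨κ i, κ j, hκ i, hκ j, fun y => by rw [h, Finset.sum_pair hij]⟩
  obtain ⟨a, b, ha, hb, hab⟩ := hs hk h0
  -- On the common zero set of the two coordinates, the derivatives of k in these coordinate
  -- directions are exactly a and b; a second division then applies to both.
  have hd : ∀ y, y i = 0 → y j = 0 → a y = 0 ∧ b y = 0 := by
    intro y hi hj
    have h2 : HasFDerivAt k _ y :=
      (((hasFDerivAt_coord i y).mul (ha.differentiable (by simp) y).hasFDerivAt).add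
        ((hasFDerivAt_coord j y).mul (hb.differentiable (by simp) y).hasFDerivAt)).congr_of_eventuallyEq
        (Filter.Eventually.of_forall hab)
    have h3 := h2.fderiv
    rw [h1 y hi hj] at h3
    have h4 := DFunLike.congr_fun h3 (Pi.single i 1)
    have h5 := DFunLike.congr_fun h3 (Pi.single j 1)
    simp [hi, hj, hij] at h4
    simp [hi, hj, hij.symm] at h5
    exact ⟨h4.symm, h5.symm⟩
  obtain ⟨a₁, a₂, ha₁, ha₂, haa⟩ := hs ha fun y hi hj => (hd y hi hj).1
  obtain ⟨b₁, b₂, hb₁, hb₂, hbb⟩ := hs hb fun y hi hj => (hd y hi hj).2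
  refine ⟨a₁, fun y => (a₂ y + b₁ y) / 2, b₂, ha₁, (ha₂.add hb₁).div_const 2, hb₂, fun y => ?_⟩
  rw [hab, haa, hbb]
  ring

/-- The chain rule for derivations at a point. -/
theorem derivation_at_eq_sum (w₀ : ι → ℝ) (v : ((ι → ℝ) → ℝ) → ℝ)
    (hadd : ∀ F G, ContDiff ℝ ∞ F → ContDiff ℝ ∞ G → v (fun w => F w + G w) = v F + v G)
    (hsmul : ∀ (c : ℝ) F, ContDiff ℝ ∞ F → v (fun w => c * F w) = c * v F)
    (hmul : ∀ F G, ContDiff ℝ ∞ F → ContDiff ℝ ∞ G →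
      v (fun w => F w * G w) = F w₀ * v G + G w₀ * v F) {F : (ι → ℝ) → ℝ} (hF : ContDiff ℝ ∞ F) :
    v F = ∑ l, fderiv ℝ F w₀ (Pi.single l 1) * v (fun w => w l) := by
  have hone : v (fun _ => 1) = 0 := by
    have := hmul (fun _ => 1) (fun _ => 1) contDiff_const contDiff_const
    simp only [mul_one, one_mul] at this
    linarith
  have hconst : ∀ c : ℝ, v (fun _ => c) = 0 := by
    intro c
    have := hsmul c (fun _ => 1) contDiff_const
    simpa [hone] using this
  have hsum : ∀ (s : Finset ι) (f : ι → (ι → ℝ) → ℝ), (∀ l, ContDiff ℝ ∞ (f l)) →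
      v (fun w => ∑ l ∈ s, f l w) = ∑ l ∈ s, v (f l) := by
    intro s f hf
    induction s using Finset.induction_on with
    | empty => simpa using hconst 0
    | insert a s ha ih =>
      simp only [Finset.sum_insert ha]
      rw [hadd _ _ (hf a) (ContDiff.sum fun l _ => hf l), ih]
  -- The factor `ℝ` is a dummy parameter space.
  have hF' : ContDiff ℝ ∞ fun p : (ι → ℝ) × ℝ => F (w₀ + p.1) := hF.comp (by fun_prop)
  obtain ⟨G, hG, h1, h2⟩ := exists_hadamard hF'
  have h3 : ∀ w, F w = F w₀ + ∑ l, G (w - w₀, 0) (Pi.single l 1) * (w l + -w₀ l) := by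
    intro w
    have h4 := h1 (w - w₀) 0
    simp only [add_sub_cancel, add_zero] at h4
    rw [h4]
    congr 1
    have h5 : w - w₀ = ∑ l, (w l + -w₀ l) • Pi.single l (1 : ℝ) := by
      funext l
      simp [Finset.sum_apply, Pi.single_apply, sub_eq_add_neg]
    conv_lhs => enter [2]; rw [h5]
    rw [map_sum]
    refine Finset.sum_congr rfl fun l _ => ?_
    rw [map_smul, smul_eq_mul, mul_comm]
  have hGl : ∀ l, ContDiff ℝ ∞ fun w : ι → ℝ => G (w - w₀, 0) (Pi.single l 1) := fun l =>
    (hG.comp (by fun_prop)).clm_apply contDiff_const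
  have hwl : ∀ l, ContDiff ℝ ∞ fun w : ι → ℝ => w l + -w₀ l := fun l => by fun_prop
  have h6 : fderiv ℝ F w₀ = G (0, 0) := by
    ext z
    rw [h2 0]
    have h7 : HasFDerivAt (fun p : (ι → ℝ) × ℝ => F (w₀ + p.1))
        ((fderiv ℝ F w₀).comp (ContinuousLinearMap.fst ℝ (ι → ℝ) ℝ)) (0, 0) := by
      have h8 : HasFDerivAt (fun p : (ι → ℝ) × ℝ => w₀ + p.1)
          (ContinuousLinearMap.fst ℝ (ι → ℝ) ℝ) (0, 0) := hasFDerivAt_fst.const_add w₀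
      have h9 : HasFDerivAt F (fderiv ℝ F w₀) (w₀ + ((0, 0) : (ι → ℝ) × ℝ).1) := by
        simpa using (hF.differentiable (by simp) w₀).hasFDerivAt
      exact HasFDerivAt.comp (g := F) (f := fun p : (ι → ℝ) × ℝ => w₀ + p.1) (0, 0) h9 h8
    rw [h7.fderiv]
    simp
  have h10 : F = fun w => F w₀ + ∑ l, G (w - w₀, 0) (Pi.single l 1) * (w l + -w₀ l) := funext h3
  conv_lhs => rw [h10]
  rw [hadd _ _ contDiff_const (ContDiff.sum fun l _ => (hGl l).mul (hwl l)), hconst, zero_add,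
    hsum _ _ fun l => (hGl l).mul (hwl l)]
  refine Finset.sum_congr rfl fun l _ => ?_
  rw [hmul _ _ (hGl l) (hwl l), hadd _ _ (by fun_prop) contDiff_const, hconst, h6]
  simp

theorem dense_setOf_coord_ne_zero : Dense {y : ι → ℝ | ∀ l, y l ≠ 0} := by
  have h : {y : ι → ℝ | ∀ l, y l ≠ 0} = ⋂ l, (fun y : ι → ℝ => y l) ⁻¹' {0}ᶜ := by
    ext; simp
  rw [h]
  refine dense_iInter_of_isOpen (fun l => isOpen_compl_singleton.preimage (continuous_apply l))
    fun l => (dense_compl_singleton (0 : ℝ)).preimage (isOpenMap_eval l)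

/-- Vector fields preserving the ideal of a product of squared radii are rotations and
scalings of the factors. -/
theorem exists_conformal_division {n : ℕ} {ι : Type} [Fintype ι] [DecidableEq ι]
    (e : Fin n × Fin 2 → ι) (he : Function.Injective e) {g : Fin n → Fin 2 → (ι → ℝ) → ℝ}
    (hg : ∀ i a, ContDiff ℝ ∞ (g i a)) {c : (ι → ℝ) → ℝ} (hc : ContDiff ℝ ∞ c)
    (heq : ∀ y, ∑ i, (y (e (i, 0)) * g i 0 y + y (e (i, 1)) * g i 1 y) *
      ∏ j ∈ Finset.univ.erase i, (y (e (j, 0)) ^ 2 + y (e (j, 1)) ^ 2) =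
      c y * ∏ j, (y (e (j, 0)) ^ 2 + y (e (j, 1)) ^ 2)) (i : Fin n) :
    ∃ a b : (ι → ℝ) → ℝ, ContDiff ℝ ∞ a ∧ ContDiff ℝ ∞ b ∧
      ∀ y, g i 0 y = a y * y (e (i, 0)) - b y * y (e (i, 1)) ∧
        g i 1 y = b y * y (e (i, 0)) + a y * y (e (i, 1)) := by
  let ρ : Fin n → (ι → ℝ) → ℝ := fun j y => y (e (j, 0)) ^ 2 + y (e (j, 1)) ^ 2
  have hρ : ∀ j, ContDiff ℝ ∞ (ρ j) := fun j => by fun_prop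
  let Q : (ι → ℝ) → ℝ := fun y => ∏ j ∈ Finset.univ.erase i, ρ j y
  have hQ : ContDiff ℝ ∞ Q := contDiff_prod fun j _ => hρ j
  -- Every summand with k ≠ i contains the factor ρ_i. Moving these summands to the right isolates
  -- branch i: (y_0 g_0 + y_1 g_1) Q = ρ_i C.
  let C : (ι → ℝ) → ℝ := fun y => c y * Q y - ∑ k ∈ Finset.univ.erase i,
    (y (e (k, 0)) * g k 0 y + y (e (k, 1)) * g k 1 y) *
      ∏ j ∈ (Finset.univ.erase i).erase k, ρ j y
  have hC : ContDiff ℝ ∞ C := by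
    refine (hc.mul hQ).sub (ContDiff.sum fun k _ => ?_)
    exact ((((contDiff_apply ℝ ℝ _).mul (hg k 0)).add ((contDiff_apply ℝ ℝ _).mul (hg k 1)))).mul
      (contDiff_prod fun j _ => hρ j)
  have h1 : ∀ y, (y (e (i, 0)) * g i 0 y + y (e (i, 1)) * g i 1 y) * Q y = ρ i y * C y := by
    intro y
    have h2 := heq y
    rw [← Finset.add_sum_erase _ _ (Finset.mem_univ i), ← Finset.mul_prod_erase _ _
      (Finset.mem_univ i)] at h2
    have h3 : ∑ k ∈ Finset.univ.erase i, (y (e (k, 0)) * g k 0 y + y (e (k, 1)) * g k 1 y) *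
        ∏ j ∈ Finset.univ.erase k, (y (e (j, 0)) ^ 2 + y (e (j, 1)) ^ 2) =
        ρ i y * ∑ k ∈ Finset.univ.erase i, (y (e (k, 0)) * g k 0 y + y (e (k, 1)) * g k 1 y) *
          ∏ j ∈ (Finset.univ.erase i).erase k, ρ j y := by
      rw [Finset.mul_sum]
      refine Finset.sum_congr rfl fun k hk => ?_
      have h4 : i ∈ Finset.univ.erase k :=
        Finset.mem_erase.2 ⟨(Finset.ne_of_mem_erase hk).symm, Finset.mem_univ _⟩
      rw [← Finset.mul_prod_erase _ _ h4, Finset.erase_right_comm]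
      simp only [ρ]
      ring
    rw [h3] at h2
    simp only [C, Q, ρ] at h2 ⊢
    linear_combination h2
  have he01 : e (i, 0) ≠ e (i, 1) := fun h => by simpa using he h
  -- The i-th pair of coordinates is replaced by one complex variable, so that Q depends on the
  -- parameters only.
  let R : ℂ × (ι → ℝ) → ι → ℝ := fun p l =>
    if l = e (i, 0) then p.1.re else if l = e (i, 1) then p.1.im else p.2 l
  have hre : ContDiff ℝ ∞ fun p : ℂ × (ι → ℝ) => p.1.re := Complex.reCLM.contDiff.comp contDiff_fst
  have him : ContDiff ℝ ∞ fun p : ℂ × (ι → ℝ) => p.1.im := Complex.imCLM.contDiff.comp contDiff_fst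
  have hR : ContDiff ℝ ∞ R := by
    refine contDiff_pi.2 fun l => ?_
    by_cases h : l = e (i, 0)
    · simpa only [R, h, if_true] using hre
    · by_cases h' : l = e (i, 1)
      · simpa only [R, h', he01.symm, if_true, if_false] using him
      · simp only [R, h, h', if_false]; fun_prop
  have hR0 : ∀ p, R p (e (i, 0)) = p.1.re := fun p => by simp [R]
  have hR1 : ∀ p, R p (e (i, 1)) = p.1.im := fun p => by simp [R, he01.symm]
  have hRQ : ∀ p, Q (R p) = Q p.2 := by
    intro p
    refine Finset.prod_congr rfl fun j hj => ?_
    have hji : j ≠ i := Finset.ne_of_mem_erase hj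
    have h5 : ∀ a b, e (j, a) ≠ e (i, b) := fun a b h => hji (by simpa using congrArg Prod.fst (he h))
    simp [ρ, R, h5]
  let T : ℂ × (ι → ℝ) → ℂ := fun p => g i 0 (R p) + g i 1 (R p) * Complex.I
  have hof : ∀ {f : (ι → ℝ) → ℝ}, ContDiff ℝ ∞ f → ContDiff ℝ ∞ fun p => ((f (R p) : ℝ) : ℂ) :=
    fun hf => Complex.ofRealCLM.contDiff.comp (hf.comp hR)
  have hT : ContDiff ℝ ∞ T := (hof (hg i 0)).add ((hof (hg i 1)).mul contDiff_const)
  -- With T = g_0 + i g_1 one has 2 Re(conj z T) = conj z T + z conj T, so the isolated equation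
  -- becomes conj z Q T = z (2 conj z C - Q conj T), and the bracket is S.
  let S : ℂ × (ι → ℝ) → ℂ := fun p =>
    2 * (starRingEnd ℂ) p.1 * C (R p) - (starRingEnd ℂ) (T p) * Q (R p)
  have hS : ContDiff ℝ ∞ S := ((contDiff_const.mul contDiff_conj_fst).mul (hof hC)).sub
    ((Complex.conjCLE.contDiff.comp hT).mul (hof hQ))
  have hQc : ContDiff ℝ ∞ fun y => ((Q y : ℝ) : ℂ) := Complex.ofRealCLM.contDiff.comp hQ
  have hd : Dense {y : ι → ℝ | ((Q y : ℝ) : ℂ) ≠ 0} := by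
    refine dense_setOf_coord_ne_zero.mono fun y hy => ?_
    have : 0 < Q y := Finset.prod_pos fun j _ => by
      have := sq_pos_of_ne_zero (hy (e (j, 0)))
      have := sq_nonneg (y (e (j, 1)))
      simp only [ρ]; linarith
    exact_mod_cast this.ne'
  obtain ⟨ζ, hζ, hTζ⟩ := exists_eq_fst_mul hT hS hQc hd (by
    intro p
    have h6 := h1 (R p)
    rw [hR0, hR1, hRQ] at h6
    simp only [ρ, hR0, hR1] at h6
    simp only [S, hRQ]
    have h7 : ((p.1.re : ℂ) * g i 0 (R p) + p.1.im * g i 1 (R p)) * Q p.2 =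
      (p.1.re ^ 2 + p.1.im ^ 2) * C (R p) := by exact_mod_cast h6
    have h8 : (starRingEnd ℂ) (T p) = g i 0 (R p) - g i 1 (R p) * Complex.I := by
      apply Complex.ext <;> simp [T]
    have h9 : (starRingEnd ℂ) p.1 = p.1.re - p.1.im * Complex.I := by
      apply Complex.ext <;> simp
    rw [h8, h9]
    simp only [T]
    have hI := Complex.I_sq
    have hp := (Complex.re_add_im p.1).symm
    generalize p.1.re = u at *
    generalize p.1.im = v at *
    rw [hp]
    linear_combination 2 * h7 + (-2 * v * g i 1 (R p) * Q p.2 + 2 * v ^ 2 * C (R p)) * hI)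
  have hRy : ∀ y : ι → ℝ, R (y (e (i, 0)) + y (e (i, 1)) * Complex.I, y) = y := by
    intro y
    funext l
    by_cases h : l = e (i, 0)
    · simp [R, h]
    · by_cases h' : l = e (i, 1)
      · simp [R, h', he01.symm]
      · simp [R, h, h']
  have hs : ContDiff ℝ ∞ fun y : ι → ℝ => ((y (e (i, 0)) : ℂ) + y (e (i, 1)) * Complex.I, y) := by
    refine ContDiff.prodMk ?_ contDiff_id
    exact (Complex.ofRealCLM.contDiff.comp (contDiff_apply ℝ ℝ _)).add
      ((Complex.ofRealCLM.contDiff.comp (contDiff_apply ℝ ℝ _)).mul contDiff_const)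
  refine ⟨fun y => (ζ (y (e (i, 0)) + y (e (i, 1)) * Complex.I, y)).re,
    fun y => (ζ (y (e (i, 0)) + y (e (i, 1)) * Complex.I, y)).im,
    Complex.reCLM.contDiff.comp (hζ.comp hs), Complex.imCLM.contDiff.comp (hζ.comp hs), fun y => ?_⟩
  have h10 := hTζ (y (e (i, 0)) + y (e (i, 1)) * Complex.I, y)
  simp only [T, hRy] at h10
  have h11 := congrArg Complex.re h10
  have h12 := congrArg Complex.im h10
  simp at h11 h12
  constructor
  · linear_combination h11
  · linear_combination h12

end Coordinates

/-- The second order behaviour of a function along a line through a critical zero. -/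
theorem tendsto_div_sq {E : Type*} [NormedAddCommGroup E] [NormedSpace ℝ E] {g : E → ℝ} {e : E}
    (hg : ContDiffAt ℝ ∞ g e) (h0 : g e = 0) (h1 : fderiv ℝ g e = 0) (v : E) :
    Filter.Tendsto (fun t : ℝ => g (e + t • v) / t ^ 2) (𝓝[≠] 0)
      (𝓝 (fderiv ℝ (fderiv ℝ g) e v v / 2)) := by
  have hl : ∀ t : ℝ, HasDerivAt (fun t : ℝ => e + t • v) v t := fun t => by
    simpa using ((hasDerivAt_id t).smul_const v).const_add e
  have hc : Filter.Tendsto (fun t : ℝ => e + t • v) (𝓝 0) (𝓝 e) := by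
    have := (hl 0).continuousAt.tendsto
    simpa using this
  have hd : ∀ᶠ t in 𝓝 (0 : ℝ), HasDerivAt (fun t : ℝ => g (e + t • v)) (fderiv ℝ g (e + t • v) v) t := by
    have h2 : ∀ᶠ z in 𝓝 e, ContDiffAt ℝ 1 g z :=
      (hg.of_le (m := 1) (by exact_mod_cast le_top)).eventually (by simp)
    filter_upwards [hc.eventually h2] with t ht
    exact (ht.differentiableAt (by simp)).hasFDerivAt.comp_hasDerivAt t (hl t)
  have hd2 : HasDerivAt (fun t : ℝ => fderiv ℝ g (e + t • v) v) (fderiv ℝ (fderiv ℝ g) e v v) 0 := by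
    have h2 : DifferentiableAt ℝ (fderiv ℝ g) e :=
      (hg.fderiv_right (m := ∞) (by simp)).differentiableAt (by simp)
    have h3 : HasFDerivAt (fderiv ℝ g) (fderiv ℝ (fderiv ℝ g) e) (e + (0 : ℝ) • v) := by
      simpa using h2.hasFDerivAt
    have h4 := h3.comp_hasDerivAt 0 (hl 0)
    simpa using (h4.clm_apply (hasDerivAt_const 0 v))
  refine HasDerivAt.lhopital_zero_nhdsNE (f' := fun t => fderiv ℝ g (e + t • v) v)
    (g' := fun t => 2 * t) (hd.filter_mono nhdsWithin_le_nhds) ?_ ?_ ?_ ?_ ?_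
  · refine Filter.Eventually.of_forall fun t => ?_
    simpa using hasDerivAt_pow 2 t
  · filter_upwards [self_mem_nhdsWithin] with t ht
    simpa using ht
  · have h5 : Filter.Tendsto (fun t : ℝ => g (e + t • v)) (𝓝 0) (𝓝 (g e)) := hg.continuousAt.tendsto.comp hc
    rw [h0] at h5
    exact h5.mono_left nhdsWithin_le_nhds
  · have : Filter.Tendsto (fun t : ℝ => t ^ 2) (𝓝 0) (𝓝 0) := by
      simpa using (continuous_pow 2 (M := ℝ)).tendsto 0
    exact this.mono_left nhdsWithin_le_nhds
  · have h6 := hd2.tendsto_slope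
    have h7 := h6.div_const 2
    refine h7.congr fun t => ?_
    simp [slope_def_field, h1]
    ring

/-! ### Local coordinates on manifolds -/

section LocalCoordinates

variable {E : Type*} [NormedAddCommGroup E] [NormedSpace ℝ E]
  {M : Type*} [TopologicalSpace M] [ChartedSpace E M]

theorem mfderiv_eq_fderiv_chart {F : Type*} [NormedAddCommGroup F] [NormedSpace ℝ F]
    {f : M → F} {x : M} (hf : MDifferentiableAt 𝓘(ℝ, E) 𝓘(ℝ, F) f x) :
    (mfderiv 𝓘(ℝ, E) 𝓘(ℝ, F) f x : E →L[ℝ] F) =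
      fderiv ℝ (f ∘ (extChartAt 𝓘(ℝ, E) x).symm) (extChartAt 𝓘(ℝ, E) x x) := by
  rw [hf.mfderiv]
  simp [writtenInExtChartAt, Function.comp_def, chartAt_self_eq]
  rfl

theorem hasFDerivAt_chart {F : Type*} [NormedAddCommGroup F] [NormedSpace ℝ F]
    {f : M → F} {x : M} (hf : MDifferentiableAt 𝓘(ℝ, E) 𝓘(ℝ, F) f x) :
    HasFDerivAt (f ∘ (extChartAt 𝓘(ℝ, E) x).symm)
      (mfderiv 𝓘(ℝ, E) 𝓘(ℝ, F) f x : E →L[ℝ] F) (extChartAt 𝓘(ℝ, E) x x) := by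
  rw [mfderiv_eq_fderiv_chart hf]
  have := hf.2
  simp only [DifferentiableWithinAtProp, modelWithCornersSelf_coe, Set.range_id] at this
  have h2 : DifferentiableAt ℝ (f ∘ (extChartAt 𝓘(ℝ, E) x).symm) (extChartAt 𝓘(ℝ, E) x x) :=
    differentiableWithinAt_univ.1 (by simpa [Function.comp_def, chartAt_self_eq] using this)
  exact h2.hasFDerivAt

/-- The line through `x` in the direction `v` in the preferred chart at `x`. -/
def chartLine {x : M} (v : TangentSpace 𝓘(ℝ, E) x) (t : ℝ) : M :=
  (extChartAt 𝓘(ℝ, E) x).symm (extChartAt 𝓘(ℝ, E) x x + t • (id v : E))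

theorem chartLine_zero {x : M} (v : TangentSpace 𝓘(ℝ, E) x) : chartLine v 0 = x := by
  simp [chartLine]

theorem tendsto_chartLine {x : M} (v : TangentSpace 𝓘(ℝ, E) x) :
    Filter.Tendsto (chartLine v) (𝓝 0) (𝓝 x) := by
  have h1 : Filter.Tendsto (fun t : ℝ => extChartAt 𝓘(ℝ, E) x x + t • (id v : E)) (𝓝 0)
      (𝓝 (extChartAt 𝓘(ℝ, E) x x)) := by
    have : Continuous fun t : ℝ => extChartAt 𝓘(ℝ, E) x x + t • (id v : E) := by fun_prop
    simpa using this.tendsto 0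
  have h2 := (continuousAt_extChartAt_symm (I := 𝓘(ℝ, E)) x).tendsto.comp h1
  simpa [Function.comp_def, chartLine] using! h2

/-- The differential of a real-valued function. -/
def differential (f : M → ℝ) (x : M) : TangentSpace 𝓘(ℝ, E) x →L[ℝ] ℝ :=
  mfderiv 𝓘(ℝ, E) 𝓘(ℝ, ℝ) f x

theorem hasDerivAt_chartLine {f : M → ℝ} {x : M} (hf : MDifferentiableAt 𝓘(ℝ, E) 𝓘(ℝ, ℝ) f x)
    (v : TangentSpace 𝓘(ℝ, E) x) :
    HasDerivAt (fun t => f (chartLine v t)) (differential f x v) 0 := by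
  have h1 : HasDerivAt (fun t : ℝ => extChartAt 𝓘(ℝ, E) x x + t • (id v : E)) (id v : E) 0 := by
    simpa using ((hasDerivAt_id (0 : ℝ)).smul_const (id v : E)).const_add (extChartAt 𝓘(ℝ, E) x x)
  have h2 : HasFDerivAt (f ∘ (extChartAt 𝓘(ℝ, E) x).symm)
      (differential f x : E →L[ℝ] ℝ) (extChartAt 𝓘(ℝ, E) x x + (0 : ℝ) • (id v : E)) := by
    rw [zero_smul, add_zero]
    exact hasFDerivAt_chart hf
  exact h2.comp_hasDerivAt 0 h1

theorem tendsto_chartLine_div {f : M → ℝ} {x : M} (hf : MDifferentiableAt 𝓘(ℝ, E) 𝓘(ℝ, ℝ) f x)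
    (h0 : f x = 0) (v : TangentSpace 𝓘(ℝ, E) x) :
    Filter.Tendsto (fun t : ℝ => f (chartLine v t) / t) (𝓝[≠] 0) (𝓝 (differential f x v)) := by
  refine (hasDerivAt_chartLine hf v).tendsto_slope.congr fun t => ?_
  rw [slope_def_field, chartLine_zero, h0, sub_zero, sub_zero]

variable [IsManifold 𝓘(ℝ, E) ∞ M]

theorem contDiffAt_chart {F : Type*} [NormedAddCommGroup F] [NormedSpace ℝ F]
    {f : M → F} {x : M} (hf : ContMDiffAt 𝓘(ℝ, E) 𝓘(ℝ, F) ∞ f x) :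
    ContDiffAt ℝ ∞ (f ∘ (extChartAt 𝓘(ℝ, E) x).symm) (extChartAt 𝓘(ℝ, E) x x) := by
  have := (contMDiffAt_iff.1 hf).2
  simpa [Function.comp_def, contDiffWithinAt_univ, chartAt_self_eq] using this

/-- The Hessian is defined in the chart in which `chartLine` is a straight line, so the second-order
limit along it recovers precisely this Hessian. Identities between functions near x thereby become
identities between Hessians. -/
theorem tendsto_chartLine_div_sq {f : M → ℝ} {x : M} (hf : ContMDiffAt 𝓘(ℝ, E) 𝓘(ℝ, ℝ) ∞ f x)
    (h0 : f x = 0) (h1 : mfderiv 𝓘(ℝ, E) 𝓘(ℝ, ℝ) f x = 0) (v : TangentSpace 𝓘(ℝ, E) x) :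
    Filter.Tendsto (fun t : ℝ => f (chartLine v t) / t ^ 2) (𝓝[≠] 0)
      (𝓝 (hessian f x v v / 2)) := by
  refine tendsto_div_sq (E := E) (contDiffAt_chart hf) (by simpa using h0) ?_ v
  rw [← mfderiv_eq_fderiv_chart (hf.mdifferentiableAt (by simp))]
  exact h1

theorem hessian_comm {f : M → ℝ} {x : M} (hf : ContMDiffAt 𝓘(ℝ, E) 𝓘(ℝ, ℝ) ∞ f x)
    (v w : TangentSpace 𝓘(ℝ, E) x) : hessian f x v w = hessian f x w v :=
  ((contDiffAt_chart hf).isSymmSndFDerivAt (by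
    rw [minSmoothness_of_isRCLikeNormedField]
    exact WithTop.coe_le_coe.2 (le_top : (2 : ℕ∞) ≤ ⊤))).eq v w

/-- A map with bijective derivative has a smooth local inverse. -/
theorem exists_local_inverse [FiniteDimensional ℝ E] {ι : Type} [Fintype ι] {x₀ : M}
    {u : M → ι → ℝ} {V : Set M}
    (hV : IsOpen V) (hx₀ : x₀ ∈ V) (hu : ContMDiffOn 𝓘(ℝ, E) 𝓘(ℝ, ι → ℝ) ∞ u V)
    (hb : Function.Bijective (mfderiv 𝓘(ℝ, E) 𝓘(ℝ, ι → ℝ) u x₀)) :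
    ∃ (U : Set M) (O : Set (ι → ℝ)) (ψ : (ι → ℝ) → M), IsOpen U ∧ x₀ ∈ U ∧ U ⊆ V ∧ IsOpen O ∧
      ContMDiffOn 𝓘(ℝ, ι → ℝ) 𝓘(ℝ, E) ∞ ψ O ∧ (∀ y ∈ U, u y ∈ O ∧ ψ (u y) = y) ∧
      ∀ o ∈ O, ψ o ∈ U ∧ u (ψ o) = o := by
  have : CompleteSpace E := FiniteDimensional.complete ℝ E
  let e := extChartAt 𝓘(ℝ, E) x₀
  have hux : ContMDiffAt 𝓘(ℝ, E) 𝓘(ℝ, ι → ℝ) ∞ u x₀ := (hu x₀ hx₀).contMDiffAt (hV.mem_nhds hx₀)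
  have het : IsOpen e.target := isOpen_extChartAt_target x₀
  have hex : e x₀ ∈ e.target := mem_extChartAt_target x₀
  have hE : IsOpen (e.target ∩ e.symm ⁻¹' V) :=
    (continuousOn_extChartAt_symm x₀).isOpen_inter_preimage het hV
  have hu1 : ContDiffOn ℝ ∞ (u ∘ e.symm) (e.target ∩ e.symm ⁻¹' V) := by
    refine contMDiffOn_iff_contDiffOn.1 ?_
    exact hu.comp ((contMDiffOn_extChartAt_symm x₀).mono Set.inter_subset_left) fun y hy => hy.2
  have hu0 : ContDiffAt ℝ ∞ (u ∘ e.symm) (e x₀) := contDiffAt_chart hux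
  let A₀ : E →L[ℝ] (ι → ℝ) := mfderiv 𝓘(ℝ, E) 𝓘(ℝ, ι → ℝ) u x₀
  let A : E ≃L[ℝ] (ι → ℝ) := (LinearEquiv.ofBijective A₀.toLinearMap hb).toContinuousLinearEquiv
  have hAA : (A : E →L[ℝ] (ι → ℝ)) = A₀ := by ext; rfl
  have hA : HasFDerivAt (u ∘ e.symm) (A : E →L[ℝ] (ι → ℝ)) (e x₀) := by
    have := hasFDerivAt_chart (hux.mdifferentiableAt (by simp))
    rwa [hAA]
  let r := hu0.toOpenPartialHomeomorph (u ∘ e.symm) hA (by simp)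
  have hr : (r : E → ι → ℝ) = u ∘ e.symm := rfl
  -- Smoothness of the inverse at a point needs an invertible derivative at the preimage, so the
  -- neighbourhood is shrunk until the derivative is invertible throughout.
  have hinv : ∀ᶠ z in 𝓝 (e x₀), ∃ B : E ≃L[ℝ] (ι → ℝ), (B : E →L[ℝ] (ι → ℝ)) = fderiv ℝ (u ∘ e.symm) z := by
    have hc : ContinuousAt (fderiv ℝ (u ∘ e.symm)) (e x₀) :=
      (hu0.fderiv_right (m := ∞) (by simp)).continuousAt
    have h2 := A.nhds
    rw [← hA.fderiv] at h2
    exact hc.eventually h2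
  obtain ⟨E₁, hE₁, hE₁o, hxE₁⟩ := mem_nhds_iff.1 (Filter.inter_mem (Filter.inter_mem hinv
    (r.open_source.mem_nhds (hu0.mem_toOpenPartialHomeomorph_source hA (by simp))))
    (hE.mem_nhds ⟨hex, by simpa [e] using hx₀⟩))
  have hO : IsOpen (r.target ∩ r.symm ⁻¹' E₁) := r.symm.isOpen_inter_preimage hE₁o
  have hU : IsOpen (e.source ∩ e ⁻¹' E₁) :=
    (continuousOn_extChartAt x₀).isOpen_inter_preimage (isOpen_extChartAt_source x₀) hE₁o
  refine ⟨e.source ∩ e ⁻¹' E₁, r.target ∩ r.symm ⁻¹' E₁, e.symm ∘ r.symm, hU,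
    ⟨mem_extChartAt_source x₀, hxE₁⟩, ?_, hO, ?_, ?_, ?_⟩
  · rintro y ⟨hy, hyE⟩
    have := (hE₁ hyE).2.2
    rwa [Set.mem_preimage, e.left_inv hy] at this
  · refine (contMDiffOn_extChartAt_symm x₀).comp (t := e.target) ?_ ?_
    · refine contMDiffOn_iff_contDiffOn.2 fun o ho => ContDiffAt.contDiffWithinAt ?_
      obtain ⟨B, hB⟩ := (hE₁ ho.2).1.1
      have hz := (hE₁ ho.2).2
      have hz' := hu1.contDiffAt (hE.mem_nhds hz)
      refine r.contDiffAt_symm (f₀' := B) ho.1 ?_ hz'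
      rw [hB]
      exact (hz'.differentiableAt (by simp)).hasFDerivAt
    · exact fun o ho => (hE₁ ho.2).2.1
  · rintro y ⟨hy, hyE⟩
    have h1 : u y = r (e y) := by rw [hr, Function.comp_apply, e.left_inv hy]
    have h2 : e y ∈ r.source := (hE₁ hyE).1.2
    rw [h1]
    refine ⟨⟨r.map_source h2, ?_⟩, ?_⟩
    · rw [Set.mem_preimage, r.left_inv h2]; exact hyE
    · rw [Function.comp_apply, r.left_inv h2, e.left_inv hy]
  · rintro o ⟨ho, hoE⟩
    have h1 : r.symm o ∈ e.target := (hE₁ hoE).2.1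
    refine ⟨⟨e.map_target h1, ?_⟩, ?_⟩
    · rw [Set.mem_preimage, Function.comp_apply, e.right_inv h1]; exact hoE
    · exact r.right_inv ho

end LocalCoordinates

/-! ### Smooth elliptic divisors on open subsets, and cancellation of products of their functions.
-/

section Tangent

variable {E : Type*} [NormedAddCommGroup E] [NormedSpace ℝ E]
  {M : Type*} [TopologicalSpace M] [ChartedSpace E M]

theorem tangentTo_inter {Z V : Set M} (hV : IsOpen V) {x : M} (hx : x ∈ V) :
    tangentTo (E := E) (Z ∩ V) x = tangentTo Z x := by
  refine le_antisymm (fun v hv W h hW hxW hh hz => ?_) fun v hv W h hW hxW hh hz => ?_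
  · exact hv W h hW hxW hh fun y hy => hz y ⟨hy.1, hy.2.1⟩
  · exact hv (W ∩ V) h (hW.inter hV) ⟨hxW, hx⟩ (hh.mono Set.inter_subset_left)
      fun y hy => hz y ⟨hy.1.1, hy.2, hy.1.2⟩

theorem zerosIn_eq_inter {U V : Set M} (hVU : V ⊆ U) (f : M → ℝ) :
    zerosIn V f = zerosIn U f ∩ V := by
  ext y
  simp only [zerosIn, Set.mem_ofPred_eq, Set.mem_inter_iff]
  exact ⟨fun h => ⟨⟨hVU h.1, h.2⟩, h.1⟩, fun h => ⟨h.2, h.1.2⟩⟩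

theorem IsSmoothElliptic.restrict {U V : Set M} (hV : IsOpen V) (hVU : V ⊆ U) {f : M → ℝ}
    (h : IsSmoothElliptic E U f) : IsSmoothElliptic E V f where
  smooth := h.smooth.mono hVU
  codim_two := by
    rintro x ⟨hxV, hx⟩
    obtain ⟨W, g, hW, hxW, hg, hs, hz⟩ := h.codim_two x ⟨hVU hxV, hx⟩
    refine ⟨W ∩ V, g, hW.inter hV, ⟨hxW, hxV⟩, hg.mono Set.inter_subset_left, hs, fun y hy => ?_⟩
    rw [zerosIn_eq_inter hVU, ← hz y hy.1]
    exact ⟨fun h => h.1, fun h => ⟨h, hy.2⟩⟩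
  critical := fun x hx => h.critical x ⟨hVU hx.1, hx.2⟩
  definite := by
    intro x hx v hv
    rw [zerosIn_eq_inter hVU, tangentTo_inter hV hx.1] at hv
    exact h.definite x ⟨hVU hx.1, hx.2⟩ v hv

/-- If f vanished on V, the submersion to ℝ² that cuts out the zero set would be locally constant.
-/
theorem IsSmoothElliptic.exists_ne_zero {U V : Set M} (hV : IsOpen V) (hVU : V ⊆ U) {f : M → ℝ}
    (h : IsSmoothElliptic E U f) (hne : V.Nonempty) : ∃ y ∈ V, f y ≠ 0 := by
  by_contra! hall
  obtain ⟨x, hx⟩ := hne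
  obtain ⟨W, g, hW, hxW, hg, hs, hz⟩ := h.codim_two x ⟨hVU hx, hall x hx⟩
  have h0 : g =ᶠ[𝓝 x] fun _ => 0 := by
    filter_upwards [(hW.inter hV).mem_nhds ⟨hxW, hx⟩] with y hy
    exact (hz y hy.1).1 ⟨hVU hy.2, hall y hy.2⟩
  rw [h0.mfderiv_eq, mfderiv_const] at hs
  obtain ⟨v, hv⟩ := hs (EuclideanSpace.single 0 1)
  have h1 : (0 : EuclideanSpace ℝ (Fin 2)) = EuclideanSpace.single 0 1 := hv
  have := congrArg (fun z : EuclideanSpace ℝ (Fin 2) => z 0) h1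
  simp at this

/-- The functions are made nonzero one at a time on shrinking open sets. Hence quotients by the
product are unique when they are continuous. -/
theorem exists_prod_ne_zero {U : Set M} {j : ℕ} {f : Fin j → M → ℝ}
    (h : ∀ i, IsSmoothElliptic E U (f i)) {V : Set M} (hV : IsOpen V) (hVU : V ⊆ U)
    (hne : V.Nonempty) : ∃ y ∈ V, ∏ i, f i y ≠ 0 := by
  have key : ∀ (s : Finset (Fin j)) (V : Set M), IsOpen V → V ⊆ U → V.Nonempty →
      ∃ y ∈ V, ∀ i ∈ s, f i y ≠ 0 := by
    intro s
    induction s using Finset.induction_on with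
    | empty => exact fun V _ _ ⟨y, hy⟩ => ⟨y, hy, by simp⟩
    | insert a s _ ih =>
      intro V hV hVU hne
      obtain ⟨y, hy, hya⟩ := (h a).exists_ne_zero hV hVU hne
      obtain ⟨z, hz, hzs⟩ := ih (V ∩ f a ⁻¹' {0}ᶜ)
        (((h a).smooth.continuousOn.mono hVU).isOpen_inter_preimage hV isOpen_compl_singleton)
        (Set.inter_subset_left.trans hVU) ⟨y, hy, hya⟩
      refine ⟨z, hz.1, fun i hi => ?_⟩
      rcases Finset.mem_insert.1 hi with rfl | hi
      · exact hz.2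
      · exact hzs i hi
  obtain ⟨y, hy, h1⟩ := key Finset.univ V hV hVU hne
  exact ⟨y, hy, Finset.prod_ne_zero_iff.2 h1⟩

/-- Two continuous functions agree if their products with `∏ f_i` do. -/
theorem eq_of_eventually_mul_prod_eq {U : Set M} (hU : IsOpen U) {j : ℕ} {f : Fin j → M → ℝ}
    (h : ∀ i, IsSmoothElliptic E U (f i)) {x : M} (hx : x ∈ U) {a b : M → ℝ}
    (ha : ContinuousAt a x) (hb : ContinuousAt b x)
    (hab : ∀ᶠ y in 𝓝 x, a y * ∏ i, f i y = b y * ∏ i, f i y) : a x = b x := by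
  by_contra hne
  have h1 : ∀ᶠ y in 𝓝 x, a y ≠ b y := by
    have := (ha.sub hb).eventually_ne (sub_ne_zero.2 hne)
    filter_upwards [this] with y hy
    exact sub_ne_zero.1 hy
  obtain ⟨V, hV, hVo, hxV⟩ := mem_nhds_iff.1 (Filter.inter_mem (Filter.inter_mem hab h1)
    (hU.mem_nhds hx))
  obtain ⟨y, hy, hy0⟩ := exists_prod_ne_zero h hVo (fun y hy => (hV hy).2) ⟨x, hxV⟩
  exact (hV hy).1.2 (mul_right_cancel₀ hy0 (hV hy).1.1)

end Tangent

/-! ### Local representations of elliptic divisors -/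

section LocalDivisors

variable {E : Type*} [NormedAddCommGroup E] [NormedSpace ℝ E]
  {M : Type*} [TopologicalSpace M] [ChartedSpace E M]
  {R : M → Type*} [TopologicalSpace (TotalSpace ℝ R)]
  [∀ x, AddCommGroup (R x)] [∀ x, Module ℝ (R x)] [∀ x, TopologicalSpace (R x)]
  [FiberBundle ℝ R] {q : ∀ x, R x}

theorem IsSmoothDualSection.contMDiffOn_apply (hq : IsRealDivisor E q) {U : Set M}
    {φ : ∀ x, R x →ₗ[ℝ] ℝ} (hφ : IsSmoothDualSection E U φ) :
    ContMDiffOn 𝓘(ℝ, E) 𝓘(ℝ, ℝ) ∞ (fun x => φ x (q x)) U :=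
  ContMDiffOn.comp (g := fun v : TotalSpace ℝ R => φ v.1 v.2) hφ hq.1.contMDiffOn fun _ hx => hx

theorem IsSmoothDualSection.smul {U : Set M} {φ : ∀ x, R x →ₗ[ℝ] ℝ}
    (hφ : IsSmoothDualSection E U φ) {a : M → ℝ} (ha : ContMDiffOn 𝓘(ℝ, E) 𝓘(ℝ, ℝ) ∞ a U) :
    IsSmoothDualSection E U (fun x => a x • φ x) := by
  have h1 : ContMDiffOn (𝓘(ℝ, E).prod 𝓘(ℝ, ℝ)) 𝓘(ℝ, ℝ) ∞ (fun v : TotalSpace ℝ R => a v.1)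
      {v | v.1 ∈ U} := ha.comp (contMDiff_proj R).contMDiffOn fun _ hv => hv
  exact h1.mul hφ

theorem IsSmoothDualSection.cutoff {U : Set M} (hU : IsOpen U) {φ : ∀ x, R x →ₗ[ℝ] ℝ}
    (hφ : IsSmoothDualSection E U φ) {χ : M → ℝ} (hχ : ContMDiff 𝓘(ℝ, E) 𝓘(ℝ, ℝ) ∞ χ)
    (hs : tsupport χ ⊆ U) : IsSmoothDualSection E Set.univ (fun x => χ x • φ x) := by
  have hp : ContMDiff (𝓘(ℝ, E).prod 𝓘(ℝ, ℝ)) 𝓘(ℝ, E) ∞ (fun v : TotalSpace ℝ R => v.1) :=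
    contMDiff_proj R
  refine ContMDiff.contMDiffOn ?_
  refine contMDiff_cutoff_mul (U := {v : TotalSpace ℝ R | v.1 ∈ U})
    (hU.preimage hp.continuous) (hχ.comp hp) ?_ hφ
  exact (tsupport_comp_subset_preimage χ hp.continuous).trans fun v hv => hs hv

theorem IsLocalNormalCrossing.contMDiffOn_prod {U : Set M} {j : ℕ} {f : Fin j → M → ℝ}
    (h : IsLocalNormalCrossing E q U f) :
    ContMDiffOn 𝓘(ℝ, E) 𝓘(ℝ, ℝ) ∞ (fun x => ∏ i, f i x) U :=
  contMDiffOn_finsetProd fun i _ => (h.elliptic i).smooth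

theorem IsLocalNormalCrossing.exists_dual {U : Set M} {j : ℕ} {f : Fin j → M → ℝ}
    (h : IsLocalNormalCrossing E q U f) :
    ∃ φ : ∀ x, R x →ₗ[ℝ] ℝ, IsSmoothDualSection E U φ ∧ ∀ x ∈ U, ∏ i, f i x = φ x (q x) :=
  (h.ideal_eq _ h.contMDiffOn_prod).2 ⟨fun _ => 1, contMDiffOn_const, fun _ _ => (one_mul _).symm⟩

/-- The local generator comes from a dual section over U only; the cutoff makes this section global.
-/
theorem IsLocalNormalCrossing.mul_mem_ideal {U : Set M} (hU : IsOpen U) {j : ℕ} {f : Fin j → M → ℝ}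
    (h : IsLocalNormalCrossing E q U f) {c χ : M → ℝ} (hχ : ContMDiff 𝓘(ℝ, E) 𝓘(ℝ, ℝ) ∞ χ)
    (hs : tsupport χ ⊆ U) (hc : ContMDiffOn 𝓘(ℝ, E) 𝓘(ℝ, ℝ) ∞ c U)
    {g : C^∞⟮𝓘(ℝ, E), M; 𝓘(ℝ, ℝ), ℝ⟯} (hg : ∀ x, g x = χ x * (c x * ∏ i, f i x)) :
    g ∈ ideal E q := by
  obtain ⟨φ, hφ, h1⟩ := h.exists_dual
  refine ⟨_, (hφ.smul hc).cutoff hU hχ hs, fun x => ?_⟩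
  rw [hg]
  by_cases hx : x ∈ U
  · simp [h1 x hx]
  · have : χ x = 0 := image_eq_zero_of_notMem_tsupport fun h => hx (hs h)
    simp [this]

theorem IsLocalNormalCrossing.exists_eq_mul_of_mem_ideal {U : Set M}
    {j : ℕ} {f : Fin j → M → ℝ}
    (h : IsLocalNormalCrossing E q U f) {g : C^∞⟮𝓘(ℝ, E), M; 𝓘(ℝ, ℝ), ℝ⟯} (hg : g ∈ ideal E q) :
    ∃ a : M → ℝ, ContMDiffOn 𝓘(ℝ, E) 𝓘(ℝ, ℝ) ∞ a U ∧ ∀ x ∈ U, g x = a x * ∏ i, f i x := by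
  obtain ⟨φ, hφ, h1⟩ := hg
  refine (h.ideal_eq g g.contMDiff.contMDiffOn).1 ⟨φ, ?_, fun x _ => h1 x⟩
  exact ContMDiffOn.mono hφ fun _ _ => trivial

variable [FiniteDimensional ℝ E] [T2Space M] [IsManifold 𝓘(ℝ, E) ∞ M]

/-- The ideal condition concerns dual sections over U, whereas φ lives over V. A cutoff supported in
U ∩ V turns φ into a global section without changing it near x. -/
theorem IsLocalNormalCrossing.exists_eventually_eq_mul (hq : IsRealDivisor E q) {U V : Set M}
    (hU : IsOpen U) (hV : IsOpen V) {j : ℕ} {f : Fin j → M → ℝ}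
    (h : IsLocalNormalCrossing E q U f) {x : M} (hxU : x ∈ U) (hxV : x ∈ V)
    {φ : ∀ x, R x →ₗ[ℝ] ℝ} (hφ : IsSmoothDualSection E V φ) :
    ∃ a : M → ℝ, ContMDiffOn 𝓘(ℝ, E) 𝓘(ℝ, ℝ) ∞ a U ∧
      ∀ᶠ y in 𝓝 x, φ y (q y) = a y * ∏ i, f i y := by
  obtain ⟨χ, hs, h1⟩ := exists_cutoff (E := E) (hU.inter hV) ⟨hxU, hxV⟩
  have h2 := hφ.cutoff hV χ.contMDiff (hs.trans Set.inter_subset_right)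
  have h3 := h2.contMDiffOn_apply hq
  obtain ⟨a, ha, hag⟩ := (h.ideal_eq _ (h3.mono (Set.subset_univ U))).1
    ⟨fun x => χ x • φ x, ContMDiffOn.mono (s := {v : TotalSpace ℝ R | v.1 ∈ Set.univ}) h2
      fun _ _ => trivial, fun _ _ => rfl⟩
  refine ⟨a, ha, ?_⟩
  filter_upwards [h1, hU.mem_nhds hxU] with y hy hyU
  rw [← hag y hyU]
  simp [hy]

/-- Each product divides the other near x. The product of the two quotients fixes ∏ f_i, so it is 1
at x by cancellation. -/
theorem IsLocalNormalCrossing.exists_unit (hq : IsRealDivisor E q) {U V : Set M}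
    (hU : IsOpen U) (hV : IsOpen V) {j k : ℕ} {f : Fin j → M → ℝ} {g : Fin k → M → ℝ}
    (h : IsLocalNormalCrossing E q U f) (h' : IsLocalNormalCrossing E q V g) {x : M} (hxU : x ∈ U)
    (hxV : x ∈ V) : ∃ a : M → ℝ, ContinuousAt a x ∧ a x ≠ 0 ∧
      ∀ᶠ y in 𝓝 x, ∏ i, g i y = a y * ∏ i, f i y := by
  obtain ⟨φ, hφ, h1⟩ := h.exists_dual
  obtain ⟨ψ, hψ, h2⟩ := h'.exists_dual
  obtain ⟨a, ha, haf⟩ := h.exists_eventually_eq_mul hq hU hV hxU hxV hψ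
  obtain ⟨b, hb, hbf⟩ := h'.exists_eventually_eq_mul hq hV hU hxV hxU hφ
  have hac := ha.continuousOn.continuousAt (hU.mem_nhds hxU)
  have hbc := hb.continuousOn.continuousAt (hV.mem_nhds hxV)
  have haf' : ∀ᶠ y in 𝓝 x, ∏ i, g i y = a y * ∏ i, f i y := by
    filter_upwards [haf, hV.mem_nhds hxV] with y hy hyV
    rw [h2 y hyV, hy]
  refine ⟨a, hac, fun h0 => ?_, haf'⟩
  have h3 := eq_of_eventually_mul_prod_eq (E := E) hU h.elliptic hxU (a := fun y => b y * a y)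
    (b := fun _ => 1) (hbc.mul hac) continuousAt_const (by
      filter_upwards [haf', hbf, hU.mem_nhds hxU] with y hy hy' hyU
      rw [mul_assoc, ← hy, ← hy', one_mul, h1 y hyU])
  simp [h0] at h3

/-- A dual section over V need not extend to U, so its quotient by ∏ f_i is first found near each
point of V; uniqueness of the quotient glues the pieces. -/
theorem IsLocalNormalCrossing.restrict (hq : IsRealDivisor E q) {U V : Set M} (hU : IsOpen U)
    (hV : IsOpen V) (hVU : V ⊆ U) {j : ℕ} {f : Fin j → M → ℝ}
    (h : IsLocalNormalCrossing E q U f) : IsLocalNormalCrossing E q V f where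
  elliptic i := (h.elliptic i).restrict hV hVU
  transverse := by
    intro x hx v
    obtain ⟨w, hw⟩ := h.transverse x (hVU hx) v
    refine ⟨w, fun i hi => ?_⟩
    rw [zerosIn_eq_inter hVU, tangentTo_inter hV hx]
    exact hw i hi
  ideal_eq := by
    intro g hg
    constructor
    · rintro ⟨φ, hφ, hgφ⟩
      choose a ha hag using fun y : V =>
        h.exists_eventually_eq_mul hq hU hV (hVU y.2) y.2 hφ
      classical
      -- At y the quotient chosen for y itself is used; near a fixed x it agrees with the quotient
      -- chosen for x.
      let b : M → ℝ := fun y => if hy : y ∈ V then a ⟨y, hy⟩ y else 0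
      have hb : ∀ (x : V), ∀ᶠ y in 𝓝 (x : M), b y = a x y := by
        intro x
        filter_upwards [(hag x).eventually_nhds, hV.mem_nhds x.2] with y hy hyV
        have h1 := eq_of_eventually_mul_prod_eq (E := E) hU h.elliptic (hVU hyV)
          ((ha ⟨y, hyV⟩).continuousOn.continuousAt (hU.mem_nhds (hVU hyV)))
          ((ha x).continuousOn.continuousAt (hU.mem_nhds (hVU hyV))) (by
            filter_upwards [hag ⟨y, hyV⟩, hy] with z hz hz'
            rw [← hz, hz'])
        simp only [b, hyV, dif_pos, h1]
      refine ⟨b, fun x hx => ?_, fun x hx => ?_⟩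
      · exact (((ha ⟨x, hx⟩ x (hVU hx)).contMDiffAt (hU.mem_nhds (hVU hx))).congr_of_eventuallyEq
          (hb ⟨x, hx⟩)).contMDiffWithinAt
      · rw [(hb ⟨x, hx⟩).self_of_nhds, ← (hag ⟨x, hx⟩).self_of_nhds, hgφ x hx]
    · rintro ⟨a, ha, hga⟩
      obtain ⟨φ, hφ, h1⟩ := h.exists_dual
      have hφV : IsSmoothDualSection E V φ := ContMDiffOn.mono hφ fun _ hv => hVU hv
      refine ⟨_, hφV.smul ha, fun x hx => ?_⟩
      rw [hga x hx, h1 x (hVU hx)]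
      simp

/-- A nonvanishing function can be dropped from a local normal crossing. -/
theorem IsLocalNormalCrossing.drop {U : Set M} {j : ℕ}
    {f : Fin (j + 1) → M → ℝ} (h : IsLocalNormalCrossing E q U f) (i : Fin (j + 1))
    (hi : ∀ x ∈ U, f i x ≠ 0) : IsLocalNormalCrossing E q U (fun k => f (i.succAbove k)) where
  elliptic k := h.elliptic _
  transverse := by
    intro x hx v
    obtain ⟨w, hw⟩ := h.transverse x hx (i.insertNth 0 v)
    refine ⟨w, fun k hk => ?_⟩
    have := hw (i.succAbove k) hk
    rwa [Fin.insertNth_apply_succAbove] at this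
  ideal_eq := by
    intro g hg
    rw [h.ideal_eq g hg]
    constructor
    · rintro ⟨a, ha, h1⟩
      refine ⟨fun x => a x * f i x, ha.mul (h.elliptic i).smooth, fun x hx => ?_⟩
      rw [h1 x hx, Fin.prod_univ_succAbove _ i, mul_assoc]
    · rintro ⟨a, ha, h1⟩
      refine ⟨fun x => a x * (f i x)⁻¹, ha.mul ((h.elliptic i).smooth.inv₀ hi), fun x hx => ?_⟩
      rw [h1 x hx, Fin.prod_univ_succAbove _ i]
      field_simp [hi x hx]

theorem pointIntersectionNumber_le {U : Set M} (hU : IsOpen U) {j : ℕ}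
    {f : Fin j → M → ℝ} (h : IsLocalNormalCrossing E q U f) {x : M} (hx : x ∈ U) :
    pointIntersectionNumber E q x ≤ j :=
  Nat.sInf_le ⟨U, hU, hx, f, h⟩

theorem exists_isLocalNormalCrossing (hq : IsElliptic E q) {n : ℕ} {x : M}
    (hx : x ∈ stratum E q n) : ∃ U : Set M, IsOpen U ∧ x ∈ U ∧
      ∃ f : Fin n → M → ℝ, IsLocalNormalCrossing E q U f := by
  obtain ⟨U, hU, hxU, j, f, hf⟩ := hq.2 x
  have h1 := Nat.sInf_mem (s := {j : ℕ | ∃ U : Set M, IsOpen U ∧ x ∈ U ∧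
    ∃ f : Fin j → M → ℝ, IsLocalNormalCrossing E q U f}) ⟨j, U, hU, hxU, f, hf⟩
  have h2 : pointIntersectionNumber E q x = n := hx
  rw [pointIntersectionNumber] at h2
  rw [h2] at h1
  exact h1

/-- A function that is nonzero at x could be dropped near x, which would represent the divisor by n
- 1 functions and contradict minimality. -/
theorem IsLocalNormalCrossing.eq_zero_of_mem_stratum (hq : IsRealDivisor E q) {U : Set M}
    (hU : IsOpen U) {n : ℕ} {f : Fin n → M → ℝ} (h : IsLocalNormalCrossing E q U f) {x : M}
    (hxU : x ∈ U) (hx : x ∈ stratum E q n) (i : Fin n) : f i x = 0 := by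
  by_contra hne
  obtain _ | j := n
  · exact i.elim0
  have hV : IsOpen (U ∩ f i ⁻¹' {0}ᶜ) :=
    (h.elliptic i).smooth.continuousOn.isOpen_inter_preimage hU isOpen_compl_singleton
  have h1 := pointIntersectionNumber_le hV
    ((h.restrict hq hU hV Set.inter_subset_left).drop i fun y hy => hy.2) ⟨hxU, hne⟩
  have h2 : pointIntersectionNumber E q x = j + 1 := hx
  omega

end LocalDivisors

/-! ### Adapted coordinates near a stratum -/

section Straightening

variable {E : Type*} [NormedAddCommGroup E] [NormedSpace ℝ E]
  {M : Type*} [TopologicalSpace M] [ChartedSpace E M]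

theorem mfderiv_clm_comp {F G : Type*} [NormedAddCommGroup F] [NormedSpace ℝ F]
    [NormedAddCommGroup G] [NormedSpace ℝ G] (L : F →L[ℝ] G) {f : M → F} {x : M}
    (hf : MDifferentiableAt 𝓘(ℝ, E) 𝓘(ℝ, F) f x) (v : TangentSpace 𝓘(ℝ, E) x) :
    mfderiv 𝓘(ℝ, E) 𝓘(ℝ, G) (fun y => L (f y)) x v = L (mfderiv 𝓘(ℝ, E) 𝓘(ℝ, F) f x v) := by
  have h := (L.hasMFDerivAt (x := f x)).comp x hf.hasMFDerivAt
  exact congrArg (fun A => A v) h.mfderiv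

theorem mfderiv_pi_apply {ι : Type} [Fintype ι] {u : M → ι → ℝ} {x : M}
    (hu : MDifferentiableAt 𝓘(ℝ, E) 𝓘(ℝ, ι → ℝ) u x) (v : TangentSpace 𝓘(ℝ, E) x) (l : ι) :
    (mfderiv 𝓘(ℝ, E) 𝓘(ℝ, ι → ℝ) u x v : ι → ℝ) l =
      differential (fun y => u y l) x v :=
  (mfderiv_clm_comp (ContinuousLinearMap.proj (R := ℝ) (φ := fun _ : ι => ℝ) l) hu v).symm

theorem differential_mul {f g : M → ℝ} {x : M}
    (hf : MDifferentiableAt 𝓘(ℝ, E) 𝓘(ℝ, ℝ) f x) (hg : MDifferentiableAt 𝓘(ℝ, E) 𝓘(ℝ, ℝ) g x)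
    (v : TangentSpace 𝓘(ℝ, E) x) : differential (fun y => f y * g y) x v =
      differential f x v * g x + f x * differential g x v := by
  have h := ((hasDerivAt_chartLine (hf.mul hg) v)).unique
    ((hasDerivAt_chartLine hf v).mul (hasDerivAt_chartLine hg v))
  rw [chartLine_zero] at h
  exact h

theorem differential_add {f g : M → ℝ} {x : M}
    (hf : MDifferentiableAt 𝓘(ℝ, E) 𝓘(ℝ, ℝ) f x) (hg : MDifferentiableAt 𝓘(ℝ, E) 𝓘(ℝ, ℝ) g x)
    (v : TangentSpace 𝓘(ℝ, E) x) : differential (fun y => f y + g y) x v =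
      differential f x v + differential g x v :=
  (hasDerivAt_chartLine (hf.add hg) v).unique
    ((hasDerivAt_chartLine hf v).add (hasDerivAt_chartLine hg v))

/-- B consists of linear coordinates on ker A, composed with a linear projection onto ker A. -/
theorem exists_complement [FiniteDimensional ℝ E] {κ : Type} (A : E →ₗ[ℝ] κ → ℝ)
    (hA : Function.Surjective A) : ∃ (d : ℕ) (B : E →L[ℝ] Fin d → ℝ),
      Function.Bijective fun v => (Sum.elim (A v) (B v) : κ ⊕ Fin d → ℝ) := by
  obtain ⟨pr, hpr⟩ := LinearMap.exists_leftInverse_of_injective (LinearMap.ker A).subtype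
    (LinearMap.ker_eq_bot.2 Subtype.coe_injective)
  have hpr' : ∀ k : LinearMap.ker A, pr k = k := fun k => LinearMap.congr_fun hpr k
  let e := (Module.finBasis ℝ (LinearMap.ker A)).equivFun
  refine ⟨_, (e.toLinearMap ∘ₗ pr).toContinuousLinearMap, ?_, ?_⟩
  · intro v w hvw
    have h1 : A (v - w) = 0 := by
      rw [map_sub, sub_eq_zero]
      funext l
      exact congrFun hvw (Sum.inl l)
    have h2 : e (pr (v - w)) = 0 := by
      rw [map_sub, map_sub, sub_eq_zero]
      funext l
      exact congrFun hvw (Sum.inr l)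
    have h3 := hpr' ⟨v - w, h1⟩
    rw [(map_eq_zero_iff e e.injective).1 h2] at h3
    exact sub_eq_zero.1 (congrArg Subtype.val h3).symm
  · intro y
    obtain ⟨v, hv⟩ := hA fun l => y (Sum.inl l)
    refine ⟨v + ((e.symm fun l => y (Sum.inr l)) - pr v : LinearMap.ker A), ?_⟩
    funext l
    obtain l | l := l
    · have : A ((e.symm fun l => y (Sum.inr l)) - pr v : LinearMap.ker A) = 0 :=
        ((e.symm fun l => y (Sum.inr l)) - pr v : LinearMap.ker A).2
      simp only [Sum.elim_inl, map_add, this, add_zero, hv]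
    · simp only [Sum.elim_inr, LinearMap.coe_toContinuousLinearMap', LinearMap.comp_apply, map_add,
        hpr', map_sub, LinearEquiv.coe_coe, LinearEquiv.apply_symm_apply, add_sub_cancel]

variable [IsManifold 𝓘(ℝ, E) ∞ M]

/-- The tangent space at x is identified with E through this same chart. The formula gives the
differentials of the coordinates that are added to complete a system. -/
theorem mfderiv_extChartAt_self (x : M) (v : TangentSpace 𝓘(ℝ, E) x) :
    mfderiv 𝓘(ℝ, E) 𝓘(ℝ, E) (extChartAt 𝓘(ℝ, E) x) x v = (id v : E) := by
  have h1 : MDifferentiableAt 𝓘(ℝ, E) 𝓘(ℝ, E) (extChartAt 𝓘(ℝ, E) x) x :=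
    (contMDiffAt_extChartAt (n := ∞)).mdifferentiableAt (by simp)
  have h2 : (extChartAt 𝓘(ℝ, E) x) ∘ (extChartAt 𝓘(ℝ, E) x).symm
      =ᶠ[𝓝 (extChartAt 𝓘(ℝ, E) x x)] id := by
    filter_upwards [extChartAt_target_mem_nhds x] with y hy
    exact (extChartAt 𝓘(ℝ, E) x).right_inv hy
  have h3 := mfderiv_eq_fderiv_chart h1
  rw [h2.fderiv_eq, fderiv_id] at h3
  exact DFunLike.congr_fun h3 v

/-- Functions with independent differentials are part of a local coordinate system. -/
theorem exists_coordinates [FiniteDimensional ℝ E] {κ : Type} [Fintype κ] {x₀ : M} {V : Set M}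
    (hV : IsOpen V) (hx₀ : x₀ ∈ V) {u : κ → M → ℝ}
    (hu : ∀ l, ContMDiffOn 𝓘(ℝ, E) 𝓘(ℝ, ℝ) ∞ (u l) V)
    (hs : ∀ ξ : κ → ℝ, ∃ v : TangentSpace 𝓘(ℝ, E) x₀,
      ∀ l, differential (u l) x₀ v = ξ l) :
    ∃ (d : ℕ) (w : κ ⊕ Fin d → M → ℝ) (U : Set M) (O : Set (κ ⊕ Fin d → ℝ))
      (ψ : (κ ⊕ Fin d → ℝ) → M), (∀ l, w (Sum.inl l) = u l) ∧ IsOpen U ∧ x₀ ∈ U ∧ U ⊆ V ∧ IsOpen O ∧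
      (∀ l, ContMDiffOn 𝓘(ℝ, E) 𝓘(ℝ, ℝ) ∞ (w l) U) ∧
      ContMDiffOn 𝓘(ℝ, κ ⊕ Fin d → ℝ) 𝓘(ℝ, E) ∞ ψ O ∧
      (∀ y ∈ U, (fun l => w l y) ∈ O ∧ ψ (fun l => w l y) = y) ∧
      ∀ o ∈ O, ψ o ∈ U ∧ ∀ l, w l (ψ o) = o l := by
  let A : E →ₗ[ℝ] κ → ℝ := LinearMap.pi fun l =>
    (differential (u l) x₀ : E →L[ℝ] ℝ).toLinearMap
  obtain ⟨d, B, hB⟩ := exists_complement A fun ξ => by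
    obtain ⟨v, hv⟩ := hs ξ
    exact ⟨v, funext hv⟩
  let w : κ ⊕ Fin d → M → ℝ := Sum.elim u fun l y => B (extChartAt 𝓘(ℝ, E) x₀ y) l
  have hV' : IsOpen (V ∩ (extChartAt 𝓘(ℝ, E) x₀).source) := hV.inter (isOpen_extChartAt_source x₀)
  have hxV' : x₀ ∈ V ∩ (extChartAt 𝓘(ℝ, E) x₀).source := ⟨hx₀, mem_extChartAt_source x₀⟩
  have hw : ∀ l, ContMDiffOn 𝓘(ℝ, E) 𝓘(ℝ, ℝ) ∞ (w l) (V ∩ (extChartAt 𝓘(ℝ, E) x₀).source) := by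
    rintro (l | l)
    · exact (hu l).mono Set.inter_subset_left
    · have h1 : ContMDiffOn 𝓘(ℝ, E) 𝓘(ℝ, E) ∞ (extChartAt 𝓘(ℝ, E) x₀)
          (V ∩ (extChartAt 𝓘(ℝ, E) x₀).source) :=
        contMDiffOn_extChartAt.mono fun y hy => by simpa using hy.2
      exact (((ContinuousLinearMap.proj (R := ℝ) (φ := fun _ : Fin d => ℝ) l).comp B).contMDiff).comp_contMDiffOn h1
  have hwp : ContMDiffOn 𝓘(ℝ, E) 𝓘(ℝ, κ ⊕ Fin d → ℝ) ∞ (fun y l => w l y)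
      (V ∩ (extChartAt 𝓘(ℝ, E) x₀).source) := contMDiffOn_pi_space.2 hw
  have hwd : MDifferentiableAt 𝓘(ℝ, E) 𝓘(ℝ, κ ⊕ Fin d → ℝ) (fun y l => w l y) x₀ :=
    ((hwp x₀ hxV').contMDiffAt (hV'.mem_nhds hxV')).mdifferentiableAt (by simp)
  have hder : ∀ v : TangentSpace 𝓘(ℝ, E) x₀,
      (mfderiv 𝓘(ℝ, E) 𝓘(ℝ, κ ⊕ Fin d → ℝ) (fun y l => w l y) x₀ v : κ ⊕ Fin d → ℝ) =
        Sum.elim (A (id v : E)) (B (id v : E)) := by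
    intro v
    funext l
    rw [mfderiv_pi_apply hwd]
    obtain l | l := l
    · rfl
    · have h1 : MDifferentiableAt 𝓘(ℝ, E) 𝓘(ℝ, E) (extChartAt 𝓘(ℝ, E) x₀) x₀ :=
        (contMDiffAt_extChartAt (n := ∞)).mdifferentiableAt (by simp)
      have h2 := mfderiv_clm_comp
        ((ContinuousLinearMap.proj (R := ℝ) (φ := fun _ : Fin d => ℝ) l).comp B) h1 v
      rw [mfderiv_extChartAt_self] at h2
      exact h2
  obtain ⟨U, O, ψ, hU, hxU, hUV, hO, hψ, h1, h2⟩ := exists_local_inverse hV' hxV' hwp (by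
    have : (mfderiv 𝓘(ℝ, E) 𝓘(ℝ, κ ⊕ Fin d → ℝ) (fun y l => w l y) x₀ : E → κ ⊕ Fin d → ℝ) =
      fun v => Sum.elim (A v) (B v) := funext hder
    exact this ▸ hB)
  exact ⟨d, w, U, O, ψ, fun _ => rfl, hU, hxU, fun y hy => (hUV hy).1, hO,
    fun l => (hw l).mono hUV, hψ, h1, fun o ho => ⟨(h2 o ho).1, fun l => congrFun (h2 o ho).2 l⟩⟩

end Straightening

/-! ### The Morse–Bott lemma for local normal crossings. -/

section MorseBott

variable {E : Type*} [NormedAddCommGroup E] [NormedSpace ℝ E] [FiniteDimensional ℝ E]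
  {M : Type*} [TopologicalSpace M] [T2Space M] [ChartedSpace E M] [IsManifold 𝓘(ℝ, E) ∞ M]

theorem differential_eq_zero_of_mem_tangentTo {Z : Set M} {x : M} {v : TangentSpace 𝓘(ℝ, E) x}
    (hv : v ∈ tangentTo Z x) {U : Set M} {h : M → ℝ} (hU : IsOpen U) (hx : x ∈ U)
    (hh : ContMDiffOn 𝓘(ℝ, E) 𝓘(ℝ, ℝ) ∞ h U) (hz : ∀ y ∈ U ∩ Z, h y = 0) :
    differential h x v = 0 :=
  hv U h hU hx hh hz

theorem mdifferentiableAt_of_contMDiffOn {U : Set M} {h : M → ℝ} (hU : IsOpen U) {x : M}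
    (hx : x ∈ U) (hh : ContMDiffOn 𝓘(ℝ, E) 𝓘(ℝ, ℝ) ∞ h U) : MDifferentiableAt 𝓘(ℝ, E) 𝓘(ℝ, ℝ) h x :=
  ((hh x hx).contMDiffAt (hU.mem_nhds hx)).mdifferentiableAt (by simp)

/-- A pair of functions that cut out the zero set of a function defining a smooth elliptic
divisor. -/
theorem IsSmoothElliptic.exists_equations {U : Set M} (hU : IsOpen U) {f : M → ℝ}
    (h : IsSmoothElliptic E U f) {x : M} (hx : x ∈ U) (h0 : f x = 0) :
    ∃ (V : Set M) (g : Fin 2 → M → ℝ), IsOpen V ∧ x ∈ V ∧ V ⊆ U ∧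
      (∀ a, ContMDiffOn 𝓘(ℝ, E) 𝓘(ℝ, ℝ) ∞ (g a) V) ∧
      (∀ ξ : Fin 2 → ℝ, ∃ v : TangentSpace 𝓘(ℝ, E) x, ∀ a, differential (g a) x v = ξ a) ∧
      ∀ y ∈ V, f y = 0 ↔ ∀ a, g a y = 0 := by
  obtain ⟨W, g, hW, hxW, hg, hs, hz⟩ := h.codim_two x ⟨hx, h0⟩
  have hgd : MDifferentiableAt 𝓘(ℝ, E) 𝓘(ℝ, EuclideanSpace ℝ (Fin 2)) g x :=
    ((hg x hxW).contMDiffAt (hW.mem_nhds hxW)).mdifferentiableAt (by simp)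
  refine ⟨W ∩ U, fun a y => g y a, hW.inter hU, ⟨hxW, hx⟩, Set.inter_subset_right, fun a => ?_,
    fun ξ => ?_, fun y hy => ?_⟩
  · exact ((EuclideanSpace.proj a : EuclideanSpace ℝ (Fin 2) →L[ℝ] ℝ).contMDiff).comp_contMDiffOn
      (hg.mono Set.inter_subset_left)
  · obtain ⟨v, hv⟩ := hs (WithLp.toLp 2 ξ)
    refine ⟨v, fun a => ?_⟩
    have h1 := mfderiv_clm_comp (EuclideanSpace.proj a : EuclideanSpace ℝ (Fin 2) →L[ℝ] ℝ) hgd v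
    rw [hv] at h1
    exact h1
  · have h1 := hz y hy.1
    have h2 : y ∈ zerosIn U f ↔ f y = 0 := ⟨fun h => h.2, fun h => ⟨hy.2, h⟩⟩
    rw [← h2, h1]
    exact ⟨fun h a => by change g y a = 0; rw [h]; rfl, fun h => by ext a; exact h a⟩

variable {R : M → Type*} [TopologicalSpace (TotalSpace ℝ R)]
  [∀ x, AddCommGroup (R x)] [∀ x, Module ℝ (R x)] [∀ x, TopologicalSpace (R x)]
  [FiberBundle ℝ R] {q : ∀ x, R x}

/-- The equations of the branches through a point have independent differentials. -/
theorem IsLocalNormalCrossing.exists_equations {U : Set M} (hU : IsOpen U) {n : ℕ}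
    {f : Fin n → M → ℝ} (h : IsLocalNormalCrossing E q U f) {x : M} (hx : x ∈ U)
    (h0 : ∀ i, f i x = 0) :
    ∃ (V : Set M) (g : Fin n × Fin 2 → M → ℝ), IsOpen V ∧ x ∈ V ∧ V ⊆ U ∧
      (∀ l, ContMDiffOn 𝓘(ℝ, E) 𝓘(ℝ, ℝ) ∞ (g l) V) ∧
      (∀ ξ : Fin n × Fin 2 → ℝ, ∃ v : TangentSpace 𝓘(ℝ, E) x, ∀ l, differential (g l) x v = ξ l) ∧
      ∀ y ∈ V, ∀ i, f i y = 0 ↔ ∀ a, g (i, a) y = 0 := by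
  choose V g hV hxV hVU hg hs hz using fun i => (h.elliptic i).exists_equations hU hx (h0 i)
  refine ⟨U ∩ ⋂ i, V i, fun l => g l.1 l.2, hU.inter (isOpen_iInter_of_finite hV),
    ⟨hx, Set.mem_iInter.2 hxV⟩, Set.inter_subset_left,
    fun l => (hg l.1 l.2).mono fun y hy => Set.mem_iInter.1 hy.2 l.1, fun ξ => ?_,
    fun y hy i => hz i y (Set.mem_iInter.1 hy.2 i)⟩
  choose v hv using fun i => hs i fun a => ξ (i, a)
  -- For every i the vector w agrees with v_i modulo the tangent space of the i-th branch, which the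
  -- differentials of its equations annihilate.
  obtain ⟨w, hw⟩ := h.transverse x hx v
  refine ⟨w, fun l => ?_⟩
  have h1 := differential_eq_zero_of_mem_tangentTo (hw l.1 (h0 l.1)) (hV l.1) (hxV l.1)
    (hg l.1 l.2) fun y hy => (hz l.1 y hy.1).1 hy.2.2 l.2
  rw [map_sub, hv, sub_eq_zero] at h1
  exact h1

/-- The Morse--Bott lemma for local normal crossings. -/
theorem IsLocalNormalCrossing.exists_sum_sq {U : Set M} (hU : IsOpen U) {n : ℕ}
    {f : Fin n → M → ℝ} (h : IsLocalNormalCrossing E q U f) {x : M} (hx : x ∈ U)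
    (h0 : ∀ i, f i x = 0) :
    ∃ (V : Set M) (g : Fin n × Fin 2 → M → ℝ), IsOpen V ∧ x ∈ V ∧ V ⊆ U ∧
      (∀ l, ContMDiffOn 𝓘(ℝ, E) 𝓘(ℝ, ℝ) ∞ (g l) V) ∧
      (∀ ξ : Fin n × Fin 2 → ℝ, ∃ v : TangentSpace 𝓘(ℝ, E) x, ∀ l, differential (g l) x v = ξ l) ∧
      ∀ y ∈ V, ∀ i, f i y = g (i, 0) y ^ 2 + g (i, 1) y ^ 2 := by
  obtain ⟨V, g, hV, hxV, hVU, hg, hs, hz⟩ := h.exists_equations hU hx h0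
  obtain ⟨d, w, W, O, ψ, hwg, hW, hxW, hWV, hO, hw, hψ, hwO, hOw⟩ := exists_coordinates hV hxV hg hs
  let y₀ : (Fin n × Fin 2) ⊕ Fin d → ℝ := fun l => w l x
  obtain ⟨η, hηs, hη1⟩ := exists_cutoff (E := (Fin n × Fin 2) ⊕ Fin d → ℝ) hO (hwO x hxW).1
  have hfψ : ∀ i, ContMDiffOn 𝓘(ℝ, (Fin n × Fin 2) ⊕ Fin d → ℝ) 𝓘(ℝ, ℝ) ∞ (fun o => f i (ψ o)) O :=
    fun i => (h.elliptic i).smooth.comp hψ fun o ho => hVU (hWV (hOw o ho).1)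
  -- The cutoff extends f_i, in coordinates, to the whole coordinate space, where the quadratic
  -- division lemma applies.
  have hF : ∀ i, ContDiff ℝ ∞ fun o => η o * f i (ψ o) := fun i =>
    contMDiff_iff_contDiff.1 (contMDiff_cutoff_mul hO η.contMDiff hηs (hfψ i))
  have hfz : ∀ i, ∀ o ∈ O, o (Sum.inl (i, 0)) = 0 → o (Sum.inl (i, 1)) = 0 → f i (ψ o) = 0 := by
    intro i o ho ho0 ho1
    refine (hz (ψ o) (hWV (hOw o ho).1) i).2 fun a => ?_
    rw [← hwg, (hOw o ho).2]
    fin_cases a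
    · exact ho0
    · exact ho1
  have hF0 : ∀ i (o : (Fin n × Fin 2) ⊕ Fin d → ℝ), o (Sum.inl (i, 0)) = 0 →
      o (Sum.inl (i, 1)) = 0 → η o * f i (ψ o) = 0 := by
    intro i o ho0 ho1
    by_cases ho : o ∈ O
    · rw [hfz i o ho ho0 ho1, mul_zero]
    · rw [image_eq_zero_of_notMem_tsupport fun h => ho (hηs h), zero_mul]
  have hF1 : ∀ i (o : (Fin n × Fin 2) ⊕ Fin d → ℝ), o (Sum.inl (i, 0)) = 0 →
      o (Sum.inl (i, 1)) = 0 → fderiv ℝ (fun o => η o * f i (ψ o)) o = 0 := by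
    intro i o ho0 ho1
    by_cases ho : o ∈ O
    · have h1 : DifferentiableAt ℝ (fun o => f i (ψ o)) o :=
        ((hfψ i o ho).contMDiffAt (hO.mem_nhds ho)).contDiffAt.differentiableAt (by simp)
      have h2 : DifferentiableAt ℝ η o :=
        (contMDiff_iff_contDiff.1 η.contMDiff).differentiable (by simp) o
      have h3 : fderiv ℝ (fun o => f i (ψ o)) o = 0 := by
        have hUo : ψ o ∈ U := hVU (hWV (hOw o ho).1)
        have h4 := (mdifferentiableAt_of_contMDiffOn hU hUo (h.elliptic i).smooth).hasMFDerivAt.comp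
          o (((hψ o ho).contMDiffAt (hO.mem_nhds ho)).mdifferentiableAt (by simp)).hasMFDerivAt
        rw [(h.elliptic i).critical (ψ o) ⟨hUo, hfz i o ho ho0 ho1⟩] at h4
        have h5 := h4.mfderiv
        rw [mfderiv_eq_fderiv] at h5
        ext z
        exact DFunLike.congr_fun h5 z
      rw [fderiv_fun_mul h2 h1, h3, hfz i o ho ho0 ho1]
      simp
    · have h1 : (fun o => η o * f i (ψ o)) =ᶠ[𝓝 o] fun _ => 0 := by
        filter_upwards [(isClosed_tsupport η).isOpen_compl.mem_nhds fun h => ho (hηs h)] with z hz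
        rw [image_eq_zero_of_notMem_tsupport hz, zero_mul]
      rw [h1.fderiv_eq]
      simp
  choose a b c ha hb hc hFabc using fun i => exists_eq_quadratic
    (i := (Sum.inl (i, 0) : (Fin n × Fin 2) ⊕ Fin d)) (j := Sum.inl (i, 1)) (by simp) (hF i)
    (hF0 i) (hF1 i)
  have hwx : ContinuousAt (fun y l => w l y) x :=
    continuousAt_pi.2 fun l => (hw l).continuousOn.continuousAt (hW.mem_nhds hxW)
  have hfw : ∀ i, ∀ᶠ y in 𝓝 x, f i y = a i (fun l => w l y) * g (i, 0) y ^ 2 +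
      2 * b i (fun l => w l y) * (g (i, 0) y * g (i, 1) y) +
      c i (fun l => w l y) * g (i, 1) y ^ 2 := by
    intro i
    filter_upwards [hwx.eventually hη1, hW.mem_nhds hxW] with y hy hyW
    have h1 := hFabc i fun l => w l y
    rw [hy, one_mul, (hwO y hyW).2, hwg, hwg] at h1
    exact h1
  have hgx : ∀ l, g l x = 0 := fun l => (hz x hxV l.1).1 (h0 l.1) l.2
  -- At x the quadratic form with coefficients a, b, c is half the Hessian of f_i, evaluated on a
  -- vector v with normal components ξ; since ξ ≠ 0, v is not tangent to the branch.
  have hpos : ∀ i (ξ : Fin 2 → ℝ), ξ ≠ 0 →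
      0 < a i y₀ * ξ 0 ^ 2 + 2 * b i y₀ * (ξ 0 * ξ 1) + c i y₀ * ξ 1 ^ 2 := by
    intro i ξ hξ
    obtain ⟨v, hv⟩ := hs fun l => ξ l.2
    have hvt : v ∉ tangentTo (zerosIn U (f i)) x := by
      intro hvt
      refine hξ (funext fun k => ?_)
      rw [← hv (i, k)]
      exact differential_eq_zero_of_mem_tangentTo hvt hV hxV (hg (i, k))
        fun y hy => (hz y hy.1 i).1 hy.2.2 k
    have h1 := (h.elliptic i).definite x ⟨hx, h0 i⟩ v hvt
    have h2 := tendsto_chartLine_div_sq (((h.elliptic i).smooth x hx).contMDiffAt (hU.mem_nhds hx))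
      (h0 i) ((h.elliptic i).critical x ⟨hx, h0 i⟩) v
    have hl : Filter.Tendsto (chartLine v) (𝓝[≠] 0) (𝓝 x) :=
      (tendsto_chartLine v).mono_left nhdsWithin_le_nhds
    have h3 : ∀ k : (((Fin n × Fin 2) ⊕ Fin d → ℝ) → ℝ), ContDiff ℝ ∞ k →
        Filter.Tendsto (fun t => k fun l => w l (chartLine v t)) (𝓝[≠] 0) (𝓝 (k y₀)) :=
      fun k hk => (hk.continuous.tendsto y₀).comp (hwx.tendsto.comp hl)
    have h4 : ∀ k, Filter.Tendsto (fun t => g (i, k) (chartLine v t) / t) (𝓝[≠] 0) (𝓝 (ξ k)) := by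
      intro k
      have := tendsto_chartLine_div (mdifferentiableAt_of_contMDiffOn hV hxV (hg (i, k))) (hgx _) v
      rwa [hv] at this
    have h5 := (((h3 _ (ha i)).mul ((h4 0).pow 2)).add
      (((h3 _ (hb i)).const_mul 2).mul ((h4 0).mul (h4 1)))).add ((h3 _ (hc i)).mul ((h4 1).pow 2))
    have h6 := tendsto_nhds_unique (h2.congr' (by
      filter_upwards [hl.eventually (hfw i), self_mem_nhdsWithin] with t ht ht0
      have ht0' : t ≠ 0 := ht0
      rw [ht]
      field_simp)) h5
    rw [← h6]
    exact half_pos h1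
  have hapos : ∀ i, 0 < a i y₀ := fun i => by
    have := hpos i ![1, 0] (fun h => by simpa using congrFun h 0)
    simpa using this
  -- The value of the form at (-b/a, 1), which is what remains after completing the square.
  have hcpos : ∀ i, 0 < c i y₀ - b i y₀ ^ 2 / a i y₀ := fun i => by
    have h1 := hpos i ![-(b i y₀ / a i y₀), 1] (fun h => by simpa using congrFun h 1)
    have h2 := (hapos i).ne'
    simp only [Matrix.cons_val_zero, Matrix.cons_val_one] at h1
    convert h1 using 1
    field_simp
    ring
  let α : Fin n → M → ℝ := fun i y => a i fun l => w l y
  let β : Fin n → M → ℝ := fun i y => b i fun l => w l y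
  let γ : Fin n → M → ℝ := fun i y => c i fun l => w l y
  have hsm : ∀ {k : ((Fin n × Fin 2) ⊕ Fin d → ℝ) → ℝ}, ContDiff ℝ ∞ k →
      ContMDiffOn 𝓘(ℝ, E) 𝓘(ℝ, ℝ) ∞ (fun y => k fun l => w l y) W := fun hk =>
    hk.contMDiff.comp_contMDiffOn (contMDiffOn_pi_space.2 hw)
  obtain ⟨T, hT, hTo, hxT⟩ := mem_nhds_iff.1 (Filter.inter_mem (Filter.inter_mem
    (Filter.eventually_all.2 hfw) (hW.mem_nhds hxW)) (Filter.inter_mem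
      (Filter.eventually_all.2 fun i => (((ha i).continuous.tendsto y₀).comp hwx.tendsto).eventually
        (lt_mem_nhds (hapos i)))
      (Filter.eventually_all.2 fun i => ((((hc i).continuous.tendsto y₀).sub
        ((((hb i).continuous.tendsto y₀).pow 2).div ((ha i).continuous.tendsto y₀)
          (hapos i).ne')).comp hwx.tendsto).eventually (lt_mem_nhds (hcpos i)))))
  have hTW : T ⊆ W := fun y hy => (hT hy).1.2
  have hTα : ∀ y ∈ T, ∀ i, 0 < α i y := fun y hy => (hT hy).2.1
  have hTγ : ∀ y ∈ T, ∀ i, 0 < γ i y - β i y ^ 2 / α i y := fun y hy => (hT hy).2.2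
  have hα : ∀ i, ContMDiffOn 𝓘(ℝ, E) 𝓘(ℝ, ℝ) ∞ (α i) T := fun i => (hsm (ha i)).mono hTW
  have hβ : ∀ i, ContMDiffOn 𝓘(ℝ, E) 𝓘(ℝ, ℝ) ∞ (β i) T := fun i => (hsm (hb i)).mono hTW
  have hγ : ∀ i, ContMDiffOn 𝓘(ℝ, E) 𝓘(ℝ, ℝ) ∞ (γ i) T := fun i => (hsm (hc i)).mono hTW
  have hsqrt : ∀ {k : M → ℝ}, ContMDiffOn 𝓘(ℝ, E) 𝓘(ℝ, ℝ) ∞ k T → (∀ y ∈ T, 0 < k y) →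
      ContMDiffOn 𝓘(ℝ, E) 𝓘(ℝ, ℝ) ∞ (fun y => √(k y)) T := fun hk hpos y hy =>
    (Real.contDiffAt_sqrt (hpos y hy).ne').contMDiffAt.comp_contMDiffWithinAt y (hk y hy)
  have hsα : ∀ i, ContMDiffOn 𝓘(ℝ, E) 𝓘(ℝ, ℝ) ∞ (fun y => √(α i y)) T := fun i =>
    hsqrt (hα i) fun y hy => hTα y hy i
  have hs0 : ∀ i, ∀ y ∈ T, √(α i y) ≠ 0 := fun i y hy => (Real.sqrt_pos.2 (hTα y hy i)).ne'
  have hβα : ∀ i, ContMDiffOn 𝓘(ℝ, E) 𝓘(ℝ, ℝ) ∞ (fun y => β i y * (√(α i y))⁻¹) T := fun i =>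
    (hβ i).mul ((hsα i).inv₀ (hs0 i))
  have hsγ : ∀ i, ContMDiffOn 𝓘(ℝ, E) 𝓘(ℝ, ℝ) ∞ (fun y => √(γ i y - β i y ^ 2 / α i y)) T :=
    fun i => hsqrt ((hγ i).sub (((hβ i).pow 2).div₀ (hα i) fun y hy => (hTα y hy i).ne'))
      fun y hy => hTγ y hy i
  have hgT : ∀ l, ContMDiffOn 𝓘(ℝ, E) 𝓘(ℝ, ℝ) ∞ (g l) T := fun l => (hg l).mono fun y hy =>
    hWV (hTW hy)
  have hmd : ∀ {k : M → ℝ}, ContMDiffOn 𝓘(ℝ, E) 𝓘(ℝ, ℝ) ∞ k T →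
      MDifferentiableAt 𝓘(ℝ, E) 𝓘(ℝ, ℝ) k x := fun hk => mdifferentiableAt_of_contMDiffOn hTo hxT hk
  -- Completing the square: a g_0² + 2 b g_0 g_1 + c g_1² = (√a g_0 + (b/√a) g_1)² + (√(c - b²/a)
  -- g_1)².
  refine ⟨T, fun l => if l.2 = 0 then
    fun y => √(α l.1 y) * g (l.1, 0) y + β l.1 y * (√(α l.1 y))⁻¹ * g (l.1, 1) y else
    fun y => √(γ l.1 y - β l.1 y ^ 2 / α l.1 y) * g (l.1, 1) y, hTo, hxT,
    fun y hy => hVU (hWV (hTW hy)), ?_, fun ξ => ?_, fun y hy i => ?_⟩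
  · rintro ⟨i, k⟩
    by_cases hk : k = 0
    · simp only [hk, if_true]
      exact ((hsα i).mul (hgT _)).add ((hβα i).mul (hgT _))
    · simp only [hk, if_false]
      exact (hsγ i).mul (hgT _)
  · let δ : Fin n → ℝ := fun i => √(γ i x - β i x ^ 2 / α i x)
    have hδ : ∀ i, δ i ≠ 0 := fun i => (Real.sqrt_pos.2 (hTγ x hxT i)).ne'
    -- Solves the triangular system for the new differentials; derivatives of the coefficients do
    -- not contribute, because the old equations vanish at x.
    obtain ⟨v, hv⟩ := hs fun l => if l.2 = 0 then
      (ξ (l.1, 0) - β l.1 x * (√(α l.1 x))⁻¹ * (ξ (l.1, 1) / δ l.1)) / √(α l.1 x)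
      else ξ (l.1, 1) / δ l.1
    refine ⟨v, ?_⟩
    rintro ⟨i, k⟩
    have hv0 : differential (g (i, 0)) x v = _ := hv (i, 0)
    have hv1 : differential (g (i, 1)) x v = _ := hv (i, 1)
    simp only [if_true, one_ne_zero, if_false] at hv0 hv1
    have h1 := hs0 i x hxT
    have h2 := hδ i
    fin_cases k
    · simp only [Fin.zero_eta, if_true]
      rw [differential_add (f := fun y => √(α i y) * g (i, 0) y)
          (g := fun y => β i y * (√(α i y))⁻¹ * g (i, 1) y) ((hmd (hsα i)).mul (hmd (hgT _))) ((hmd (hβα i)).mul (hmd (hgT _))),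
        differential_mul (hmd (hsα i)) (hmd (hgT _)), differential_mul (hmd (hβα i)) (hmd (hgT _)),
        hgx, hgx, hv0, hv1]
      field_simp
      ring
    · simp only [Fin.mk_one, one_ne_zero, if_false]
      rw [differential_mul (hmd (hsγ i)) (hmd (hgT _)), hgx, hv1, mul_zero, zero_add]
      exact mul_div_cancel₀ _ h2
  · have h1 : f i y = α i y * g (i, 0) y ^ 2 + 2 * β i y * (g (i, 0) y * g (i, 1) y) +
      γ i y * g (i, 1) y ^ 2 := (hT hy).1.1 i
    have h2 := Real.sq_sqrt (hTα y hy i).le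
    have h3 := Real.sq_sqrt (hTγ y hy i).le
    have h4 := hs0 i y hy
    have h5 := (hTα y hy i).ne'
    simp only [if_true, one_ne_zero, if_false]
    rw [mul_pow, h3, h1]
    have h6 : (√(α i y))⁻¹ ^ 2 = (α i y)⁻¹ := by rw [inv_pow, h2]
    have h7 : √(α i y) * (√(α i y))⁻¹ = 1 := mul_inv_cancel₀ h4
    generalize √(α i y) = s at *
    rw [div_eq_mul_inv, ← h6, ← h2]
    generalize s⁻¹ = r at *
    linear_combination (-2 * β i y * g (i, 0) y * g (i, 1) y) * h7

end MorseBott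

/-! ### Adapted charts, and derivations in these coordinates. -/

section Adapted

variable (E : Type*) [NormedAddCommGroup E] [NormedSpace ℝ E]
  {M : Type*} [TopologicalSpace M] [ChartedSpace E M]
  {R : M → Type*} [TopologicalSpace (TotalSpace ℝ R)]
  [∀ x, AddCommGroup (R x)] [∀ x, Module ℝ (R x)] [∀ x, TopologicalSpace (R x)]
  [FiberBundle ℝ R]

/-- Local coordinates near a point of the stratum `D[n]` in which the branches of the divisor are
the squared radii of `n` pairs of coordinates.  The coordinates extend to global functions; the
first `2n` of these vanish on the whole stratum. -/
structure AdaptedChart (q : ∀ x, R x) (n : ℕ) where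
  /-- The number of the remaining coordinates. -/
  dim : ℕ
  /-- The coordinate neighbourhood. -/
  source : Set M
  isOpen_source : IsOpen source
  /-- The image of the coordinate neighbourhood. -/
  target : Set ((Fin n × Fin 2) ⊕ Fin dim → ℝ)
  isOpen_target : IsOpen target
  /-- The coordinate functions. -/
  coord : (Fin n × Fin 2) ⊕ Fin dim → C^∞⟮𝓘(ℝ, E), M; 𝓘(ℝ, ℝ), ℝ⟯
  /-- The inverse of the coordinates. -/
  inv : ((Fin n × Fin 2) ⊕ Fin dim → ℝ) → M
  contMDiffOn_inv : ContMDiffOn 𝓘(ℝ, (Fin n × Fin 2) ⊕ Fin dim → ℝ) 𝓘(ℝ, E) ∞ inv target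
  /-- The functions defining the branches of the divisor. -/
  branch : Fin n → M → ℝ
  crossing : IsLocalNormalCrossing E q source branch
  branch_eq : ∀ y ∈ source, ∀ i, branch i y = coord (Sum.inl (i, 0)) y ^ 2 +
    coord (Sum.inl (i, 1)) y ^ 2
  mem_target : ∀ y ∈ source, (fun l => coord l y) ∈ target
  left_inv : ∀ y ∈ source, inv (fun l => coord l y) = y
  mem_source : ∀ o ∈ target, inv o ∈ source
  right_inv : ∀ o ∈ target, ∀ l, coord l (inv o) = o l
  coord_eq_zero : ∀ y ∈ stratum E q n, ∀ l, coord (Sum.inl l) y = 0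

variable {E}
variable [FiniteDimensional ℝ E] [T2Space M] [IsManifold 𝓘(ℝ, E) ∞ M] {q : ∀ x, R x} {n : ℕ}

/-- Morse–Bott equations are completed to coordinates and multiplied by a cutoff, which makes them
global; the chart is shrunk to where the cutoff equals 1. -/
theorem exists_adaptedChart (hq : IsElliptic E q) {x : M} (hx : x ∈ stratum E q n) :
    ∃ C : AdaptedChart E q n, x ∈ C.source := by
  obtain ⟨U, hU, hxU, f, hf⟩ := exists_isLocalNormalCrossing hq hx
  have hf0 : ∀ y ∈ U, y ∈ stratum E q n → ∀ i, f i y = 0 := fun y hyU hy =>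
    hf.eq_zero_of_mem_stratum hq.1 hU hyU hy
  obtain ⟨V, g, hV, hxV, hVU, hg, hs, hfg⟩ := hf.exists_sum_sq hU hxU (hf0 x hxU hx)
  obtain ⟨d, w, W, O, ψ, hwg, hW, hxW, hWV, hO, hw, hψ, hwO, hOw⟩ := exists_coordinates hV hxV hg hs
  obtain ⟨χ, hχs, hχ1⟩ := exists_cutoff (E := E) hW hxW
  obtain ⟨T, hT, hTo, hxT⟩ := mem_nhds_iff.1 (Filter.inter_mem hχ1 (hW.mem_nhds hxW))
  have hTW : T ⊆ W := fun y hy => (hT hy).2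
  have hχT : ∀ y ∈ T, χ y = 1 := fun y hy => (hT hy).1
  let u : (Fin n × Fin 2) ⊕ Fin d → C^∞⟮𝓘(ℝ, E), M; 𝓘(ℝ, ℝ), ℝ⟯ := fun l =>
    ⟨fun y => χ y * w l y, contMDiff_cutoff_mul hW χ.contMDiff hχs (hw l)⟩
  have hu : ∀ l, ∀ y ∈ T, u l y = w l y := fun l y hy => by
    change χ y * w l y = w l y
    rw [hχT y hy, one_mul]
  have hu' : ∀ y ∈ T, (fun l => u l y) = fun l => w l y := fun y hy => funext fun l => hu l y hy
  refine ⟨⟨d, T, hTo, O ∩ ψ ⁻¹' T, hψ.continuousOn.isOpen_inter_preimage hO hTo, u, ψ,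
    hψ.mono Set.inter_subset_left, f, hf.restrict hq.1 hU hTo fun y hy => hVU (hWV (hTW hy)),
    fun y hy i => ?_, fun y hy => ?_, fun y hy => ?_, fun o ho => ho.2, fun o ho l => ?_,
    fun y hy l => ?_⟩, hxT⟩
  · rw [hu _ y hy, hu _ y hy, hwg, hwg, hfg y (hWV (hTW hy))]
  · rw [hu' y hy]
    exact ⟨(hwO y (hTW hy)).1, by rw [Set.mem_preimage, (hwO y (hTW hy)).2]; exact hy⟩
  · rw [hu' y hy]
    exact (hwO y (hTW hy)).2
  · rw [hu l _ ho.2, (hOw o ho.1).2]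
  -- Vanishing is required on the whole stratum, also where the cutoff is not 1. Inside W the sum of
  -- two squares f_i is zero, so both terms are; outside W the cutoff is zero.
  · change χ y * w (Sum.inl l) y = 0
    by_cases hyW : y ∈ W
    · have h1 := hfg y (hWV hyW) l.1
      rw [hf0 y (hVU (hWV hyW)) hy] at h1
      have h2 : g l y = 0 := by
        obtain ⟨i, k⟩ := l
        have h3 := sq_nonneg (g (i, 0) y)
        have h4 := sq_nonneg (g (i, 1) y)
        simp only at h1
        fin_cases k
        · exact pow_eq_zero_iff two_ne_zero |>.1 (by simp only [Fin.zero_eta]; linarith)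
        · exact pow_eq_zero_iff two_ne_zero |>.1 (by simp only [Fin.mk_one]; linarith)
      rw [hwg, h2, mul_zero]
    · rw [image_eq_zero_of_notMem_tsupport fun h => hyW (hχs h), zero_mul]

theorem derivation_congr (X : Derivation ℝ C^∞⟮𝓘(ℝ, E), M; 𝓘(ℝ, ℝ), ℝ⟯
    C^∞⟮𝓘(ℝ, E), M; 𝓘(ℝ, ℝ), ℝ⟯) {f g : C^∞⟮𝓘(ℝ, E), M; 𝓘(ℝ, ℝ), ℝ⟯} {x : M}
    (h : ∀ᶠ y in 𝓝 x, f y = g y) : X f x = X g x := by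
  obtain ⟨U, hU, hUo, hxU⟩ := mem_nhds_iff.1 h
  obtain ⟨χ, hs, h1⟩ := exists_cutoff (E := E) hUo hxU
  have h2 : χ * (f - g) = 0 := by
    ext y
    change χ y * (f y - g y) = 0
    by_cases hy : y ∈ U
    · have : f y = g y := hU hy
      rw [this, sub_self, mul_zero]
    · rw [image_eq_zero_of_notMem_tsupport fun h => hy (hs h), zero_mul]
  have h3 := congrArg (fun k : C^∞⟮𝓘(ℝ, E), M; 𝓘(ℝ, ℝ), ℝ⟯ => k x) (congrArg X h2)
  simp only [Derivation.leibniz, map_zero, map_sub] at h3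
  have h4 : χ x * (X f x - X g x) + (f x - g x) * X χ x = 0 := h3
  rw [h1.self_of_nhds, show f x = g x from h.self_of_nhds] at h4
  linarith

namespace AdaptedChart

variable (C : AdaptedChart E q n)

/-- The coordinates of a point. -/
def coords (y : M) : (Fin n × Fin 2) ⊕ Fin C.dim → ℝ := fun l => C.coord l y

theorem contMDiff_coords : ContMDiff 𝓘(ℝ, E) 𝓘(ℝ, (Fin n × Fin 2) ⊕ Fin C.dim → ℝ) ∞ C.coords :=
  contMDiff_pi_space.2 fun l => (C.coord l).contMDiff

/-- A smooth function of the coordinates. -/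
def ofCoords {F : ((Fin n × Fin 2) ⊕ Fin C.dim → ℝ) → ℝ} (hF : ContDiff ℝ ∞ F) :
    C^∞⟮𝓘(ℝ, E), M; 𝓘(ℝ, ℝ), ℝ⟯ := ⟨fun y => F (C.coords y), hF.contMDiff.comp C.contMDiff_coords⟩

theorem ofCoords_apply {F : ((Fin n × Fin 2) ⊕ Fin C.dim → ℝ) → ℝ} (hF : ContDiff ℝ ∞ F) (y : M) :
    C.ofCoords hF y = F (C.coords y) := rfl

theorem contDiffOn_comp_inv {f : M → ℝ} (hf : ContMDiffOn 𝓘(ℝ, E) 𝓘(ℝ, ℝ) ∞ f C.source) :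
    ContDiffOn ℝ ∞ (f ∘ C.inv) C.target :=
  contMDiffOn_iff_contDiffOn.1 (hf.comp C.contMDiffOn_inv C.mem_source)

theorem contDiffAt_comp_inv {f : M → ℝ} (hf : ContMDiffOn 𝓘(ℝ, E) 𝓘(ℝ, ℝ) ∞ f C.source) {x : M}
    (hx : x ∈ C.source) : ContDiffAt ℝ ∞ (f ∘ C.inv) (C.coords x) :=
  (C.contDiffOn_comp_inv hf).contDiffAt (C.isOpen_target.mem_nhds (C.mem_target x hx))

theorem eventually_inv_mem {x : M} (hx : x ∈ C.source) {p : M → Prop} (hp : ∀ᶠ y in 𝓝 x, p y) :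
    ∀ᶠ o in 𝓝 (C.coords x), p (C.inv o) := by
  have h1 : ContinuousAt C.inv (C.coords x) :=
    C.contMDiffOn_inv.continuousOn.continuousAt (C.isOpen_target.mem_nhds (C.mem_target x hx))
  have h2 : C.inv (C.coords x) = x := C.left_inv x hx
  rw [ContinuousAt, h2] at h1
  exact h1.eventually hp

/-- Transfers functions on V to smooth functions on the whole coordinate space without changing them
near x, so that the division lemmas can be used. -/
theorem exists_contDiff_eventuallyEq {V : Set M} (hV : IsOpen V) (hVs : V ⊆ C.source)
    {x : M} (hx : x ∈ V) :
    ∃ η : ((Fin n × Fin 2) ⊕ Fin C.dim → ℝ) → ℝ, ContDiff ℝ ∞ η ∧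
      (∀ o, η o ≠ 0 → o ∈ C.target ∧ C.inv o ∈ V) ∧ (∀ᶠ o in 𝓝 (C.coords x), η o = 1) ∧
      ∀ g : M → ℝ, ContMDiffOn 𝓘(ℝ, E) 𝓘(ℝ, ℝ) ∞ g V → ContDiff ℝ ∞ fun o => η o * g (C.inv o) := by
  have hO : IsOpen (C.target ∩ C.inv ⁻¹' V) :=
    C.contMDiffOn_inv.continuousOn.isOpen_inter_preimage C.isOpen_target hV
  have hxO : C.coords x ∈ C.target ∩ C.inv ⁻¹' V := by
    refine ⟨C.mem_target x (hVs hx), ?_⟩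
    have h2 : C.inv (C.coords x) = x := C.left_inv x (hVs hx)
    rw [Set.mem_preimage, h2]
    exact hx
  obtain ⟨η, hs, h1⟩ := exists_cutoff (E := (Fin n × Fin 2) ⊕ Fin C.dim → ℝ) hO hxO
  refine ⟨η, contMDiff_iff_contDiff.1 η.contMDiff, fun o ho => ?_, h1, fun g hg => ?_⟩
  · by_contra h
    exact ho (image_eq_zero_of_notMem_tsupport fun h' => h (hs h'))
  · refine contMDiff_iff_contDiff.1 (contMDiff_cutoff_mul hO η.contMDiff hs ?_)
    exact hg.comp (C.contMDiffOn_inv.mono Set.inter_subset_left) fun o ho => ho.2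

/-- A derivation is determined near a point by its values on coordinate functions. -/
theorem derivation_apply (X : Derivation ℝ C^∞⟮𝓘(ℝ, E), M; 𝓘(ℝ, ℝ), ℝ⟯
    C^∞⟮𝓘(ℝ, E), M; 𝓘(ℝ, ℝ), ℝ⟯) (f : C^∞⟮𝓘(ℝ, E), M; 𝓘(ℝ, ℝ), ℝ⟯) {x : M} (hx : x ∈ C.source) :
    X f x = fderiv ℝ (f ∘ C.inv) (C.coords x) (fun l => X (C.coord l) x) := by
  classical
  obtain ⟨η, hη, -, h1, hs⟩ := C.exists_contDiff_eventuallyEq C.isOpen_source subset_rfl hx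
  have hF := hs f f.contMDiff.contMDiffOn
  have h2 : X f x = X (C.ofCoords hF) x := by
    refine derivation_congr X ?_
    filter_upwards [C.contMDiff_coords.continuous.continuousAt.eventually h1,
      C.isOpen_source.mem_nhds hx] with y hy hys
    have h3 : C.inv (C.coords y) = y := C.left_inv y hys
    rw [C.ofCoords_apply, hy, one_mul, h3]
  have h3 : (fun o => η o * f (C.inv o)) =ᶠ[𝓝 (C.coords x)] f ∘ C.inv := by
    filter_upwards [h1] with o ho
    rw [ho, one_mul]
    rfl
  -- The derivation at x as a functional of functions of the coordinates, with default value 0 on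
  -- functions that are not smooth.
  let v : (((Fin n × Fin 2) ⊕ Fin C.dim → ℝ) → ℝ) → ℝ := fun F =>
    if hF : ContDiff ℝ ∞ F then X (C.ofCoords hF) x else 0
  have hv : ∀ {F} (hF : ContDiff ℝ ∞ F), v F = X (C.ofCoords hF) x := fun hF => dif_pos hF
  have h4 := derivation_at_eq_sum (C.coords x) v
    (fun F G hF hG => by
      rw [hv (hF.add hG), hv hF, hv hG]
      have : C.ofCoords (hF.add hG) = C.ofCoords hF + C.ofCoords hG := rfl
      exact (congrArg (fun k => X k x) this).trans (by rw [map_add]; rfl))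
    (fun c F hF => by
      rw [hv (contDiff_const.mul hF), hv hF]
      have : C.ofCoords (contDiff_const.mul hF) = c • C.ofCoords hF := rfl
      exact (congrArg (fun k => X k x) this).trans (by rw [Derivation.map_smul]; rfl))
    (fun F G hF hG => by
      rw [hv (hF.mul hG), hv hF, hv hG]
      have : C.ofCoords (hF.mul hG) = C.ofCoords hF * C.ofCoords hG := rfl
      exact (congrArg (fun k => X k x) this).trans (by rw [Derivation.leibniz]; rfl)) hF
  rw [hv hF, h3.fderiv_eq] at h4
  rw [h2, h4]
  have h5 : (fun l => X (C.coord l) x) = ∑ l, X (C.coord l) x • Pi.single l (1 : ℝ) := by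
    funext l
    simp [Finset.sum_apply, Pi.single_apply]
  rw [h5, map_sum]
  refine Finset.sum_congr rfl fun l _ => ?_
  rw [hv (contDiff_apply ℝ ℝ l), map_smul, smul_eq_mul, mul_comm]
  rfl

theorem contMDiffOn_fderiv_comp_inv {f : M → ℝ}
    (hf : ContMDiffOn 𝓘(ℝ, E) 𝓘(ℝ, ℝ) ∞ f C.source)
    (c : (Fin n × Fin 2) ⊕ Fin C.dim → C^∞⟮𝓘(ℝ, E), M; 𝓘(ℝ, ℝ), ℝ⟯) :
    ContMDiffOn 𝓘(ℝ, E) 𝓘(ℝ, ℝ) ∞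
      (fun y => fderiv ℝ (f ∘ C.inv) (C.coords y) (fun l => c l y)) C.source := by
  have h1 : ContDiffOn ℝ ∞ (fderiv ℝ (f ∘ C.inv)) C.target :=
    (C.contDiffOn_comp_inv hf).fderiv_of_isOpen C.isOpen_target (by simp)
  have h2 : ContMDiffOn 𝓘(ℝ, E) 𝓘(ℝ, ((Fin n × Fin 2) ⊕ Fin C.dim → ℝ) →L[ℝ] ℝ) ∞
      (fun y => fderiv ℝ (f ∘ C.inv) (C.coords y)) C.source :=
    h1.contMDiffOn.comp C.contMDiff_coords.contMDiffOn C.mem_target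
  exact h2.clm_apply (contMDiff_pi_space.2 fun l => (c l).contMDiff).contMDiffOn

/-- The vector field with given coefficients, multiplied by a cutoff function. -/
def field (χ : C^∞⟮𝓘(ℝ, E), M; 𝓘(ℝ, ℝ), ℝ⟯) (hχ : tsupport χ ⊆ C.source)
    (c : (Fin n × Fin 2) ⊕ Fin C.dim → C^∞⟮𝓘(ℝ, E), M; 𝓘(ℝ, ℝ), ℝ⟯) :
    Derivation ℝ C^∞⟮𝓘(ℝ, E), M; 𝓘(ℝ, ℝ), ℝ⟯ C^∞⟮𝓘(ℝ, E), M; 𝓘(ℝ, ℝ), ℝ⟯ :=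
  Derivation.mk'
    { toFun := fun f => ⟨fun y => χ y * fderiv ℝ (f ∘ C.inv) (C.coords y) (fun l => c l y),
        contMDiff_cutoff_mul C.isOpen_source χ.contMDiff hχ
          (C.contMDiffOn_fderiv_comp_inv f.contMDiff.contMDiffOn c)⟩
      map_add' := by
        intro f g
        ext y
        change χ y * _ = χ y * _ + χ y * _
        by_cases hy : y ∈ C.source
        · have hf := (C.contDiffAt_comp_inv f.contMDiff.contMDiffOn hy).differentiableAt (by simp)
          have hg := (C.contDiffAt_comp_inv g.contMDiff.contMDiffOn hy).differentiableAt (by simp)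
          have : ⇑(f + g) ∘ C.inv = f ∘ C.inv + g ∘ C.inv := rfl
          rw [this, fderiv_add hf hg, add_apply, mul_add]
        · rw [image_eq_zero_of_notMem_tsupport fun h => hy (hχ h)]
          ring
      map_smul' := by
        intro r f
        ext y
        change χ y * _ = r * (χ y * _)
        have : ⇑(r • f) ∘ C.inv = r • (f ∘ C.inv) := rfl
        rw [this, fderiv_const_smul_field]
        exact mul_left_comm _ _ _ }
    (by
      intro f g
      ext y
      change χ y * _ = f y * (χ y * _) + g y * (χ y * _)
      by_cases hy : y ∈ C.source
      · have hf := (C.contDiffAt_comp_inv f.contMDiff.contMDiffOn hy).differentiableAt (by simp)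
        have hg := (C.contDiffAt_comp_inv g.contMDiff.contMDiffOn hy).differentiableAt (by simp)
        have : ⇑(f * g) ∘ C.inv = (f ∘ C.inv) * (g ∘ C.inv) := rfl
        have h2 : C.inv (C.coords y) = y := C.left_inv y hy
        rw [this, fderiv_mul hf hg, add_apply, smul_apply, smul_apply, Function.comp_apply,
          Function.comp_apply, h2, smul_eq_mul, smul_eq_mul]
        ring
      · rw [image_eq_zero_of_notMem_tsupport fun h => hy (hχ h)]
        ring)

theorem field_apply (χ : C^∞⟮𝓘(ℝ, E), M; 𝓘(ℝ, ℝ), ℝ⟯) (hχ : tsupport χ ⊆ C.source)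
    (c : (Fin n × Fin 2) ⊕ Fin C.dim → C^∞⟮𝓘(ℝ, E), M; 𝓘(ℝ, ℝ), ℝ⟯)
    (f : C^∞⟮𝓘(ℝ, E), M; 𝓘(ℝ, ℝ), ℝ⟯) (y : M) :
    C.field χ hχ c f y = χ y * fderiv ℝ (f ∘ C.inv) (C.coords y) (fun l => c l y) := rfl

theorem fderiv_coord_comp_inv {y : M} (hy : y ∈ C.source) (l : (Fin n × Fin 2) ⊕ Fin C.dim)
    (c : (Fin n × Fin 2) ⊕ Fin C.dim → ℝ) :
    fderiv ℝ (C.coord l ∘ C.inv) (C.coords y) c = c l := by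
  have h1 : C.coord l ∘ C.inv =ᶠ[𝓝 (C.coords y)] fun o => o l := by
    filter_upwards [C.isOpen_target.mem_nhds (C.mem_target y hy)] with o ho
    exact C.right_inv o ho l
  rw [h1.fderiv_eq, (hasFDerivAt_coord l _).fderiv]
  rfl

theorem field_coord (χ : C^∞⟮𝓘(ℝ, E), M; 𝓘(ℝ, ℝ), ℝ⟯) (hχ : tsupport χ ⊆ C.source)
    (c : (Fin n × Fin 2) ⊕ Fin C.dim → C^∞⟮𝓘(ℝ, E), M; 𝓘(ℝ, ℝ), ℝ⟯)
    (l : (Fin n × Fin 2) ⊕ Fin C.dim) {y : M} (hy : y ∈ C.source) :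
    C.field χ hχ c (C.coord l) y = χ y * c l y := by
  rw [field_apply, C.fderiv_coord_comp_inv hy]

end AdaptedChart

end Adapted

/-! ### Local form of the sections of the elliptic tangent bundle. -/

section EllipticFields

theorem fderiv_prod_sq {n : ℕ} {ι : Type} [Fintype ι] [DecidableEq ι] (e : Fin n × Fin 2 → ι)
    (o c : ι → ℝ) :
    fderiv ℝ (fun y : ι → ℝ => ∏ j, (y (e (j, 0)) ^ 2 + y (e (j, 1)) ^ 2)) o c =
      2 * ∑ i, (o (e (i, 0)) * c (e (i, 0)) + o (e (i, 1)) * c (e (i, 1))) *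
        ∏ j ∈ Finset.univ.erase i, (o (e (j, 0)) ^ 2 + o (e (j, 1)) ^ 2) := by
  have h : ∀ i, HasFDerivAt (fun y : ι → ℝ => y (e (i, 0)) ^ 2 + y (e (i, 1)) ^ 2) _ o := fun i =>
    ((hasFDerivAt_coord (e (i, 0)) o).pow 2).add ((hasFDerivAt_coord (e (i, 1)) o).pow 2)
  rw [(HasFDerivAt.finsetProd fun i _ => h i).fderiv, sum_apply,
    Finset.mul_sum]
  refine Finset.sum_congr rfl fun i _ => ?_
  simp only [smul_apply, add_apply, ContinuousLinearMap.proj_apply, smul_eq_mul, nsmul_eq_mul]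
  ring

variable {E : Type*} [NormedAddCommGroup E] [NormedSpace ℝ E]
  {M : Type*} [TopologicalSpace M] [ChartedSpace E M]
  {R : M → Type*} [TopologicalSpace (TotalSpace ℝ R)]
  [∀ x, AddCommGroup (R x)] [∀ x, Module ℝ (R x)] [∀ x, TopologicalSpace (R x)]
  [FiberBundle ℝ R]
variable [FiniteDimensional ℝ E] [T2Space M] [IsManifold 𝓘(ℝ, E) ∞ M] {q : ∀ x, R x} {n : ℕ}

namespace AdaptedChart

variable (C : AdaptedChart E q n)

theorem prod_branch_comp_inv {o : (Fin n × Fin 2) ⊕ Fin C.dim → ℝ} (ho : o ∈ C.target) :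
    ∏ i, C.branch i (C.inv o) =
      ∏ i, (o (Sum.inl (i, 0)) ^ 2 + o (Sum.inl (i, 1)) ^ 2) := by
  refine Finset.prod_congr rfl fun i _ => ?_
  rw [C.branch_eq _ (C.mem_source o ho), C.right_inv o ho, C.right_inv o ho]

/-- The coefficients of the combination of the scalings and rotations of the normal coordinates and
of the remaining coordinate fields. -/
def coefficients (a b : Fin n → C^∞⟮𝓘(ℝ, E), M; 𝓘(ℝ, ℝ), ℝ⟯)
    (t : Fin C.dim → C^∞⟮𝓘(ℝ, E), M; 𝓘(ℝ, ℝ), ℝ⟯) :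
    (Fin n × Fin 2) ⊕ Fin C.dim → C^∞⟮𝓘(ℝ, E), M; 𝓘(ℝ, ℝ), ℝ⟯ :=
  Sum.elim (fun l => if l.2 = 0
    then a l.1 * C.coord (Sum.inl (l.1, 0)) - b l.1 * C.coord (Sum.inl (l.1, 1))
    else b l.1 * C.coord (Sum.inl (l.1, 0)) + a l.1 * C.coord (Sum.inl (l.1, 1))) t

/-- Rotations annihilate |z_i|² and the scaling part multiplies it by 2 a_i. The product of squared
radii is therefore an eigenfunction with factor 2 Σ a_i, and its multiples are mapped to multiples.
-/
theorem field_coefficients_mem {χ : C^∞⟮𝓘(ℝ, E), M; 𝓘(ℝ, ℝ), ℝ⟯} (hχ : tsupport χ ⊆ C.source)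
    (a b : Fin n → C^∞⟮𝓘(ℝ, E), M; 𝓘(ℝ, ℝ), ℝ⟯)
    (t : Fin C.dim → C^∞⟮𝓘(ℝ, E), M; 𝓘(ℝ, ℝ), ℝ⟯) :
    C.field χ hχ (C.coefficients a b t) ∈ ellipticFields E q := by
  intro g hg
  obtain ⟨k, hk, hgk⟩ := C.crossing.exists_eq_mul_of_mem_ideal hg
  refine C.crossing.mul_mem_ideal C.isOpen_source χ.contMDiff hχ
    (c := fun y => fderiv ℝ (k ∘ C.inv) (C.coords y) (fun l => C.coefficients a b t l y) +
      k y * (2 * ∑ i, a i y)) ?_ fun y => ?_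
  · refine (C.contMDiffOn_fderiv_comp_inv hk _).add (hk.mul (contMDiffOn_const.mul ?_))
    exact contMDiffOn_finsetSum fun i _ => (a i).contMDiff.contMDiffOn
  · rw [field_apply]
    by_cases hy : y ∈ C.source
    swap
    · rw [image_eq_zero_of_notMem_tsupport fun h => hy (hχ h), zero_mul, zero_mul]
    congr 1
    have h1 : g ∘ C.inv =ᶠ[𝓝 (C.coords y)] (k ∘ C.inv) * fun o =>
        ∏ i, (o (Sum.inl (i, 0)) ^ 2 + o (Sum.inl (i, 1)) ^ 2) := by
      filter_upwards [C.isOpen_target.mem_nhds (C.mem_target y hy)] with o ho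
      rw [Pi.mul_apply, Function.comp_apply, hgk _ (C.mem_source o ho), C.prod_branch_comp_inv ho]
      rfl
    have hd : DifferentiableAt ℝ (fun o : (Fin n × Fin 2) ⊕ Fin C.dim → ℝ =>
        ∏ i, (o (Sum.inl (i, 0)) ^ 2 + o (Sum.inl (i, 1)) ^ 2)) (C.coords y) := by fun_prop
    have h2 : C.inv (C.coords y) = y := C.left_inv y hy
    have h3 := C.prod_branch_comp_inv (C.mem_target y hy)
    have h4 : ∀ i, C.coords y (Sum.inl (i, 0)) * C.coefficients a b t (Sum.inl (i, 0)) y +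
        C.coords y (Sum.inl (i, 1)) * C.coefficients a b t (Sum.inl (i, 1)) y =
        a i y * (C.coords y (Sum.inl (i, 0)) ^ 2 + C.coords y (Sum.inl (i, 1)) ^ 2) := by
      intro i
      change C.coord _ y * (a i y * C.coord (Sum.inl (i, 0)) y - b i y * C.coord (Sum.inl (i, 1)) y)
        + C.coord _ y * (b i y * C.coord (Sum.inl (i, 0)) y + a i y * C.coord (Sum.inl (i, 1)) y) =
        a i y * (C.coord _ y ^ 2 + C.coord _ y ^ 2)
      ring
    have h5 : ∏ i, (C.coords y (Sum.inl (i, 0)) ^ 2 + C.coords y (Sum.inl (i, 1)) ^ 2) =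
        ∏ i, C.branch i y := by
      have h3' : ∏ i, C.branch i (C.inv (C.coords y)) = _ := h3
      rw [h2] at h3'
      exact h3'.symm
    rw [h1.fderiv_eq, fderiv_mul ((C.contDiffAt_comp_inv hk hy).differentiableAt (by simp)) hd,
      add_apply, smul_apply, smul_apply, fderiv_prod_sq Sum.inl, Function.comp_apply, h2, h5,
      smul_eq_mul, smul_eq_mul]
    simp only [h4]
    have h6 : ∀ i, a i y * (C.coords y (Sum.inl (i, 0)) ^ 2 + C.coords y (Sum.inl (i, 1)) ^ 2) *
        ∏ j ∈ Finset.univ.erase i, (C.coords y (Sum.inl (j, 0)) ^ 2 +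
          C.coords y (Sum.inl (j, 1)) ^ 2) = a i y * ∏ i, C.branch i y := by
      intro i
      rw [mul_assoc, Finset.mul_prod_erase Finset.univ (fun j => C.coords y (Sum.inl (j, 0)) ^ 2 +
          C.coords y (Sum.inl (j, 1)) ^ 2) (Finset.mem_univ i), h5]
    simp only [h6, ← Finset.sum_mul]
    ring

/-- The section of the elliptic tangent bundle with given coefficients in an adapted chart. -/
def ellipticField {χ : C^∞⟮𝓘(ℝ, E), M; 𝓘(ℝ, ℝ), ℝ⟯} (hχ : tsupport χ ⊆ C.source)
    (a b : Fin n → C^∞⟮𝓘(ℝ, E), M; 𝓘(ℝ, ℝ), ℝ⟯)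
    (t : Fin C.dim → C^∞⟮𝓘(ℝ, E), M; 𝓘(ℝ, ℝ), ℝ⟯) : ellipticFields E q :=
  ⟨C.field χ hχ (C.coefficients a b t), C.field_coefficients_mem hχ a b t⟩

/-- Apply X to the generator ∏ |z_i|², cut off near the boundary of the chart. That the result is
again a multiple of the generator is the hypothesis of `exists_conformal_division`. -/
theorem exists_conformal (X : ellipticFields E q) {x : M} (hx : x ∈ C.source) :
    ∃ a b : Fin n → C^∞⟮𝓘(ℝ, E), M; 𝓘(ℝ, ℝ), ℝ⟯, ∀ᶠ y in 𝓝 x, ∀ i,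
      X.1 (C.coord (Sum.inl (i, 0))) y =
        a i y * C.coord (Sum.inl (i, 0)) y - b i y * C.coord (Sum.inl (i, 1)) y ∧
      X.1 (C.coord (Sum.inl (i, 1))) y =
        b i y * C.coord (Sum.inl (i, 0)) y + a i y * C.coord (Sum.inl (i, 1)) y := by
  obtain ⟨χ, hs, h1⟩ := exists_cutoff (E := E) C.isOpen_source hx
  let G : C^∞⟮𝓘(ℝ, E), M; 𝓘(ℝ, ℝ), ℝ⟯ := ⟨fun y => χ y * ∏ i, C.branch i y,
    contMDiff_cutoff_mul C.isOpen_source χ.contMDiff hs C.crossing.contMDiffOn_prod⟩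
  have hG : G ∈ ideal E q := C.crossing.mul_mem_ideal C.isOpen_source χ.contMDiff hs
    (c := fun _ => 1) contMDiffOn_const fun y => by rw [one_mul]; rfl
  obtain ⟨k, hk, hGk⟩ := C.crossing.exists_eq_mul_of_mem_ideal (X.2 G hG)
  obtain ⟨V, hV, hVo, hxV⟩ := mem_nhds_iff.1 (Filter.inter_mem h1 (C.isOpen_source.mem_nhds hx))
  have hVs : V ⊆ C.source := fun y hy => (hV hy).2
  obtain ⟨η, hη, hη0, hη1, hηs⟩ := C.exists_contDiff_eventuallyEq hVo hVs hxV
  have hkey : ∀ y ∈ V, 2 * ∑ i, (C.coords y (Sum.inl (i, 0)) * X.1 (C.coord (Sum.inl (i, 0))) y +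
      C.coords y (Sum.inl (i, 1)) * X.1 (C.coord (Sum.inl (i, 1))) y) *
      ∏ j ∈ Finset.univ.erase i,
        (C.coords y (Sum.inl (j, 0)) ^ 2 + C.coords y (Sum.inl (j, 1)) ^ 2) =
      k y * ∏ j, (C.coords y (Sum.inl (j, 0)) ^ 2 + C.coords y (Sum.inl (j, 1)) ^ 2) := by
    intro y hy
    have h2 := hGk y (hVs hy)
    have h3 : G ∘ C.inv =ᶠ[𝓝 (C.coords y)] fun o =>
        ∏ i, (o (Sum.inl (i, 0)) ^ 2 + o (Sum.inl (i, 1)) ^ 2) := by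
      filter_upwards [C.isOpen_target.mem_nhds (C.mem_target y (hVs hy)),
        C.eventually_inv_mem (hVs hy) (hVo.mem_nhds hy)] with o ho hoV
      change χ (C.inv o) * _ = _
      rw [show χ (C.inv o) = 1 from (hV hoV).1, one_mul, C.prod_branch_comp_inv ho]
    rw [C.derivation_apply X.1 G (hVs hy), h3.fderiv_eq, fderiv_prod_sq Sum.inl] at h2
    rw [h2]
    congr 1
    refine Finset.prod_congr rfl fun i _ => ?_
    exact C.branch_eq y (hVs hy) i
  have h5 := exists_conformal_division (n := n) (ι := (Fin n × Fin 2) ⊕ Fin C.dim) Sum.inl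
    Sum.inl_injective
    (g := fun i m o => η o * X.1 (C.coord (Sum.inl (i, m))) (C.inv o))
    (fun i m => hηs _ (X.1 (C.coord (Sum.inl (i, m)))).contMDiff.contMDiffOn)
    -- The derivative of the squared radii brings a factor 2. Both sides of the equation are
    -- multiplied by η to make it hold on the whole coordinate space.
    (c := fun o => η o * (k (C.inv o) / 2))
    (hηs (fun y => k y / 2) ((hk.mono hVs).div_const 2)) (by
      intro o
      by_cases ho : η o = 0
      · simp [ho]
      obtain ⟨hoT, hoV⟩ := hη0 o ho
      have h6 := hkey _ hoV
      have h7 : C.coords (C.inv o) = o := funext fun l => C.right_inv o hoT l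
      rw [h7] at h6
      have h8 : ∀ s P : ℝ, 2 * s = k (C.inv o) * P → η o * s = η o * (k (C.inv o) / 2) * P := by
        intro s P h; linear_combination (η o / 2) * h
      rw [← h8 _ _ h6, Finset.mul_sum]
      refine Finset.sum_congr rfl fun i _ => ?_
      ring)
  choose a b ha hb hab using h5
  refine ⟨fun i => C.ofCoords (ha i), fun i => C.ofCoords (hb i), ?_⟩
  filter_upwards [C.contMDiff_coords.continuous.continuousAt.eventually hη1,
    C.isOpen_source.mem_nhds hx] with y hy hys i
  have h6 := hab i (C.coords y)
  have h2 : C.inv (C.coords y) = y := C.left_inv y hys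
  rw [hy, one_mul, one_mul, h2] at h6
  exact h6

end AdaptedChart

/-- In Γ(𝒜) / 𝔪_x Γ(𝒜), multiplication by a cutoff with value 1 at x has no effect, so the value at
x is local. -/
theorem valueAt_congr {X Y : ellipticFields E q} {x : M}
    (h : ∀ᶠ y in 𝓝 x, ∀ f, X.1 f y = Y.1 f y) : valueAt E q x X = valueAt E q x Y := by
  obtain ⟨U, hU, hUo, hxU⟩ := mem_nhds_iff.1 h
  obtain ⟨χ, hs, h1⟩ := exists_cutoff (E := E) hUo hxU
  have h2 : χ • X = χ • Y := by
    refine Subtype.ext (Derivation.ext fun f => ?_)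
    ext y
    change χ y * X.1 f y = χ y * Y.1 f y
    by_cases hy : y ∈ U
    · rw [hU hy f]
    · rw [image_eq_zero_of_notMem_tsupport fun h => hy (hs h), zero_mul, zero_mul]
  have h3 := congrArg (valueAt E q x) h2
  rwa [valueAt_smul, valueAt_smul, h1.self_of_nhds, one_smul, one_smul] at h3

namespace AdaptedChart

variable (C : AdaptedChart E q n)

/-- Coefficients enter linearly over the smooth functions. When they vanish at x, the decomposition
places the field in 𝔪_x Γ(𝒜). -/
theorem ellipticField_eq_sum {χ : C^∞⟮𝓘(ℝ, E), M; 𝓘(ℝ, ℝ), ℝ⟯} (hχ : tsupport χ ⊆ C.source)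
    (a b : Fin n → C^∞⟮𝓘(ℝ, E), M; 𝓘(ℝ, ℝ), ℝ⟯)
    (t : Fin C.dim → C^∞⟮𝓘(ℝ, E), M; 𝓘(ℝ, ℝ), ℝ⟯) :
    C.ellipticField hχ a b t = ∑ i, a i • C.ellipticField hχ (Pi.single i 1) 0 0 +
      ∑ i, b i • C.ellipticField hχ 0 (Pi.single i 1) 0 +
      ∑ l, t l • C.ellipticField hχ 0 0 (Pi.single l 1) := by
  have hvec : ∀ y, (fun l => C.coefficients a b t l y) =
      ∑ i, a i y • (fun l => C.coefficients (Pi.single i 1) 0 0 l y) +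
      ∑ i, b i y • (fun l => C.coefficients 0 (Pi.single i 1) 0 l y) +
      ∑ k, t k y • (fun l => C.coefficients 0 0 (Pi.single k 1) l y) := by
    intro y
    have h1 : ∀ {m : ℕ} (k l : Fin m),
        (Pi.single k 1 : Fin m → C^∞⟮𝓘(ℝ, E), M; 𝓘(ℝ, ℝ), ℝ⟯) l y = if l = k then 1 else 0 := by
      intro m k l
      by_cases h : l = k
      · subst h; simp
      · simp [h]
    funext l
    obtain ⟨i, m⟩ | l := l
    · fin_cases m
      · simp [coefficients, h1, Finset.sum_apply, sub_eq_add_neg]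
      · simp [coefficients, h1, Finset.sum_apply, add_comm]
    · simp [coefficients, h1, Finset.sum_apply]
  refine Subtype.ext (Derivation.ext fun f => ?_)
  ext y
  let φ : ↥(ellipticFields E q) →+ ℝ :=
    { toFun := fun X => X.1 f y, map_zero' := rfl, map_add' := fun _ _ => rfl }
  change χ y * fderiv ℝ (f ∘ C.inv) (C.coords y) (fun l => C.coefficients a b t l y) =
    φ (∑ i, a i • C.ellipticField hχ (Pi.single i 1) 0 0 +
      ∑ i, b i • C.ellipticField hχ 0 (Pi.single i 1) 0 +
      ∑ l, t l • C.ellipticField hχ 0 0 (Pi.single l 1))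
  rw [hvec]
  have e1 : ∀ (m : ℕ) (g : Fin m → C^∞⟮𝓘(ℝ, E), M; 𝓘(ℝ, ℝ), ℝ⟯) (Y : Fin m → ↥(ellipticFields E q)),
      φ (∑ i, g i • Y i) = ∑ i, g i y * (Y i).1 f y := fun m g Y => map_sum φ _ _
  have e2 : ∀ (m : ℕ) (g : Fin m → ℝ) (w : Fin m → (Fin n × Fin 2) ⊕ Fin C.dim → ℝ),
      χ y * fderiv ℝ (f ∘ C.inv) (C.coords y) (∑ i, g i • w i) =
      ∑ i, g i * (χ y * fderiv ℝ (f ∘ C.inv) (C.coords y) (w i)) := fun m g w => by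
    rw [map_sum, Finset.mul_sum]
    refine Finset.sum_congr rfl fun _ _ => ?_
    rw [map_smul, smul_eq_mul, mul_left_comm]
  rw [φ.map_add, φ.map_add, e1, e1, e1, map_add, map_add, mul_add, mul_add, e2, e2, e2]
  rfl

/-- A section of the elliptic tangent bundle is zero at a point if its coefficients are. -/
theorem valueAt_eq_zero (X : ellipticFields E q) {x : M} (hx : x ∈ C.source)
    {a b : Fin n → C^∞⟮𝓘(ℝ, E), M; 𝓘(ℝ, ℝ), ℝ⟯} (hab : ∀ᶠ y in 𝓝 x, ∀ i,
      X.1 (C.coord (Sum.inl (i, 0))) y =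
        a i y * C.coord (Sum.inl (i, 0)) y - b i y * C.coord (Sum.inl (i, 1)) y ∧
      X.1 (C.coord (Sum.inl (i, 1))) y =
        b i y * C.coord (Sum.inl (i, 0)) y + a i y * C.coord (Sum.inl (i, 1)) y)
    (ha : ∀ i, a i x = 0) (hb : ∀ i, b i x = 0) (ht : ∀ l, X.1 (C.coord (Sum.inr l)) x = 0) :
    valueAt E q x X = 0 := by
  obtain ⟨χ, hs, h1⟩ := exists_cutoff (E := E) C.isOpen_source hx
  have h2 : valueAt E q x X =
      valueAt E q x (C.ellipticField hs a b fun l => X.1 (C.coord (Sum.inr l))) := by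
    refine valueAt_congr ?_
    filter_upwards [hab, h1, C.isOpen_source.mem_nhds hx] with y hy hy1 hys f
    have h3 : (C.ellipticField hs a b fun l => X.1 (C.coord (Sum.inr l))).1 f y =
      χ y * fderiv ℝ (f ∘ C.inv) (C.coords y) fun l => C.coefficients a b _ l y := rfl
    rw [h3, hy1, one_mul, C.derivation_apply X.1 f hys]
    congr 1
    funext l
    obtain ⟨i, m⟩ | l := l
    · fin_cases m
      · exact (hy i).1
      · exact (hy i).2
    · rfl
  rw [h2, ellipticField_eq_sum, map_add, map_add, map_sum, map_sum, map_sum]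
  have h3 : ∀ (g : C^∞⟮𝓘(ℝ, E), M; 𝓘(ℝ, ℝ), ℝ⟯) (Y : ellipticFields E q), g x = 0 →
      valueAt E q x (g • Y) = 0 := fun g Y hg => by rw [valueAt_smul, hg, zero_smul]
  rw [Finset.sum_eq_zero fun i _ => h3 _ _ (ha i), Finset.sum_eq_zero fun i _ => h3 _ _ (hb i),
    Finset.sum_eq_zero fun l _ => h3 _ _ (ht l), add_zero, add_zero]

end AdaptedChart

end EllipticFields

/-! ### The stratum in adapted coordinates: vanishing orders, tangent spaces and Hessians. -/

section Strata

variable {E : Type*} [NormedAddCommGroup E] [NormedSpace ℝ E]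
  {M : Type*} [TopologicalSpace M] [ChartedSpace E M]
  {R : M → Type*} [TopologicalSpace (TotalSpace ℝ R)]
  [∀ x, AddCommGroup (R x)] [∀ x, Module ℝ (R x)] [∀ x, TopologicalSpace (R x)]
  [FiberBundle ℝ R]
variable [FiniteDimensional ℝ E] [T2Space M] [IsManifold 𝓘(ℝ, E) ∞ M] {q : ∀ x, R x} {n : ℕ}

theorem IsSmoothElliptic.exists_notMem_tangentTo {U : Set M} (hU : IsOpen U) {f : M → ℝ}
    (h : IsSmoothElliptic E U f) {x : M} (hx : x ∈ U) (h0 : f x = 0) :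
    ∃ v : TangentSpace 𝓘(ℝ, E) x, v ∉ tangentTo (zerosIn U f) x := by
  obtain ⟨V, g, hV, hxV, -, hg, hs, hz⟩ := h.exists_equations hU hx h0
  obtain ⟨v, hv⟩ := hs fun _ => 1
  refine ⟨v, fun hv' => ?_⟩
  have h1 := differential_eq_zero_of_mem_tangentTo hv' hV hxV (hg 0)
    fun y hy => (hz y hy.1).1 hy.2.2 0
  rw [hv] at h1
  exact one_ne_zero h1

/-- Transversality combines nontangent vectors for the single branches into one vector, along which
every branch vanishes to order exactly two. -/
theorem IsLocalNormalCrossing.exists_notMem_tangentTo {U : Set M} (hU : IsOpen U) {j : ℕ}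
    {f : Fin j → M → ℝ} (h : IsLocalNormalCrossing E q U f) {x : M} (hx : x ∈ U) :
    ∃ v : TangentSpace 𝓘(ℝ, E) x, ∀ i, f i x = 0 → v ∉ tangentTo (zerosIn U (f i)) x := by
  have h1 : ∀ i, ∃ v : TangentSpace 𝓘(ℝ, E) x, f i x = 0 → v ∉ tangentTo (zerosIn U (f i)) x := by
    intro i
    by_cases h0 : f i x = 0
    · obtain ⟨v, hv⟩ := (h.elliptic i).exists_notMem_tangentTo hU hx h0
      exact ⟨v, fun _ => hv⟩
    · exact ⟨0, fun h => absurd h h0⟩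
  choose v hv using h1
  obtain ⟨w, hw⟩ := h.transverse x hx v
  refine ⟨w, fun i hi hw' => hv i hi ?_⟩
  have := Submodule.sub_mem _ hw' (hw i hi)
  rwa [sub_sub_cancel] at this

theorem IsSmoothElliptic.tendsto_chartLine {U : Set M} (hU : IsOpen U) {f : M → ℝ}
    (h : IsSmoothElliptic E U f) {x : M} (hx : x ∈ U) (h0 : f x = 0)
    (v : TangentSpace 𝓘(ℝ, E) x) :
    Filter.Tendsto (fun t : ℝ => f (chartLine v t) / t ^ 2) (𝓝[≠] 0)
      (𝓝 (hessian f x v v / 2)) :=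
  tendsto_chartLine_div_sq ((h.smooth x hx).contMDiffAt (hU.mem_nhds hx)) h0
    (h.critical x ⟨hx, h0⟩) v

theorem IsLocalNormalCrossing.tendsto_prod {U : Set M} (hU : IsOpen U) {j : ℕ}
    {f : Fin j → M → ℝ} (h : IsLocalNormalCrossing E q U f) {x : M} (hx : x ∈ U)
    (h0 : ∀ i, f i x = 0) (v : TangentSpace 𝓘(ℝ, E) x) :
    Filter.Tendsto (fun t : ℝ => (∏ i, f i (chartLine v t)) / (t ^ 2) ^ j) (𝓝[≠] 0)
      (𝓝 (∏ i, hessian (f i) x v v / 2)) := by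
  refine (tendsto_finsetProd Finset.univ fun i _ =>
    (h.elliptic i).tendsto_chartLine hU hx (h0 i) v).congr fun t => ?_
  rw [Finset.prod_div_distrib, Finset.prod_const, Finset.card_univ, Fintype.card_fin]

/-- Compare vanishing orders along a line that is nontangent to all branches of g through x. There ∏
g_i has order exactly 2 · #{i | g_i x = 0} ≤ 2k, while ∏ f_i has order at least 2j, and the former
is a continuous multiple of the latter. -/
theorem IsLocalNormalCrossing.le_of_forall_eq_zero (hq : IsRealDivisor E q) {U V : Set M}
    (hU : IsOpen U) (hV : IsOpen V) {j k : ℕ} {f : Fin j → M → ℝ} {g : Fin k → M → ℝ}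
    (h : IsLocalNormalCrossing E q U f) (h' : IsLocalNormalCrossing E q V g) {x : M} (hxU : x ∈ U)
    (hxV : x ∈ V) (h0 : ∀ i, f i x = 0) : j ≤ k := by
  by_contra! hlt
  obtain ⟨a, ha, -, hag⟩ := h.exists_unit hq hU hV h' hxU hxV
  obtain ⟨v, hv⟩ := h'.exists_notMem_tangentTo hV hxV
  have hl : Filter.Tendsto (chartLine v) (𝓝[≠] 0) (𝓝 x) :=
    (tendsto_chartLine v).mono_left nhdsWithin_le_nhds
  -- Half the vanishing order of `g i` along the line.
  let e : Fin k → ℕ := fun i => if g i x = 0 then 1 else 0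
  have h1 : ∀ i, ∃ L : ℝ, L ≠ 0 ∧
      Filter.Tendsto (fun t : ℝ => g i (chartLine v t) / (t ^ 2) ^ e i) (𝓝[≠] 0) (𝓝 L) := by
    intro i
    by_cases hi : g i x = 0
    · refine ⟨hessian (g i) x v v / 2,
        (half_pos ((h'.elliptic i).definite x ⟨hxV, hi⟩ v (hv i hi))).ne', ?_⟩
      simpa [e, hi] using (h'.elliptic i).tendsto_chartLine hV hxV hi v
    · refine ⟨g i x, hi, ?_⟩
      simpa [e, hi, Function.comp_def] using (((h'.elliptic i).smooth.continuousOn.continuousAt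
        (hV.mem_nhds hxV)).tendsto.comp hl)
  choose L hL hLt using h1
  have h2 : Filter.Tendsto (fun t : ℝ => (∏ i, g i (chartLine v t)) / (t ^ 2) ^ ∑ i, e i) (𝓝[≠] 0)
      (𝓝 (∏ i, L i)) := by
    refine (tendsto_finsetProd Finset.univ fun i _ => hLt i).congr fun t => ?_
    rw [Finset.prod_div_distrib, Finset.prod_pow_eq_pow_sum]
  have hsum : ∑ i, e i < j := by
    refine lt_of_le_of_lt ?_ hlt
    calc ∑ i, e i ≤ ∑ _i : Fin k, 1 := Finset.sum_le_sum fun i _ => by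
          simp only [e]; split_ifs <;> simp
      _ = k := by simp
  have h3 : Filter.Tendsto (fun t : ℝ => a (chartLine v t) *
      ((∏ i, f i (chartLine v t)) / (t ^ 2) ^ j) * (t ^ 2) ^ (j - ∑ i, e i)) (𝓝[≠] 0) (𝓝 0) := by
    have h4 : Filter.Tendsto (fun t : ℝ => (t ^ 2) ^ (j - ∑ i, e i)) (𝓝[≠] 0) (𝓝 0) := by
      have : Continuous fun t : ℝ => (t ^ 2) ^ (j - ∑ i, e i) := by fun_prop
      have h5 := this.tendsto 0
      have h6 : j - ∑ i, e i ≠ 0 := by omega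
      simp only [ne_eq, OfNat.ofNat_ne_zero, not_false_eq_true, zero_pow, h6] at h5
      exact h5.mono_left nhdsWithin_le_nhds
    have := ((ha.tendsto.comp hl).mul (h.tendsto_prod hU hxU h0 v)).mul h4
    rwa [mul_zero] at this
  refine Finset.prod_ne_zero_iff.2 (fun i _ => hL i) (tendsto_nhds_unique h2 (h3.congr' ?_))
  filter_upwards [hl.eventually hag, self_mem_nhdsWithin] with t ht ht0
  have ht0' : t ≠ 0 := ht0
  have h7 : (t ^ 2) ^ j = (t ^ 2) ^ (j - ∑ i, e i) * (t ^ 2) ^ ∑ i, e i := by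
    rw [← pow_add, Nat.sub_add_cancel hsum.le]
  rw [ht, h7]
  field_simp

/-- By the comparison of vanishing orders, no smaller number of functions can represent the divisor
near x. -/
theorem IsLocalNormalCrossing.mem_stratum (hq : IsElliptic E q) {U : Set M}
    (hU : IsOpen U) {f : Fin n → M → ℝ} (h : IsLocalNormalCrossing E q U f) {x : M} (hxU : x ∈ U)
    (h0 : ∀ i, f i x = 0) : x ∈ stratum E q n := by
  refine le_antisymm (pointIntersectionNumber_le hU h hxU) ?_
  obtain ⟨V, hV, hxV, g, hg⟩ := exists_isLocalNormalCrossing hq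
    (n := pointIntersectionNumber E q x) (x := x) rfl
  exact h.le_of_forall_eq_zero hq.1 hU hV hg hxU hxV h0

namespace AdaptedChart

variable (C : AdaptedChart E q n)

theorem mem_stratum (hq : IsElliptic E q) {x : M} (hx : x ∈ C.source)
    (h0 : ∀ l, C.coord (Sum.inl l) x = 0) : x ∈ stratum E q n :=
  C.crossing.mem_stratum hq C.isOpen_source hx fun i => by
    rw [C.branch_eq x hx, h0, h0]; ring

theorem differential_eq {f : M → ℝ} {x : M} (hx : x ∈ C.source)
    (hf : ContMDiffAt 𝓘(ℝ, E) 𝓘(ℝ, ℝ) ∞ f x) (v : TangentSpace 𝓘(ℝ, E) x) :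
    differential f x v =
      fderiv ℝ (f ∘ C.inv) (C.coords x) fun l => differential (C.coord l) x v := by
  have h1 : HasDerivAt (fun t => C.coords (chartLine v t))
      (fun l => differential (C.coord l) x v) 0 :=
    hasDerivAt_pi.2 fun l => hasDerivAt_chartLine
      ((C.coord l).contMDiff.contMDiffAt.mdifferentiableAt (by simp)) v
  have h2 : DifferentiableAt ℝ (f ∘ C.inv) (C.coords x) := by
    have h3 : C.inv (C.coords x) = x := C.left_inv x hx
    have h4 : ContMDiffAt 𝓘(ℝ, (Fin n × Fin 2) ⊕ Fin C.dim → ℝ) 𝓘(ℝ, ℝ) ∞ (f ∘ C.inv)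
        (C.coords x) := by
      refine ContMDiffAt.comp _ (by rwa [h3]) (C.contMDiffOn_inv.contMDiffAt
        (C.isOpen_target.mem_nhds (C.mem_target x hx)))
    exact (contMDiffAt_iff_contDiffAt.1 h4).differentiableAt (by simp)
  have h5 : HasFDerivAt (f ∘ C.inv) (fderiv ℝ (f ∘ C.inv) (C.coords x))
      (C.coords (chartLine v 0)) := by
    rw [chartLine_zero]
    exact h2.hasFDerivAt
  have h6 := h5.comp_hasDerivAt 0 h1
  refine (hasDerivAt_chartLine (hf.mdifferentiableAt (by simp)) v).unique
    (h6.congr_of_eventuallyEq ?_)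
  filter_upwards [(tendsto_chartLine v).eventually (C.isOpen_source.mem_nhds hx)] with t ht
  have h7 : C.inv (C.coords (chartLine v t)) = chartLine v t := C.left_inv _ ht
  rw [Function.comp_apply, Function.comp_apply, h7]

theorem exists_differential_eq {x : M} (hx : x ∈ C.source) (ξ : (Fin n × Fin 2) ⊕ Fin C.dim → ℝ) :
    ∃ v : TangentSpace 𝓘(ℝ, E) x, ∀ l, differential (C.coord l) x v = ξ l := by
  have h1 : ContMDiffAt 𝓘(ℝ, (Fin n × Fin 2) ⊕ Fin C.dim → ℝ) 𝓘(ℝ, E) ∞ C.inv (C.coords x) :=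
    C.contMDiffOn_inv.contMDiffAt (C.isOpen_target.mem_nhds (C.mem_target x hx))
  have h2 : C.inv (C.coords x) = x := C.left_inv x hx
  have key : ∀ y, y = C.inv (C.coords x) → ∃ v : TangentSpace 𝓘(ℝ, E) y,
      ∀ l, differential (C.coord l) y v = ξ l := by
    rintro y rfl
    refine ⟨mfderiv 𝓘(ℝ, (Fin n × Fin 2) ⊕ Fin C.dim → ℝ) 𝓘(ℝ, E) C.inv (C.coords x) ξ,
      fun l => ?_⟩
    have h3 := ((C.coord l).contMDiff.contMDiffAt (x := C.inv (C.coords x))).mdifferentiableAt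
      (by simp)
    have h4 := mfderiv_comp (C.coords x) h3 (h1.mdifferentiableAt (by simp))
    have h5 : mfderiv 𝓘(ℝ, (Fin n × Fin 2) ⊕ Fin C.dim → ℝ) 𝓘(ℝ, ℝ) (C.coord l ∘ C.inv)
      (C.coords x) ξ = ξ l := by
      rw [mfderiv_eq_fderiv]
      exact C.fderiv_coord_comp_inv hx l ξ
    rw [h4] at h5
    exact h5
  exact key x h2.symm

/-- In the chart the stratum is the plane where the normal coordinates vanish. A vector along this
plane is the velocity of a straight coordinate line contained in the stratum. -/
theorem mem_tangentTo_stratum (hq : IsElliptic E q) {x : M} (hx : x ∈ C.source)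
    (hxs : x ∈ stratum E q n) (v : TangentSpace 𝓘(ℝ, E) x) :
    v ∈ tangentTo (stratum E q n) x ↔ ∀ l, differential (C.coord (Sum.inl l)) x v = 0 := by
  constructor
  · intro hv l
    exact differential_eq_zero_of_mem_tangentTo hv isOpen_univ trivial
      (C.coord (Sum.inl l)).contMDiff.contMDiffOn fun y hy => C.coord_eq_zero y hy.2 l
  · intro hv U h hU hxU hh hz
    change differential h x v = 0
    have hhx := (hh x hxU).contMDiffAt (hU.mem_nhds hxU)
    rw [C.differential_eq hx hhx]
    set ξ : (Fin n × Fin 2) ⊕ Fin C.dim → ℝ := fun l => differential (C.coord l) x v with hξ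
    have h3 : C.inv (C.coords x) = x := C.left_inv x hx
    have h2 : DifferentiableAt ℝ (h ∘ C.inv) (C.coords x) := by
      have h4 : ContMDiffAt 𝓘(ℝ, (Fin n × Fin 2) ⊕ Fin C.dim → ℝ) 𝓘(ℝ, ℝ) ∞ (h ∘ C.inv)
          (C.coords x) := by
        refine ContMDiffAt.comp _ (by rwa [h3]) (C.contMDiffOn_inv.contMDiffAt
          (C.isOpen_target.mem_nhds (C.mem_target x hx)))
      exact (contMDiffAt_iff_contDiffAt.1 h4).differentiableAt (by simp)
    have h5 : HasDerivAt (fun t : ℝ => C.coords x + t • ξ) ξ 0 := by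
      simpa using ((hasDerivAt_id (0 : ℝ)).smul_const ξ).const_add (C.coords x)
    have h6 : HasFDerivAt (h ∘ C.inv) (fderiv ℝ (h ∘ C.inv) (C.coords x))
        (C.coords x + (0 : ℝ) • ξ) := by
      rw [zero_smul, add_zero]
      exact h2.hasFDerivAt
    have h7 := h6.comp_hasDerivAt 0 h5
    refine h7.unique ((hasDerivAt_const (0 : ℝ) (0 : ℝ)).congr_of_eventuallyEq ?_)
    have h8 : Filter.Tendsto (fun t : ℝ => C.coords x + t • ξ) (𝓝 0) (𝓝 (C.coords x)) := by
      have : Continuous fun t : ℝ => C.coords x + t • ξ := by fun_prop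
      simpa using this.tendsto 0
    filter_upwards [h8.eventually (C.eventually_inv_mem hx (hU.mem_nhds hxU)),
      h8.eventually (C.isOpen_target.mem_nhds (C.mem_target x hx))] with t ht ht'
    refine hz _ ⟨ht, C.mem_stratum hq (C.mem_source _ ht') fun l => ?_⟩
    rw [C.right_inv _ ht']
    change C.coord (Sum.inl l) x + t * ξ (Sum.inl l) = 0
    rw [C.coord_eq_zero x hxs, hξ]
    simp only [hv l, mul_zero, add_zero]

/-- The diagonal values are second-order limits of a sum of two squares along a line; polarisation
and symmetry give the bilinear form. -/
theorem hessian_branch {x : M} (hx : x ∈ C.source) (hxs : x ∈ stratum E q n) (i : Fin n)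
    (v w : TangentSpace 𝓘(ℝ, E) x) : hessian (C.branch i) x v w =
      2 * (differential (C.coord (Sum.inl (i, 0))) x v * differential (C.coord (Sum.inl (i, 0))) x w +
        differential (C.coord (Sum.inl (i, 1))) x v *
          differential (C.coord (Sum.inl (i, 1))) x w) := by
  have hb : C.branch i x = 0 := by
    rw [C.branch_eq x hx, C.coord_eq_zero x hxs, C.coord_eq_zero x hxs]
    ring
  have h1 : ∀ v : TangentSpace 𝓘(ℝ, E) x, hessian (C.branch i) x v v / 2 =
      differential (C.coord (Sum.inl (i, 0))) x v ^ 2 +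
        differential (C.coord (Sum.inl (i, 1))) x v ^ 2 := by
    intro v
    have h2 : ∀ a, Filter.Tendsto (fun t : ℝ => (C.coord (Sum.inl (i, a)) (chartLine v t) / t) ^ 2)
        (𝓝[≠] 0) (𝓝 (differential (C.coord (Sum.inl (i, a))) x v ^ 2)) := fun a =>
      (tendsto_chartLine_div ((C.coord _).contMDiff.contMDiffAt.mdifferentiableAt (by simp))
        (C.coord_eq_zero x hxs _) v).pow 2
    refine tendsto_nhds_unique ((C.crossing.elliptic i).tendsto_chartLine C.isOpen_source hx hb v)
      (((h2 0).add (h2 1)).congr' ?_)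
    filter_upwards [((tendsto_chartLine v).mono_left nhdsWithin_le_nhds).eventually
      (C.isOpen_source.mem_nhds hx)] with t ht
    rw [C.branch_eq _ ht, div_pow, div_pow, add_div]
  have hsymm := hessian_comm (((C.crossing.elliptic i).smooth x hx).contMDiffAt
    (C.isOpen_source.mem_nhds hx)) v w
  have h3 := h1 (v + w)
  simp only [map_add, add_apply] at h3
  have h4 := h1 v
  have h5 := h1 w
  linear_combination h3 - h4 - h5 + (1/2) * hsymm

end AdaptedChart

end Strata

/-! ### The structure group as the automorphisms that rescale the product of squared norms, and its
elements near the identity. -/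

section StructureGroup

/-- A real vector space is not a finite union of proper subspaces. -/
theorem exists_le_of_subset_iUnion {V : Type*} [AddCommGroup V] [Module ℝ V] {ι : Type*} [Finite ι]
    (S : Submodule ℝ V) (p : ι → Submodule ℝ V) (h : ∀ w ∈ S, ∃ i, w ∈ p i) : ∃ i, S ≤ p i := by
  obtain ⟨i, hi⟩ := Subspace.exists_eq_top_of_iUnion_eq_univ (k := ℝ) (E := S)
    (p := fun i => (p i).comap S.subtype) (by
      ext w
      simpa using h w w.2)
  exact ⟨i, Submodule.comap_subtype_eq_top.1 hi⟩

variable {n : ℕ}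

/-- The zero set of ∏ |w_i|² is the union of the subspaces {w_i = 0}. As g preserves it, g maps each
{w_j = 0} into a single {w_i = 0}, which defines the permutation. The component i of g w then
depends on w_j only, and varying one summand at a time in the product identity shows that each block
is conformal. -/
theorem mem_structureGroup_of_prod (g : NormalModel n ≃L[ℝ] NormalModel n) {c : ℝ} (hc : c ≠ 0)
    (h : ∀ w, ∏ i, ‖g w i‖ ^ 2 = c * ∏ i, ‖w i‖ ^ 2) : g ∈ structureGroup n := by
  have h1 : ∀ j, ∃ i, ∀ w : NormalModel n, w j = 0 → g w i = 0 := by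
    intro j
    obtain ⟨i, hi⟩ := exists_le_of_subset_iUnion
      (LinearMap.ker (LinearMap.proj j : NormalModel n →ₗ[ℝ] EuclideanSpace ℝ (Fin 2)))
      (fun i => LinearMap.ker ((LinearMap.proj i : NormalModel n →ₗ[ℝ] EuclideanSpace ℝ (Fin 2)) ∘ₗ
        (g : NormalModel n →ₗ[ℝ] NormalModel n))) (by
        intro w hw
        have hw' : w j = 0 := hw
        have h2 := h w
        have h3 : ∏ i, ‖w i‖ ^ 2 = 0 := Finset.prod_eq_zero (Finset.mem_univ j) (by simp [hw'])
        rw [h3, mul_zero, Finset.prod_eq_zero_iff] at h2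
        obtain ⟨i, -, hi⟩ := h2
        exact ⟨i, by simpa using hi⟩)
    exact ⟨i, fun w hw => hi (x := w) hw⟩
  choose σ hσ using h1
  let B : Fin n → EuclideanSpace ℝ (Fin 2) →ₗ[ℝ] EuclideanSpace ℝ (Fin 2) := fun j =>
    (LinearMap.proj (σ j) : NormalModel n →ₗ[ℝ] EuclideanSpace ℝ (Fin 2)) ∘ₗ
      (g : NormalModel n →ₗ[ℝ] NormalModel n) ∘ₗ LinearMap.single ℝ (fun _ : Fin n => EuclideanSpace ℝ (Fin 2)) j
  have hB : ∀ j w, g w (σ j) = B j (w j) := by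
    intro j w
    have h2 := hσ j (w - Pi.single j (w j)) (by simp)
    rw [map_sub, Pi.sub_apply, sub_eq_zero] at h2
    exact h2
  let e : EuclideanSpace ℝ (Fin 2) := EuclideanSpace.single 0 1
  have he : ‖e‖ = 1 := by simp [e]
  -- If σ j = σ k with j ≠ k, the component σ j of g w depends on w_j alone and also vanishes when
  -- w_k = 0, so it is always zero, against surjectivity.
  have hinj : Function.Injective σ := by
    intro j k hjk
    by_contra hne
    obtain ⟨w, hw⟩ := g.surjective fun _ => e
    have h2 : g w (σ j) = 0 := by
      rw [hB]
      change g (Pi.single j (w j)) (σ j) = 0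
      rw [hjk]
      exact hσ k _ (by simp [Ne.symm hne])
    rw [hw] at h2
    rw [show e = 0 from h2, norm_zero] at he
    exact zero_ne_one he
  let τ : Equiv.Perm (Fin n) := Equiv.ofBijective σ (Finite.injective_iff_bijective.1 hinj)
  have hprod : ∀ w : NormalModel n, ∏ j, ‖B j (w j)‖ ^ 2 = c * ∏ j, ‖w j‖ ^ 2 := by
    intro w
    rw [← h w, ← Equiv.prod_comp τ (fun i => ‖g w i‖ ^ 2)]
    exact Finset.prod_congr rfl fun j _ => by rw [← hB]; rfl
  have hc' : ∏ j, ‖B j e‖ ^ 2 = c := by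
    have := hprod fun _ => e
    simpa [he] using this
  have hBe : ∀ j, ‖B j e‖ ≠ 0 := fun j h0 => hc (by
    rw [← hc', Finset.prod_eq_zero (Finset.mem_univ j) (by rw [h0]; simp)])
  -- Test vector: v in the summand j and the unit vector e in all others.
  have hnorm : ∀ j v, ‖B j v‖ = ‖B j e‖ * ‖v‖ := by
    intro j v
    have h2 := hprod (Function.update (fun _ => e) j v)
    have e1 : ∏ k, ‖B k (Function.update (fun _ => e) j v k)‖ ^ 2 =
        ‖B j v‖ ^ 2 * ∏ k ∈ Finset.univ.erase j, ‖B k e‖ ^ 2 := by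
      rw [← Finset.mul_prod_erase _ _ (Finset.mem_univ j), Function.update_self]
      congr 1
      exact Finset.prod_congr rfl fun k hk => by
        rw [Function.update_of_ne (Finset.ne_of_mem_erase hk)]
    have e2 : ∏ k, ‖Function.update (fun _ => e) j v k‖ ^ 2 = ‖v‖ ^ 2 := by
      rw [← Finset.mul_prod_erase _ _ (Finset.mem_univ j), Function.update_self,
        Finset.prod_eq_one fun k hk => by
          rw [Function.update_of_ne (Finset.ne_of_mem_erase hk), he, one_pow], mul_one]
    rw [e1, e2, ← hc', ← Finset.mul_prod_erase _ _ (Finset.mem_univ j)] at h2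
    have h3 : ∏ k ∈ Finset.univ.erase j, ‖B k e‖ ^ 2 ≠ 0 :=
      Finset.prod_ne_zero_iff.2 fun k _ => pow_ne_zero 2 (hBe k)
    have h4 : ‖B j v‖ ^ 2 = (‖B j e‖ * ‖v‖) ^ 2 :=
      mul_right_cancel₀ h3 (by rw [h2]; ring)
    exact (sq_eq_sq₀ (norm_nonneg _) (by positivity)).1 h4
  let A : Fin n → (EuclideanSpace ℝ (Fin 2) →ₗᵢ[ℝ] EuclideanSpace ℝ (Fin 2)) := fun j =>
    { toLinearMap := ‖B j e‖⁻¹ • B j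
      norm_map' := fun v => by
        rw [LinearMap.smul_apply, norm_smul, hnorm j v, norm_inv, norm_norm,
          inv_mul_cancel_left₀ (hBe j)] }
  refine ⟨τ, fun j => ‖B j e‖, fun j => (A j).toLinearIsometryEquiv rfl,
    fun j => (norm_nonneg _).lt_of_ne (hBe j).symm, fun w j => ?_⟩
  change g w (σ j) = ‖B j e‖ • (‖B j e‖⁻¹ • B j (w j))
  rw [hB, smul_smul, mul_inv_cancel₀ (hBe j), one_smul]

theorem exists_equiv_of_ker_eq {V F : Type*} [AddCommGroup V] [Module ℝ V] [NormedAddCommGroup F]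
    [NormedSpace ℝ F] [FiniteDimensional ℝ F] (A B : V →ₗ[ℝ] F) (hA : Function.Surjective A)
    (hB : Function.Surjective B) (h : ∀ v, A v = 0 ↔ B v = 0) :
    ∃ g : F ≃L[ℝ] F, ∀ v, B v = g (A v) := by
  have hk : LinearMap.ker A = LinearMap.ker B := by
    ext v
    exact h v
  refine ⟨((A.quotKerEquivOfSurjective hA).symm ≪≫ₗ (Submodule.quotEquivOfEq _ _ hk) ≪≫ₗ
    B.quotKerEquivOfSurjective hB).toContinuousLinearEquiv, fun v => ?_⟩
  have h1 : (A.quotKerEquivOfSurjective hA).symm (A v) = Submodule.Quotient.mk v := by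
    rw [LinearEquiv.symm_apply_eq]
    rfl
  change _ = B.quotKerEquivOfSurjective hB (Submodule.quotEquivOfEq _ _ hk
    ((A.quotKerEquivOfSurjective hA).symm (A v)))
  rw [h1]
  rfl

/-- The rotation of the plane by a right angle. -/
def rightAngle : EuclideanSpace ℝ (Fin 2) →L[ℝ] EuclideanSpace ℝ (Fin 2) :=
  LinearMap.toContinuousLinearMap
    { toFun := fun v => !₂[-v 1, v 0]
      map_add' := fun v w => by ext a; fin_cases a <;> simp [add_comm]
      map_smul' := fun r v => by ext a; fin_cases a <;> simp }

theorem rightAngle_zero (v : EuclideanSpace ℝ (Fin 2)) : rightAngle v 0 = -v 1 := rfl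

theorem rightAngle_one (v : EuclideanSpace ℝ (Fin 2)) : rightAngle v 1 = v 0 := rfl

/-- Multiplication by `n` complex numbers on `ℂ^n = (ℝ²)^n`. -/
def conformal (γ : Fin n × Fin 2 → ℝ) : NormalModel n →L[ℝ] NormalModel n :=
  ∑ i, (γ (i, 0) • (ContinuousLinearMap.single ℝ (fun _ => EuclideanSpace ℝ (Fin 2)) i ∘L
      ContinuousLinearMap.proj i) +
    γ (i, 1) • (ContinuousLinearMap.single ℝ (fun _ => EuclideanSpace ℝ (Fin 2)) i ∘L
      rightAngle ∘L ContinuousLinearMap.proj i))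

theorem conformal_apply (γ : Fin n × Fin 2 → ℝ) (v : NormalModel n) (i : Fin n) :
    conformal γ v i = γ (i, 0) • v i + γ (i, 1) • rightAngle (v i) := by
  simp only [conformal, sum_apply, Finset.sum_apply, add_apply, smul_apply,
    ContinuousLinearMap.comp_apply, ContinuousLinearMap.proj_apply, Pi.add_apply, Pi.smul_apply,
    ContinuousLinearMap.single_apply]
  rw [Finset.sum_eq_single i]
  · simp
  · intro j _ hj
    simp [Pi.single_eq_of_ne hj.symm]
  · simp

theorem conformal_apply_zero (γ : Fin n × Fin 2 → ℝ) (v : NormalModel n) (i : Fin n) :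
    conformal γ v i 0 = γ (i, 0) * v i 0 - γ (i, 1) * v i 1 := by
  rw [conformal_apply]
  simp [rightAngle_zero, sub_eq_add_neg]

theorem conformal_apply_one (γ : Fin n × Fin 2 → ℝ) (v : NormalModel n) (i : Fin n) :
    conformal γ v i 1 = γ (i, 0) * v i 1 + γ (i, 1) * v i 0 := by
  rw [conformal_apply]
  simp [rightAngle_one]

theorem contDiff_conformal : ContDiff ℝ ∞ (conformal (n := n)) := by
  unfold conformal
  fun_prop

/-- The inverses of `n` complex numbers. -/
def conformalInv (γ : Fin n × Fin 2 → ℝ) : Fin n × Fin 2 → ℝ := fun l =>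
  (if l.2 = 0 then γ (l.1, 0) else -γ (l.1, 1)) / (γ (l.1, 0) ^ 2 + γ (l.1, 1) ^ 2)

theorem conformal_mul (γ δ : Fin n × Fin 2 → ℝ)
    (h0 : ∀ i, γ (i, 0) * δ (i, 0) - γ (i, 1) * δ (i, 1) = 1)
    (h1 : ∀ i, γ (i, 0) * δ (i, 1) + γ (i, 1) * δ (i, 0) = 0) (v : NormalModel n) :
    conformal γ (conformal δ v) = v := by
  ext i a
  fin_cases a
  · simp only [Fin.zero_eta, conformal_apply_zero, conformal_apply_one]
    linear_combination v i 0 * h0 i - v i 1 * h1 i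
  · simp only [Fin.mk_one, conformal_apply_zero, conformal_apply_one]
    linear_combination v i 1 * h0 i + v i 0 * h1 i

theorem conformal_conformalInv {γ : Fin n × Fin 2 → ℝ}
    (hγ : ∀ i, γ (i, 0) ^ 2 + γ (i, 1) ^ 2 ≠ 0) (v : NormalModel n) :
    conformal γ (conformal (conformalInv γ) v) = v := by
  refine conformal_mul _ _ (fun i => ?_) (fun i => ?_) v <;>
  · have := hγ i
    simp only [conformalInv, ite_true, one_ne_zero, ite_false]
    field_simp
    ring

theorem conformalInv_conformal {γ : Fin n × Fin 2 → ℝ}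
    (hγ : ∀ i, γ (i, 0) ^ 2 + γ (i, 1) ^ 2 ≠ 0) (v : NormalModel n) :
    conformal (conformalInv γ) (conformal γ v) = v := by
  refine conformal_mul _ _ (fun i => ?_) (fun i => ?_) v <;>
  · have := hγ i
    simp only [conformalInv, ite_true, one_ne_zero, ite_false]
    field_simp
    ring

theorem norm_sq_eq (v : EuclideanSpace ℝ (Fin 2)) : ‖v‖ ^ 2 = v 0 ^ 2 + v 1 ^ 2 := by
  simp [EuclideanSpace.norm_sq_eq, Fin.sum_univ_two]

/-- Multiplication by `n` nonzero complex numbers, as an element of the structure group. -/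
def conformalEquiv (γ : Fin n × Fin 2 → ℝ) (hγ : ∀ i, γ (i, 0) ^ 2 + γ (i, 1) ^ 2 ≠ 0) :
    structureGroup n :=
  ⟨ContinuousLinearEquiv.equivOfInverse (conformal γ) (conformal (conformalInv γ))
    (conformalInv_conformal hγ) (conformal_conformalInv hγ), by
    refine mem_structureGroup_of_prod _ (c := ∏ i, (γ (i, 0) ^ 2 + γ (i, 1) ^ 2))
      (Finset.prod_ne_zero_iff.2 fun i _ => hγ i) fun w => ?_
    rw [← Finset.prod_mul_distrib]
    refine Finset.prod_congr rfl fun i _ => ?_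
    change ‖conformal γ w i‖ ^ 2 = _
    rw [norm_sq_eq, norm_sq_eq, conformal_apply_zero, conformal_apply_one]
    ring⟩

/-- An element of the structure group which is close to the identity multiplies by complex
numbers. -/
theorem structureGroup_eq_conformal (g : structureGroup n)
    (h0 : ∀ i, 0 < g.1 (Pi.single i (EuclideanSpace.single 0 1)) i 0)
    (h1 : ∀ i, 0 < g.1 (Pi.single i (EuclideanSpace.single 1 1)) i 1) (v : NormalModel n) :
    g.1 v = conformal (fun l => g.1 (Pi.single l.1 (EuclideanSpace.single 0 1)) l.1 l.2) v := by
  obtain ⟨g, σ, c, A, hc, hg⟩ := g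
  -- If σ moved i, the i-th component of the image of a vector in the i-th summand would vanish,
  -- against the positive diagonal entry.
  have hσ : ∀ i, σ i = i := by
    intro i
    by_contra hne
    have h2 := hg (Pi.single (σ.symm i) 0 + Pi.single i (EuclideanSpace.single 0 1)) (σ.symm i)
    have h3 : σ.symm i ≠ i := fun h => hne (by rw [← h, Equiv.apply_symm_apply, h])
    rw [Equiv.apply_symm_apply, Pi.single_zero, zero_add, Pi.single_eq_of_ne h3, map_zero,
      smul_zero] at h2
    have h4 := h0 i
    rw [h2] at h4
    exact lt_irrefl _ h4
  have hg' : ∀ v i, g v i = c i • A i (v i) := fun v i => by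
    have := hg v i
    rwa [hσ] at this
  simp only [hg', Pi.single_eq_same] at h0 h1 ⊢
  ext i a
  have hdec : v i = v i 0 • EuclideanSpace.single 0 1 + v i 1 • EuclideanSpace.single 1 1 := by
    ext a
    fin_cases a <;> simp
  set x := A i (EuclideanSpace.single 0 1) with hx
  set y := A i (EuclideanSpace.single 1 1) with hy
  have hA : A i (v i) = v i 0 • x + v i 1 • y := by
    conv_lhs => rw [hdec, map_add, map_smul, map_smul]
  have hxx : x 0 ^ 2 + x 1 ^ 2 = 1 := by rw [← norm_sq_eq, hx, (A i).norm_map]; simp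
  have hyy : y 0 ^ 2 + y 1 ^ 2 = 1 := by rw [← norm_sq_eq, hy, (A i).norm_map]; simp
  have hxy : x 0 * y 0 + x 1 * y 1 = 0 := by
    have h3 := (A i).inner_map_map (EuclideanSpace.single 0 1) (EuclideanSpace.single 1 1)
    rw [← hx, ← hy] at h3
    simp [PiLp.inner_apply, Fin.sum_univ_two] at h3
    linarith
  have hx0 : 0 < x 0 := pos_of_mul_pos_right (by simpa using h0 i) (hc i).le
  have hy1 : 0 < y 1 := pos_of_mul_pos_right (by simpa using h1 i) (hc i).le
  -- For an orthonormal pair x, y of the plane, y is plus or minus the rotation of x by a right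
  -- angle; positivity of x_0 and y_1 selects the plus sign and excludes reflections.
  have h5 : y 1 = x 0 := by
    have h6 : (x 0) ^ 2 = (y 1) ^ 2 := by
      have e1 : (x 0 * y 0) ^ 2 = (x 1 * y 1) ^ 2 := by
        have : x 0 * y 0 = -(x 1 * y 1) := by linarith
        rw [this]; ring
      linear_combination (x 0) ^ 2 * (-hyy) + (y 1) ^ 2 * hxx + e1
    nlinarith
  have h7 : y 0 = -x 1 := by
    rw [h5] at hxy
    have h8 : x 0 * (y 0 + x 1) = 0 := by linarith
    have := (mul_eq_zero.1 h8).resolve_left hx0.ne'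
    linarith
  rw [hg', hA]
  fin_cases a
  · simp only [Fin.zero_eta, conformal_apply_zero]
    simp [← hx, h7]
    ring
  · simp only [Fin.mk_one, conformal_apply_one]
    simp [← hx, h5]
    ring

end StructureGroup

/-! ### Frames of the normal bundle -/

section ChartDifferential

variable {E : Type*} [NormedAddCommGroup E] [NormedSpace ℝ E]
  {M : Type*} [TopologicalSpace M] [ChartedSpace E M] [IsManifold 𝓘(ℝ, E) ∞ M]
  {F : Type*} [NormedAddCommGroup F] [NormedSpace ℝ F]

/-- The differential of a map in the chart at `x₀`. -/
def chartDifferential (k : M → F) (x₀ x : M) : E →L[ℝ] F :=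
  fderiv ℝ (k ∘ (extChartAt 𝓘(ℝ, E) x₀).symm) (extChartAt 𝓘(ℝ, E) x₀ x)

theorem contMDiffOn_chartDifferential {k : M → F} (hk : ContMDiff 𝓘(ℝ, E) 𝓘(ℝ, F) ∞ k) (x₀ : M) :
    ContMDiffOn 𝓘(ℝ, E) 𝓘(ℝ, E →L[ℝ] F) ∞ (chartDifferential (E := E) k x₀) (chartAt E x₀).source := by
  have h1 : ContDiffOn ℝ ∞ (k ∘ (extChartAt 𝓘(ℝ, E) x₀).symm) (extChartAt 𝓘(ℝ, E) x₀).target :=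
    contMDiffOn_iff_contDiffOn.1
      (hk.comp_contMDiffOn (contMDiffOn_extChartAt_symm (I := 𝓘(ℝ, E)) x₀))
  have h2 : ContDiffOn ℝ ∞ (fderiv ℝ (k ∘ (extChartAt 𝓘(ℝ, E) x₀).symm))
      (extChartAt 𝓘(ℝ, E) x₀).target :=
    h1.fderiv_of_isOpen (isOpen_extChartAt_target x₀) (by simp)
  exact h2.contMDiffOn.comp contMDiffOn_extChartAt fun y hy =>
    (extChartAt 𝓘(ℝ, E) x₀).map_source (by rwa [extChartAt_source])

/-- Relates the derivative in a fixed chart, whose smoothness in x is clear, to the intrinsic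
differential in the trivialisation of TM, as it occurs in coordinates on Hom(TM, (ℝ²)^n). -/
theorem chartDifferential_eq {k : M → F} (hk : ContMDiff 𝓘(ℝ, E) 𝓘(ℝ, F) ∞ k) {x₀ x : M}
    (hx : x ∈ (chartAt E x₀).source) (e : E) : chartDifferential k x₀ x e =
      mfderiv 𝓘(ℝ, E) 𝓘(ℝ, F) k x
        ((trivializationAt E (TangentSpace 𝓘(ℝ, E)) x₀).symmL ℝ x e) := by
  rw [TangentBundle.symmL_trivializationAt hx]
  have h1 : (extChartAt 𝓘(ℝ, E) x₀).symm (extChartAt 𝓘(ℝ, E) x₀ x) = x :=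
    (extChartAt 𝓘(ℝ, E) x₀).left_inv (by rwa [extChartAt_source])
  have h2 : MDifferentiableAt 𝓘(ℝ, E) 𝓘(ℝ, E) (extChartAt 𝓘(ℝ, E) x₀).symm
      (extChartAt 𝓘(ℝ, E) x₀ x) :=
    ((contMDiffOn_extChartAt_symm (n := ∞) x₀).contMDiffAt ((isOpen_extChartAt_target x₀).mem_nhds
      ((extChartAt 𝓘(ℝ, E) x₀).map_source (by rwa [extChartAt_source])))).mdifferentiableAt (by simp)
  have key : ∀ (y : M) (w : E), y = (extChartAt 𝓘(ℝ, E) x₀).symm (extChartAt 𝓘(ℝ, E) x₀ x) →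
      w = (mfderiv 𝓘(ℝ, E) 𝓘(ℝ, E) (extChartAt 𝓘(ℝ, E) x₀).symm (extChartAt 𝓘(ℝ, E) x₀ x) e : E) →
      chartDifferential k x₀ x e = (mfderiv 𝓘(ℝ, E) 𝓘(ℝ, F) k y : E →L[ℝ] F) w := by
    rintro y w rfl rfl
    have h3 := mfderiv_comp (extChartAt 𝓘(ℝ, E) x₀ x)
      (hk.contMDiffAt.mdifferentiableAt (by simp)) h2
    rw [mfderiv_eq_fderiv] at h3
    exact congrArg (fun L : E →L[ℝ] F => L e) h3
  refine key x _ h1.symm ?_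
  simp only [modelWithCornersSelf_coe, Set.range_id, mfderivWithin_univ]
  rfl

end ChartDifferential

section Reduction

variable {E : Type*} [NormedAddCommGroup E] [NormedSpace ℝ E]
  {M : Type*} [TopologicalSpace M] [ChartedSpace E M]
  {R : M → Type*} [TopologicalSpace (TotalSpace ℝ R)]
  [∀ x, AddCommGroup (R x)] [∀ x, Module ℝ (R x)] [∀ x, TopologicalSpace (R x)]
  [FiberBundle ℝ R]
variable [FiniteDimensional ℝ E] [T2Space M] [IsManifold 𝓘(ℝ, E) ∞ M] {q : ∀ x, R x} {n : ℕ}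

namespace AdaptedChart

variable (C : AdaptedChart E q n)

/-- The projection to the normal coordinates. -/
def normalProj : ((Fin n × Fin 2) ⊕ Fin C.dim → ℝ) →L[ℝ] NormalModel n :=
  ContinuousLinearMap.pi fun i =>
    ((EuclideanSpace.equiv (Fin 2) ℝ).symm : (Fin 2 → ℝ) →L[ℝ] EuclideanSpace ℝ (Fin 2)) ∘L
      ContinuousLinearMap.pi fun a => ContinuousLinearMap.proj (Sum.inl (i, a))

/-- The normal coordinates of a point. -/
def normal (y : M) : NormalModel n := C.normalProj (C.coords y)

theorem contMDiff_normal : ContMDiff 𝓘(ℝ, E) 𝓘(ℝ, NormalModel n) ∞ C.normal :=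
  C.normalProj.contMDiff.comp C.contMDiff_coords

/-- The differential of the normal coordinates. -/
def normalDiff (x : M) : TangentSpace 𝓘(ℝ, E) x →L[ℝ] NormalModel n :=
  mfderiv 𝓘(ℝ, E) 𝓘(ℝ, NormalModel n) C.normal x

theorem normalDiff_apply (x : M) (v : TangentSpace 𝓘(ℝ, E) x) (i : Fin n) (a : Fin 2) :
    C.normalDiff x v i a = differential (C.coord (Sum.inl (i, a))) x v :=
  (mfderiv_clm_comp ((EuclideanSpace.proj a : EuclideanSpace ℝ (Fin 2) →L[ℝ] ℝ) ∘L
    (ContinuousLinearMap.proj i : NormalModel n →L[ℝ] EuclideanSpace ℝ (Fin 2)))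
    (C.contMDiff_normal.contMDiffAt.mdifferentiableAt (by simp)) v).symm

theorem normalDiff_surjective {x : M} (hx : x ∈ C.source) :
    Function.Surjective (C.normalDiff x) := by
  intro m
  obtain ⟨v, hv⟩ := C.exists_differential_eq hx (Sum.elim (fun l => m l.1 l.2) 0)
  refine ⟨v, ?_⟩
  ext i a
  rw [normalDiff_apply, hv, Sum.elim_inl]

theorem normalDiff_eq_zero_iff (hq : IsElliptic E q) {x : M} (hx : x ∈ C.source)
    (hxs : x ∈ stratum E q n) (v : TangentSpace 𝓘(ℝ, E) x) :
    C.normalDiff x v = 0 ↔ v ∈ tangentTo (stratum E q n) x := by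
  rw [C.mem_tangentTo_stratum hq hx hxs]
  constructor
  · rintro h ⟨i, a⟩
    rw [← normalDiff_apply, h]
    rfl
  · intro h
    ext i a
    rw [normalDiff_apply, h]
    rfl

/-- The frame of the normal bundle given by the normal coordinates. -/
def frame (hq : IsElliptic E q) {x : M} (hx : x ∈ C.source) (hxs : x ∈ stratum E q n) :
    reduction E q n :=
  ⟨⟨x, C.normalDiff x⟩, hxs, C.normalDiff_surjective hx, C.normalDiff_eq_zero_iff hq hx hxs,
    -- The factor 1/2 is needed because the Hessian of a squared radius is twice the standard inner
    -- product.
    C.source, C.isOpen_source, hx, fun i y => 2⁻¹ * C.branch i y,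
    C.crossing.rescale E C.isOpen_source 1 (fun _ => 2⁻¹) (fun _ => by norm_num), fun i y hy => by
      simp only [C.branch_eq y hy]; positivity, fun i v w => by
      rw [hessian_const_mul]
      change 2⁻¹ * hessian (C.branch i) x v w = ⟪C.normalDiff x v i, C.normalDiff x w i⟫_ℝ
      rw [C.hessian_branch hx hxs]
      simp only [PiLp.inner_apply, Fin.sum_univ_two, normalDiff_apply, RCLike.inner_apply,
        conj_trivial]
      ring⟩

/-- Both θ's have kernel T_x D[n], so they differ by a linear automorphism g. The two local
generators of I_q differ by a factor that is nonzero at x; comparing leading terms along all lines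
gives proportional products of Hessians, that is, the product identity characterising the structure
group. -/
theorem exists_structureGroup_of_hessian (hq : IsElliptic E q) {x : M} (hp : x ∈ C.source)
    (hxs : x ∈ stratum E q n) (A : TangentSpace 𝓘(ℝ, E) x →L[ℝ] NormalModel n)
    (hsurj : Function.Surjective A) (hker : ∀ v, A v = 0 ↔ v ∈ tangentTo (stratum E q n) x)
    {U : Set M} (hU : IsOpen U) (hxU : x ∈ U) {f : Fin n → M → ℝ}
    (hf : IsLocalNormalCrossing E q U f)
    (hh : ∀ i (v w : TangentSpace 𝓘(ℝ, E) x), hessian (f i) x v w = ⟪A v i, A w i⟫_ℝ) :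
    ∃ g : structureGroup n, ∀ v, C.normalDiff x v = g.1 (A v) := by
  obtain ⟨g, hg⟩ := exists_equiv_of_ker_eq (A : TangentSpace 𝓘(ℝ, E) x →ₗ[ℝ] NormalModel n)
    (C.normalDiff x) hsurj (C.normalDiff_surjective hp)
    fun v => (hker v).trans (C.normalDiff_eq_zero_iff hq hp hxs v).symm
  change ∀ v, C.normalDiff x v = g (A v) at hg
  obtain ⟨a, ha, ha0, hab⟩ := hf.exists_unit hq.1 hU C.isOpen_source C.crossing hxU hp
  have hf0 := hf.eq_zero_of_mem_stratum hq.1 hU hxU hxs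
  have hb0 := C.crossing.eq_zero_of_mem_stratum hq.1 C.isOpen_source hp hxs
  have key : ∀ v : TangentSpace 𝓘(ℝ, E) x,
      ∏ i, hessian (C.branch i) x v v / 2 = a x * ∏ i, hessian (f i) x v v / 2 := by
    intro v
    have hl : Filter.Tendsto (chartLine v) (𝓝[≠] 0) (𝓝 x) :=
      (tendsto_chartLine v).mono_left nhdsWithin_le_nhds
    refine tendsto_nhds_unique (C.crossing.tendsto_prod C.isOpen_source hp hb0 v)
      (((ha.tendsto.comp hl).mul (hf.tendsto_prod hU hxU hf0 v)).congr' ?_)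
    filter_upwards [hl.eventually hab] with t ht
    rw [ht, Function.comp_apply, mul_div_assoc]
  -- The halves come from Hess(f_i)/2 = |(θ v)_i|²/2, whereas Hess(branch_i)/2 is the full squared
  -- norm of the normal coordinates.
  refine ⟨⟨g, mem_structureGroup_of_prod g (c := a x * ∏ _i : Fin n, (2 : ℝ)⁻¹)
    (mul_ne_zero ha0 (Finset.prod_ne_zero_iff.2 fun _ _ => by norm_num)) fun w => ?_⟩, hg⟩
  obtain ⟨v, rfl⟩ := hsurj w
  have h1 := key v
  rw [mul_assoc, ← Finset.prod_mul_distrib, ← hg]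
  refine Eq.trans (Finset.prod_congr rfl fun i _ => ?_) (h1.trans ?_)
  · rw [C.hessian_branch hp hxs, norm_sq_eq, normalDiff_apply, normalDiff_apply]
    ring
  · congr 1
    refine Finset.prod_congr rfl fun i _ => ?_
    rw [hh, real_inner_self_eq_norm_sq]
    ring

theorem exists_structureGroup (hq : IsElliptic E q) (p : reduction E q n) (hp : p.1.1 ∈ C.source) :
    ∃ g : structureGroup n, ∀ v, C.normalDiff p.1.1 v = g.1 (p.1.2 v) := by
  obtain ⟨hxs, hsurj, hker, U, hU, hxU, f, hf, -, hh⟩ := p.2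
  exact C.exists_structureGroup_of_hessian hq hp hxs p.1.2 hsurj hker hU hxU hf hh

end AdaptedChart

/-- The derivative of a function in the direction of a constant combination of the vectors of the
frame. -/
def frameDeriv (k : C^∞⟮𝓘(ℝ, E), M; 𝓘(ℝ, ℝ), ℝ⟯) (m : NormalModel n) (p : reduction E q n) : ℝ :=
  differential k p.1.1 (Classical.choose (p.2.2.1 m))

/-- The choice of preimage is immaterial: two preimages of m differ by a vector tangent to the
stratum, where dk vanishes. -/
theorem frameDeriv_eq {k : C^∞⟮𝓘(ℝ, E), M; 𝓘(ℝ, ℝ), ℝ⟯} (hk : ∀ y ∈ stratum E q n, k y = 0)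
    {m : NormalModel n} {p : reduction E q n} {v : TangentSpace 𝓘(ℝ, E) p.1.1}
    (hv : p.1.2 v = m) : frameDeriv k m p = differential k p.1.1 v := by
  have h1 := Classical.choose_spec (p.2.2.1 m)
  have h2 : Classical.choose (p.2.2.1 m) - v ∈ tangentTo (stratum E q n) p.1.1 := by
    rw [← p.2.2.2.1, map_sub, h1, hv]
    exact sub_self m
  have h3 := differential_eq_zero_of_mem_tangentTo h2 isOpen_univ trivial
    k.contMDiff.contMDiffOn fun y hy => hk y hy.2
  rw [map_sub, sub_eq_zero] at h3
  exact h3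

/-- In a trivialisation fix a linear right inverse r of the given θ₀. For θ near θ₀ the endomorphism
θ r is invertible, and r (θ r)⁻¹ m is a preimage of m that depends smoothly on θ. -/
theorem frameDeriv_mem {k : C^∞⟮𝓘(ℝ, E), M; 𝓘(ℝ, ℝ), ℝ⟯} (hk : ∀ y ∈ stratum E q n, k y = 0)
    (m : NormalModel n) :
    (frameDeriv k m : reduction E q n → ℝ) ∈ smoothFunctions (homModel E n) (reduction E q n) := by
  intro p₀
  let x₀ := p₀.1.1
  let e := trivializationAt (E →L[ℝ] NormalModel n)
    (fun x : M => TangentSpace 𝓘(ℝ, E) x →L[ℝ] Bundle.Trivial M (NormalModel n) x) x₀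
  let et := trivializationAt E (TangentSpace 𝓘(ℝ, E) (M := M)) x₀
  have he : ∀ p : HomBundle E M n, p.1 ∈ et.baseSet → ∀ v : E, (e p).2 v = p.2 (et.symmL ℝ p.1 v) :=
    fun p hp v => by
    change ContinuousLinearMap.inCoordinates E (fun x : M => TangentSpace 𝓘(ℝ, E) x)
      (NormalModel n) (Bundle.Trivial M (NormalModel n)) x₀ p.1 x₀ p.1 p.2 v = _
    simp [ContinuousLinearMap.inCoordinates]
    rfl
  have hbase : et.baseSet = (chartAt E x₀).source := rfl
  have hsource : ∀ p : HomBundle E M n, p.1 ∈ (chartAt E x₀).source → p ∈ e.source :=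
    fun p hp => ⟨hp, trivial⟩
  have hx₀ : x₀ ∈ (chartAt E x₀).source := mem_chart_source E x₀
  have hs : Function.Surjective ((e p₀.1).2 : E →ₗ[ℝ] NormalModel n) := by
    intro w
    obtain ⟨v, hv⟩ := p₀.2.2.1 w
    refine ⟨et.continuousLinearMapAt ℝ x₀ v, ?_⟩
    refine (he p₀.1 hx₀ _).trans ?_
    rw [et.symmL_continuousLinearMapAt hx₀, hv]
  obtain ⟨r₀, hr₀⟩ := LinearMap.exists_rightInverse_of_surjective _ (LinearMap.range_eq_top.2 hs)
  let r : NormalModel n →L[ℝ] E := r₀.toContinuousLinearMap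
  let A : HomBundle E M n → NormalModel n →L[ℝ] NormalModel n := fun p => (e p).2 ∘L r
  have hA₀ : A p₀.1 = (ContinuousLinearEquiv.refl ℝ (NormalModel n)) := by
    ext1 w
    exact LinearMap.congr_fun hr₀ w
  have heS : ContMDiffOn (homModel E n) (homModel E n) ∞ e e.source := e.contMDiffOn
  have hAs : ContMDiffOn (homModel E n) 𝓘(ℝ, NormalModel n →L[ℝ] NormalModel n) ∞ A e.source := by
    have h1 : ContMDiffOn (homModel E n) 𝓘(ℝ, E →L[ℝ] NormalModel n) ∞ (fun p => (e p).2)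
        e.source := contMDiff_snd.comp_contMDiffOn heS
    exact h1.clm_comp contMDiffOn_const
  let U : Set (HomBundle E M n) := e.source ∩ A ⁻¹'
    Set.range ((↑) : (NormalModel n ≃L[ℝ] NormalModel n) → NormalModel n →L[ℝ] NormalModel n)
  have hU : IsOpen U :=
    hAs.continuousOn.isOpen_inter_preimage e.open_source ContinuousLinearEquiv.isOpen
  refine ⟨U, hU, ⟨hsource p₀.1 hx₀, _, hA₀.symm⟩, fun p => chartDifferential k x₀ p.1
    (r (ContinuousLinearMap.inverse (A p) m)), ?_, ?_⟩
  · have h1 : ContMDiffOn (homModel E n) 𝓘(ℝ, E →L[ℝ] ℝ) ∞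
        (fun p : HomBundle E M n => chartDifferential k x₀ p.1) U :=
      (contMDiffOn_chartDifferential k.contMDiff x₀).comp
        (contMDiff_proj _).contMDiffOn fun p hp => hp.1.1
    have h2 : ContMDiffOn (homModel E n) 𝓘(ℝ, NormalModel n →L[ℝ] NormalModel n) ∞
        (fun p => ContinuousLinearMap.inverse (A p)) U := by
      rintro p ⟨hp, g, hg⟩
      have h3 : ContDiffAt ℝ ∞ ContinuousLinearMap.inverse (A p) := by
        rw [← hg]
        exact contDiffAt_map_inverse g
      exact (h3.contMDiffAt.comp p (hAs.contMDiffAt (e.open_source.mem_nhds hp))).contMDiffWithinAt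
    exact h1.clm_apply (contMDiffOn_const.clm_apply (h2.clm_apply contMDiffOn_const))
  · rintro p ⟨hp, g, hg⟩
    have hpx : p.1.1 ∈ (chartAt E x₀).source := hp.1
    have h4 : p.1.2 (et.symmL ℝ p.1.1 (r (ContinuousLinearMap.inverse (A p.1) m))) = m := by
      refine (he p.1 hpx _).symm.trans ?_
      change A p.1 (ContinuousLinearMap.inverse (A p.1) m) = m
      rw [← hg, ContinuousLinearMap.inverse_equiv]
      exact g.apply_symm_apply m
    exact (frameDeriv_eq hk h4).trans (chartDifferential_eq k.contMDiff hpx _).symm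

end Reduction

/-! ### Smooth functions and tangent vectors of subsets of manifolds -/

section SmoothFunctions

variable {F H X : Type*} [NormedAddCommGroup F] [NormedSpace ℝ F] [TopologicalSpace H]
  [TopologicalSpace X] [ChartedSpace H X] {J : ModelWithCorners ℝ F H} {S : Set X}

namespace SmoothFun

theorem add_apply (f g : SmoothFun J S) (p : S) : (f + g) p = f p + g p := rfl

theorem sub_apply (f g : SmoothFun J S) (p : S) : (f - g) p = f p - g p := rfl

theorem mul_apply (f g : SmoothFun J S) (p : S) : (f * g) p = f p * g p := rfl

theorem smul_apply (c : ℝ) (f : SmoothFun J S) (p : S) : (c • f) p = c * f p := rfl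

theorem sum_apply {ι : Type*} (s : Finset ι) (f : ι → SmoothFun J S) (p : S) :
    (∑ i ∈ s, f i) p = ∑ i ∈ s, f i p := by
  let φ : SmoothFun J S →+ ℝ := { toFun := fun h => h p, map_zero' := rfl, map_add' := fun _ _ => rfl }
  exact map_sum φ f s

@[ext]
theorem ext {f g : SmoothFun J S} (h : ∀ p, f p = g p) : f = g := DFunLike.ext f g h

/-- A smooth function of smooth functions. -/
def comp {ι : Type} [Fintype ι] {G : (ι → ℝ) → ℝ} (hG : ContDiff ℝ ∞ G) (w : ι → SmoothFun J S) :
    SmoothFun J S :=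
  ⟨fun p => G fun l => w l p, fun p => by
    choose U hU hpU k hk hwk using fun l => (w l).2 p
    refine ⟨⋂ l, U l, isOpen_iInter_of_finite hU, Set.mem_iInter.2 hpU, fun x => G fun l => k l x,
      hG.contMDiff.comp_contMDiffOn (contMDiffOn_pi_space.2 fun l =>
        (hk l).mono (Set.iInter_subset U l)), fun y hy => ?_⟩
    exact congrArg G (funext fun l => hwk l y (Set.mem_iInter.1 hy l))⟩

theorem comp_apply {ι : Type} [Fintype ι] {G : (ι → ℝ) → ℝ} (hG : ContDiff ℝ ∞ G)
    (w : ι → SmoothFun J S) (p : S) : comp hG w p = G fun l => w l p := rfl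

end SmoothFun

/-- Neighbourhoods are given by the nonvanishing of a smooth function, so that locality can be
handled inside the algebra of functions. -/
theorem mem_smoothFunctions_of_local {f : S → ℝ}
    (h : ∀ p : S, ∃ Θ g : SmoothFun J S, Θ p ≠ 0 ∧ ∀ p', Θ p' ≠ 0 → f p' = g p') :
    f ∈ smoothFunctions J S := by
  intro p
  obtain ⟨Θ, g, hp, hfg⟩ := h p
  obtain ⟨U, hU, hpU, k, hk, hΘk⟩ := Θ.2 p
  obtain ⟨V, hV, hpV, l, hl, hgl⟩ := g.2 p
  have hk0 : k p ≠ 0 := by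
    rw [← hΘk p hpU]
    exact hp
  refine ⟨V ∩ (U ∩ k ⁻¹' {0}ᶜ), hV.inter (hk.continuousOn.isOpen_inter_preimage hU
    isOpen_compl_singleton), ⟨hpV, hpU, hk0⟩, l, hl.mono Set.inter_subset_left, fun y hy => ?_⟩
  refine (hfg y ?_).trans (hgl y hy.1)
  change Θ.1 y ≠ 0
  rw [hΘk y hy.2.1]
  exact hy.2.2

/-- A tangent vector at `p`, as a derivation of the algebra of smooth functions. -/
structure IsPointDerivation (p : S) (v : SmoothFun J S →ₗ[ℝ] ℝ) : Prop where
  leibniz : ∀ f g, v (f * g) = f p * v g + g p * v f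

namespace IsPointDerivation

variable {p : S} {v : SmoothFun J S →ₗ[ℝ] ℝ}

/-- Apply the Leibniz rule to Θ (f - g) = 0 at p. -/
theorem congr (hv : IsPointDerivation p v) {Θ f g : SmoothFun J S} (hp : Θ p ≠ 0)
    (h : ∀ p', Θ p' ≠ 0 → f p' = g p') : v f = v g := by
  have h1 : Θ * (f - g) = 0 := by
    ext p'
    rw [SmoothFun.mul_apply, SmoothFun.sub_apply]
    by_cases h0 : Θ p' = 0
    · rw [h0, zero_mul]
      rfl
    · rw [h p' h0, sub_self, mul_zero]
      rfl
  have h2 := hv.leibniz Θ (f - g)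
  rw [h1, map_zero, SmoothFun.sub_apply, h p hp, sub_self, zero_mul, add_zero, map_sub] at h2
  exact sub_eq_zero.1 ((mul_eq_zero.1 h2.symm).resolve_left hp)

theorem comp_eq (hv : IsPointDerivation p v) {ι : Type} [Fintype ι] [DecidableEq ι]
    {G : (ι → ℝ) → ℝ}
    (hG : ContDiff ℝ ∞ G) (w : ι → SmoothFun J S) :
    v (SmoothFun.comp hG w) = fderiv ℝ G (fun l => w l p) fun l => v (w l) := by
  classical
  let u : ((ι → ℝ) → ℝ) → ℝ := fun G =>
    if hG : ContDiff ℝ ∞ G then v (SmoothFun.comp hG w) else 0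
  have hu : ∀ {G} (hG : ContDiff ℝ ∞ G), u G = v (SmoothFun.comp hG w) := fun hG => dif_pos hG
  have h4 := derivation_at_eq_sum (fun l => w l p) u
    (fun F G hF hG => by
      rw [hu (hF.add hG), hu hF, hu hG, ← map_add]
      rfl)
    (fun c F hF => by
      rw [hu (contDiff_const.mul hF), hu hF, ← smul_eq_mul, ← map_smul]
      rfl)
    (fun F G hF hG => by
      rw [hu (hF.mul hG), hu hF, hu hG]
      exact hv.leibniz (SmoothFun.comp hF w) (SmoothFun.comp hG w)) hG
  rw [hu hG] at h4
  have h5 : (fun l => v (w l)) = ∑ l, v (w l) • Pi.single l (1 : ℝ) := by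
    funext l
    simp [Finset.sum_apply, Pi.single_apply]
  rw [h4, h5, map_sum]
  refine Finset.sum_congr rfl fun l _ => ?_
  rw [hu (contDiff_apply ℝ ℝ l), map_smul, smul_eq_mul, mul_comm]
  rfl

theorem add {v' : SmoothFun J S →ₗ[ℝ] ℝ} (hv : IsPointDerivation p v)
    (hv' : IsPointDerivation p v') : IsPointDerivation p (v + v') :=
  ⟨fun f g => by
    rw [LinearMap.add_apply, LinearMap.add_apply, LinearMap.add_apply, hv.leibniz, hv'.leibniz]
    ring⟩

theorem smul (hv : IsPointDerivation p v) (c : ℝ) : IsPointDerivation p (c • v) :=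
  ⟨fun f g => by
    rw [LinearMap.smul_apply, LinearMap.smul_apply, LinearMap.smul_apply, hv.leibniz, smul_eq_mul,
      smul_eq_mul, smul_eq_mul]
    ring⟩

end IsPointDerivation

/-- The value of a vector field at a point. -/
def pointDerivation (D : VectorFields J S) (p : S) : SmoothFun J S →ₗ[ℝ] ℝ where
  toFun h := D h p
  map_add' f g := by rw [map_add]; rfl
  map_smul' c f := by rw [Derivation.map_smul]; rfl

theorem isPointDerivation_pointDerivation (D : VectorFields J S) (p : S) :
    IsPointDerivation p (pointDerivation D p) :=
  ⟨fun f g => by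
    change D (f * g) p = _
    rw [Derivation.leibniz]
    rfl⟩

/-- Local coordinates on a subset `S` of a manifold: smooth functions `coord`, and a smooth
parametrization `param` of the points at which the cutoff function `bump` is not zero. -/
structure ParamChart (J : ModelWithCorners ℝ F H) (S : Set X) (ι : Type) [Fintype ι] where
  /-- The coordinates. -/
  coord : ι → SmoothFun J S
  /-- A function whose support is in the coordinate neighbourhood. -/
  bump : SmoothFun J S
  /-- The image of the coordinates. -/
  target : Set (ι → ℝ)
  isOpen_target : IsOpen target
  /-- The point with given coordinates. -/
  param : (ι → ℝ) → S
  coord_param : ∀ o ∈ target, ∀ l, coord l (param o) = o l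
  mem_target : ∀ p, bump p ≠ 0 → (fun l => coord l p) ∈ target
  param_coord : ∀ p, bump p ≠ 0 → param (fun l => coord l p) = p
  contDiffOn_comp_param : ∀ h : SmoothFun J S, ContDiffOn ℝ ∞ (fun o => h (param o)) target

namespace ParamChart

variable {ι : Type} [Fintype ι] (Φ : ParamChart J S ι)

theorem exists_cutoff {o : ι → ℝ} (ho : o ∈ Φ.target) : ∃ η ρ : (ι → ℝ) → ℝ, ContDiff ℝ ∞ η ∧
    ContDiff ℝ ∞ ρ ∧ (∀ᶠ o' in 𝓝 o, η o' = 1) ∧ ρ o ≠ 0 ∧ (∀ o', ρ o' ≠ 0 → η o' = 1) ∧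
    ∀ f : (ι → ℝ) → ℝ, ContDiffOn ℝ ∞ f Φ.target → ContDiff ℝ ∞ fun o' => η o' * f o' := by
  obtain ⟨η, hs, h1⟩ := EllipticDivisor.exists_cutoff (E := ι → ℝ) Φ.isOpen_target ho
  obtain ⟨V, hV, hVo, hoV⟩ := mem_nhds_iff.1 h1
  obtain ⟨ρ, hρs, hρ1⟩ := EllipticDivisor.exists_cutoff (E := ι → ℝ) hVo hoV
  refine ⟨η, ρ, contMDiff_iff_contDiff.1 η.contMDiff, contMDiff_iff_contDiff.1 ρ.contMDiff, h1,
    by rw [hρ1.self_of_nhds]; exact one_ne_zero, fun o' ho' => ?_, fun f hf => ?_⟩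
  · by_contra h
    exact ho' (image_eq_zero_of_notMem_tsupport fun h' => h (hV (hρs h')))
  · exact contMDiff_iff_contDiff.1
      (contMDiff_cutoff_mul Φ.isOpen_target η.contMDiff hs (contMDiffOn_iff_contDiffOn.2 hf))

/-- On Θ ≠ 0 every smooth h equals the function η · (h ∘ param) of the coordinates, which is smooth
on the whole coordinate space; the chain rule for derivations then applies. -/
theorem exists_eq_comp {p : S} (hp : Φ.bump p ≠ 0) :
    ∃ (Θ : SmoothFun J S) (η : (ι → ℝ) → ℝ), ContDiff ℝ ∞ η ∧
      (∀ᶠ o in 𝓝 (fun l => Φ.coord l p), η o = 1) ∧ Θ p ≠ 0 ∧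
      (∀ p', Θ p' ≠ 0 → Φ.bump p' ≠ 0 ∧ η (fun l => Φ.coord l p') = 1) ∧
      ∀ f : (ι → ℝ) → ℝ, ContDiffOn ℝ ∞ f Φ.target → ContDiff ℝ ∞ fun o' => η o' * f o' := by
  obtain ⟨η, ρ, hη, hρ, hη1, hρ0, hρη, hηs⟩ := Φ.exists_cutoff (Φ.mem_target p hp)
  refine ⟨Φ.bump * SmoothFun.comp hρ Φ.coord, η, hη, hη1, mul_ne_zero hp hρ0, fun p' hp' => ?_, hηs⟩
  exact ⟨left_ne_zero_of_mul hp', hρη _ (right_ne_zero_of_mul hp')⟩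

/-- A tangent vector is determined by the derivatives of the coordinates. -/
theorem pointDerivation_eq [DecidableEq ι] {p : S} (hp : Φ.bump p ≠ 0)
    {v : SmoothFun J S →ₗ[ℝ] ℝ} (hv : IsPointDerivation p v) (h : SmoothFun J S) :
    v h = fderiv ℝ (fun o => h (Φ.param o)) (fun l => Φ.coord l p) fun l => v (Φ.coord l) := by
  obtain ⟨Θ, η, hη, hη1, hΘ, hΘη, hηs⟩ := Φ.exists_eq_comp hp
  have h1 := hηs _ (Φ.contDiffOn_comp_param h)
  have h2 : v h = v (SmoothFun.comp h1 Φ.coord) := by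
    refine hv.congr hΘ fun p' hp' => ?_
    rw [SmoothFun.comp_apply, (hΘη p' hp').2, one_mul, Φ.param_coord p' (hΘη p' hp').1]
  rw [h2, hv.comp_eq h1]
  congr 1
  refine Filter.EventuallyEq.fderiv_eq ?_
  filter_upwards [hη1] with o ho
  rw [ho, one_mul]

theorem pointDerivation_ext [DecidableEq ι] {p : S} (hp : Φ.bump p ≠ 0)
    {v v' : SmoothFun J S →ₗ[ℝ] ℝ} (hv : IsPointDerivation p v) (hv' : IsPointDerivation p v')
    (h : ∀ l, v (Φ.coord l) = v' (Φ.coord l)) : v = v' := by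
  ext f
  rw [Φ.pointDerivation_eq hp hv, Φ.pointDerivation_eq hp hv']
  simp only [h]

theorem exists_pointDerivation {p : S} (hp : Φ.bump p ≠ 0) (c : ι → ℝ) :
    ∃ v : SmoothFun J S →ₗ[ℝ] ℝ, IsPointDerivation p v ∧ ∀ h,
      v h = fderiv ℝ (fun o => h (Φ.param o)) (fun l => Φ.coord l p) c := by
  have hd : ∀ h : SmoothFun J S,
      DifferentiableAt ℝ (fun o => h (Φ.param o)) (fun l => Φ.coord l p) := fun h =>
    ((Φ.contDiffOn_comp_param h).contDiffAt (Φ.isOpen_target.mem_nhds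
      (Φ.mem_target p hp))).differentiableAt (by simp)
  refine ⟨{ toFun := fun h => fderiv ℝ (fun o => h (Φ.param o)) (fun l => Φ.coord l p) c
            map_add' := fun f g => ?_
            map_smul' := fun r f => ?_ }, ⟨fun f g => ?_⟩, fun h => rfl⟩
  · have h1 : (fun o => (f + g) (Φ.param o)) =
      (fun o => f (Φ.param o)) + fun o => g (Φ.param o) := rfl
    rw [h1, fderiv_add (hd f) (hd g)]
    rfl
  · have h1 : (fun o => (r • f) (Φ.param o)) = r • (fun o => f (Φ.param o)) := rfl
    rw [h1, fderiv_const_smul_field]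
    rfl
  · have h1 : (fun o => (f * g) (Φ.param o)) =
      (fun o => f (Φ.param o)) * fun o => g (Φ.param o) := rfl
    change fderiv ℝ (fun o => (f * g) (Φ.param o)) _ c = _
    rw [h1, fderiv_mul (hd f) (hd g), Φ.param_coord p hp]
    rfl

theorem apply_coord_eq [DecidableEq ι] {p : S} (hp : Φ.bump p ≠ 0) (c : ι → ℝ) (l : ι) :
    fderiv ℝ (fun o => Φ.coord l (Φ.param o)) (fun l => Φ.coord l p) c = c l := by
  have h1 : (fun o => Φ.coord l (Φ.param o)) =ᶠ[𝓝 fun l => Φ.coord l p] fun o => o l := by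
    filter_upwards [Φ.isOpen_target.mem_nhds (Φ.mem_target p hp)] with o ho
    exact Φ.coord_param o ho l
  rw [h1.fderiv_eq, (hasFDerivAt_coord l _).fderiv]
  rfl

/-- A family of tangent vectors is smooth near a point if its values on the coordinates are. -/
theorem exists_eq_of_coord [DecidableEq ι] {p : S} (hp : Φ.bump p ≠ 0)
    {v : S → SmoothFun J S →ₗ[ℝ] ℝ} (hv : ∀ p, IsPointDerivation p (v p)) (c : ι → SmoothFun J S)
    (hc : ∀ p l, v p (Φ.coord l) = c l p) (h : SmoothFun J S) :
    ∃ Θ g : SmoothFun J S, Θ p ≠ 0 ∧ ∀ p', Θ p' ≠ 0 → v p' h = g p' := by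
  obtain ⟨Θ, η, hη, hη1, hΘ, hΘη, hηs⟩ := Φ.exists_eq_comp hp
  have h1 : ContDiffOn ℝ ∞ (fderiv ℝ fun o => h (Φ.param o)) Φ.target :=
    (Φ.contDiffOn_comp_param h).fderiv_of_isOpen Φ.isOpen_target (by simp)
  have h2 : ∀ l, ContDiff ℝ ∞ fun o =>
      η o * fderiv ℝ (fun o => h (Φ.param o)) o (Pi.single l 1) := fun l =>
    hηs _ (h1.clm_apply contDiffOn_const)
  refine ⟨Θ, ∑ l, c l * SmoothFun.comp (h2 l) Φ.coord, hΘ, fun p' hp' => ?_⟩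
  rw [Φ.pointDerivation_eq (hΘη p' hp').1 (hv p'), SmoothFun.sum_apply]
  have h5 : (fun l => v p' (Φ.coord l)) = ∑ l, c l p' • Pi.single l (1 : ℝ) := by
    funext l
    simp [Finset.sum_apply, Pi.single_apply, hc]
  rw [h5, map_sum]
  refine Finset.sum_congr rfl fun l _ => ?_
  rw [map_smul, smul_eq_mul, SmoothFun.mul_apply, SmoothFun.comp_apply, (hΘη p' hp').2, one_mul]

end ParamChart

end SmoothFunctions

/-! ### Coordinates on the reduction -/

section FrameChart

variable {E : Type*} [NormedAddCommGroup E] [NormedSpace ℝ E]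
  {M : Type*} [TopologicalSpace M] [ChartedSpace E M]
  {R : M → Type*} [TopologicalSpace (TotalSpace ℝ R)]
  [∀ x, AddCommGroup (R x)] [∀ x, Module ℝ (R x)] [∀ x, TopologicalSpace (R x)]
  [FiberBundle ℝ R]
variable [FiniteDimensional ℝ E] [T2Space M] [IsManifold 𝓘(ℝ, E) ∞ M] {q : ∀ x, R x} {n : ℕ}

/-- The derivative of a function that vanishes on the stratum, as a smooth function on the
reduction. -/
def frameFun (k : C^∞⟮𝓘(ℝ, E), M; 𝓘(ℝ, ℝ), ℝ⟯) (hk : ∀ y ∈ stratum E q n, k y = 0)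
    (m : NormalModel n) : SmoothFun (homModel E n) (reduction E q n) :=
  ⟨frameDeriv k m, frameDeriv_mem hk m⟩

/-- The pullback to the reduction of a function on the manifold. -/
def baseFun (q : ∀ x, R x) (n : ℕ) (f : C^∞⟮𝓘(ℝ, E), M; 𝓘(ℝ, ℝ), ℝ⟯) :
    SmoothFun (homModel E n) (reduction E q n) :=
  projPullback E q n (restrict E (stratum E q n) f)

theorem baseFun_apply (f : C^∞⟮𝓘(ℝ, E), M; 𝓘(ℝ, ℝ), ℝ⟯) (p : reduction E q n) :
    baseFun q n f p = f p.1.1 := rfl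

/-- The standard basis of `(ℝ²)^n`. -/
def basisVector (l : Fin n × Fin 2) : NormalModel n :=
  Pi.single l.1 (EuclideanSpace.single l.2 1)

theorem conformal_basisVector (γ : Fin n × Fin 2 → ℝ) (l : Fin n × Fin 2) :
    conformal γ (basisVector (l.1, 0)) l.1 l.2 = γ l := by
  obtain ⟨i, a⟩ := l
  fin_cases a
  · simp [conformal_apply_zero, basisVector]
  · simp [conformal_apply_one, basisVector]

namespace AdaptedChart

variable (C : AdaptedChart E q n)

/-- A vector v with θ v = m has normal coordinates g m. The matrix entries of g are thus smooth
functions on the reduction, and they serve as coordinates. -/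
theorem frameDeriv_coord {p : reduction E q n} {g : NormalModel n → NormalModel n}
    (hg : ∀ v, C.normalDiff p.1.1 v = g (p.1.2 v)) (m : NormalModel n) (l : Fin n × Fin 2) :
    frameDeriv (C.coord (Sum.inl l)) m p = g m l.1 l.2 := by
  obtain ⟨v, hv⟩ := p.2.2.1 m
  rw [frameDeriv_eq (fun y hy => C.coord_eq_zero y hy l) hv, ← hv]
  have h1 := C.normalDiff_apply p.1.1 v l.1 l.2
  rw [hg] at h1
  exact h1.symm

/-- The projection to the coordinates of the stratum. -/
def dropNormal : ((Fin n × Fin 2) ⊕ Fin C.dim → ℝ) →L[ℝ] (Fin n × Fin 2) ⊕ Fin C.dim → ℝ :=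
  ContinuousLinearMap.pi (Sum.elim 0 fun l => ContinuousLinearMap.proj (Sum.inr l))

/-- The coordinates of the frames. -/
def frameTarget : Set ((Fin n × Fin 2) ⊕ Fin C.dim → ℝ) :=
  {o | C.dropNormal o ∈ C.target ∧ ∀ i, o (Sum.inl (i, 0)) ^ 2 + o (Sum.inl (i, 1)) ^ 2 ≠ 0}

theorem isOpen_frameTarget : IsOpen C.frameTarget := by
  have h1 : {o : (Fin n × Fin 2) ⊕ Fin C.dim → ℝ |
      ∀ i, o (Sum.inl (i, 0)) ^ 2 + o (Sum.inl (i, 1)) ^ 2 ≠ 0} =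
      ⋂ i, {o | o (Sum.inl (i, 0)) ^ 2 + o (Sum.inl (i, 1)) ^ 2 ≠ 0} := by
    ext; simp
  have h2 : IsOpen {o : (Fin n × Fin 2) ⊕ Fin C.dim → ℝ |
      ∀ i, o (Sum.inl (i, 0)) ^ 2 + o (Sum.inl (i, 1)) ^ 2 ≠ 0} := by
    rw [h1]
    exact isOpen_iInter_of_finite fun i => isOpen_ne_fun (by fun_prop) continuous_const
  exact (C.isOpen_target.preimage C.dropNormal.continuous).inter h2

theorem inv_dropNormal_mem_stratum (hq : IsElliptic E q) {o : (Fin n × Fin 2) ⊕ Fin C.dim → ℝ}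
    (ho : C.dropNormal o ∈ C.target) : C.inv (C.dropNormal o) ∈ stratum E q n :=
  C.mem_stratum hq (C.mem_source _ ho) fun _ => C.right_inv _ ho _

open Classical in
/-- The frame with given coordinates. -/
def frameParam (hq : IsElliptic E q) (g₀ : structureGroup n) (b : reduction E q n)
    (o : (Fin n × Fin 2) ⊕ Fin C.dim → ℝ) : reduction E q n :=
  if ho : o ∈ C.frameTarget then
    act E q (conformalEquiv (fun l => o (Sum.inl l)) ho.2 * g₀)
      (C.frame hq (C.mem_source _ ho.1) (C.inv_dropNormal_mem_stratum hq ho.1))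
  -- Default value for coordinates that belong to no frame.
  else b

/-- The frame with given coordinates, as an element of the vector bundle that contains the
reduction. -/
def frameParamHom (g₀ : structureGroup n) (o : (Fin n × Fin 2) ⊕ Fin C.dim → ℝ) :
    HomBundle E M n :=
  ⟨C.inv (C.dropNormal o),
    ((g₀.1.symm : NormalModel n →L[ℝ] NormalModel n) ∘L
      conformal (conformalInv fun l => o (Sum.inl l))) ∘L C.normalDiff (C.inv (C.dropNormal o))⟩

theorem frameParam_coe (hq : IsElliptic E q) (g₀ : structureGroup n) (b : reduction E q n)
    {o : (Fin n × Fin 2) ⊕ Fin C.dim → ℝ} (ho : o ∈ C.frameTarget) :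
    (C.frameParam hq g₀ b o).1 = C.frameParamHom g₀ o := by
  rw [frameParam, dif_pos ho]
  rfl

/-- In a trivialisation the frame is the differential of the normal coordinates in a fixed chart,
followed by inverses of nonzero complex numbers and a constant map. -/
theorem contMDiffAt_frameParamHom (g₀ : structureGroup n)
    {o : (Fin n × Fin 2) ⊕ Fin C.dim → ℝ} (ho : o ∈ C.frameTarget) :
    ContMDiffAt 𝓘(ℝ, (Fin n × Fin 2) ⊕ Fin C.dim → ℝ) (homModel E n) ∞ (C.frameParamHom g₀) o := by
  have h1 : ContMDiffAt 𝓘(ℝ, (Fin n × Fin 2) ⊕ Fin C.dim → ℝ) 𝓘(ℝ, E) ∞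
      (fun o => C.inv (C.dropNormal o)) o :=
    (C.contMDiffOn_inv.contMDiffAt (C.isOpen_target.mem_nhds ho.1)).comp o
      C.dropNormal.contMDiff.contMDiffAt
  refine (contMDiffAt_hom_bundle _).2 ⟨h1, ?_⟩
  let x₀ := C.inv (C.dropNormal o)
  have hx₀ : x₀ ∈ (chartAt E x₀).source := mem_chart_source E x₀
  have hcd : ContMDiffAt 𝓘(ℝ, E) 𝓘(ℝ, E →L[ℝ] NormalModel n) ∞
      (chartDifferential (E := E) C.normal x₀) x₀ :=
    (contMDiffOn_chartDifferential C.contMDiff_normal x₀).contMDiffAt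
      ((chartAt E x₀).open_source.mem_nhds hx₀)
  have h2 : ContMDiffAt 𝓘(ℝ, (Fin n × Fin 2) ⊕ Fin C.dim → ℝ) 𝓘(ℝ, E →L[ℝ] NormalModel n) ∞
      (fun o => chartDifferential (E := E) C.normal x₀ (C.inv (C.dropNormal o))) o :=
    ContMDiffAt.comp (g := chartDifferential (E := E) C.normal x₀) o hcd h1
  have h3 : ContDiffAt ℝ ∞ (fun o : (Fin n × Fin 2) ⊕ Fin C.dim → ℝ =>
      conformalInv (n := n) fun l => o (Sum.inl l)) o := by
    refine contDiffAt_pi.2 fun l => ?_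
    unfold conformalInv
    refine ContDiffAt.div ?_ (by fun_prop) (ho.2 l.1)
    by_cases hl : l.2 = 0
    · simp only [hl, ite_true]; fun_prop
    · simp only [hl, ite_false]; fun_prop
  have h4 : ContDiffAt ℝ ∞ (fun o : (Fin n × Fin 2) ⊕ Fin C.dim → ℝ =>
      (g₀.1.symm : NormalModel n →L[ℝ] NormalModel n) ∘L
        conformal (conformalInv fun l => o (Sum.inl l))) o :=
    contDiffAt_const.clm_comp (contDiff_conformal.contDiffAt.comp o h3)
  refine (h4.contMDiffAt.clm_comp h2).congr_of_eventuallyEq ?_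
  filter_upwards [h1.continuousAt.preimage_mem_nhds
    ((chartAt E x₀).open_source.mem_nhds hx₀)] with o' ho'
  ext1 e
  have h5 := chartDifferential_eq C.contMDiff_normal (show C.inv (C.dropNormal o') ∈ _ from ho') e
  change ContinuousLinearMap.inCoordinates E (fun x : M => TangentSpace 𝓘(ℝ, E) x)
      (NormalModel n) (Bundle.Trivial M (NormalModel n)) x₀ _ x₀ _ (C.frameParamHom g₀ o').2 e = _
  rw [ContinuousLinearMap.comp_apply, h5]
  simp [ContinuousLinearMap.inCoordinates]
  rfl

theorem contDiffOn_comp_frameParam (hq : IsElliptic E q) (g₀ : structureGroup n)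
    (b : reduction E q n) (h : SmoothFun (homModel E n) (reduction E q n)) :
    ContDiffOn ℝ ∞ (fun o => h (C.frameParam hq g₀ b o)) C.frameTarget := by
  intro o ho
  refine ContDiffAt.contDiffWithinAt ?_
  obtain ⟨U, hU, hpU, k, hk, hhk⟩ := h.2 (C.frameParam hq g₀ b o)
  rw [C.frameParam_coe hq g₀ b ho] at hpU
  have h1 := C.contMDiffAt_frameParamHom g₀ ho
  have h2 : ContMDiffAt 𝓘(ℝ, (Fin n × Fin 2) ⊕ Fin C.dim → ℝ) 𝓘(ℝ, ℝ) ∞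
      (k ∘ C.frameParamHom g₀) o := (hk.contMDiffAt (hU.mem_nhds hpU)).comp o h1
  refine (contMDiffAt_iff_contDiffAt.1 h2).congr_of_eventuallyEq ?_
  filter_upwards [h1.continuousAt.preimage_mem_nhds (hU.mem_nhds hpU),
    C.isOpen_frameTarget.mem_nhds ho] with o' ho' hoT
  refine (hhk _ ?_).trans ?_
  · rw [C.frameParam_coe hq g₀ b hoT]
    exact ho'
  · rw [C.frameParam_coe hq g₀ b hoT]
    rfl

theorem normalDiff_act_frame (hq : IsElliptic E q) (g : structureGroup n) {x : M}
    (hx : x ∈ C.source) (hxs : x ∈ stratum E q n) (v : TangentSpace 𝓘(ℝ, E) x) :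
    C.normalDiff x v = g.1 ((act E q g (C.frame hq hx hxs)).1.2 v) :=
  (g.1.apply_symm_apply (C.normalDiff x v)).symm

theorem eq_act_frame (hq : IsElliptic E q) (g : structureGroup n) (p : reduction E q n)
    (hp : p.1.1 ∈ C.source) (hg : ∀ v, C.normalDiff p.1.1 v = g.1 (p.1.2 v)) :
    p = act E q g (C.frame hq hp p.2.1) := by
  refine Subtype.ext ?_
  have h1 : p.1.2 = (act E q g (C.frame hq hp p.2.1)).1.2 := by
    ext1 v
    exact (ContinuousLinearEquiv.symm_apply_eq g.1).2 (hg v) |>.symm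
  obtain ⟨⟨x, θ⟩, hp'⟩ := p
  exact congrArg (fun θ => (⟨x, θ⟩ : HomBundle E M n)) h1

/-- The functions that detect frames close to a given one. -/
def frameEntry (g₀ : structureGroup n) (l : Fin n × Fin 2) :
    SmoothFun (homModel E n) (reduction E q n) :=
  frameFun (C.coord (Sum.inl l)) (fun y hy => C.coord_eq_zero y hy l) (g₀.1.symm (basisVector l))

/-- The coordinates of a frame. -/
def frameCoord (g₀ : structureGroup n) :
    (Fin n × Fin 2) ⊕ Fin C.dim → SmoothFun (homModel E n) (reduction E q n) :=
  Sum.elim (fun l => frameFun (C.coord (Sum.inl l)) (fun y hy => C.coord_eq_zero y hy l)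
    (g₀.1.symm (basisVector (l.1, 0)))) fun l => baseFun q n (C.coord (Sum.inr l))

theorem contDiff_prod_smoothTransition :
    ContDiff ℝ ∞ fun y : Fin n × Fin 2 → ℝ => ∏ l, Real.smoothTransition (y l) :=
  contDiff_prod fun l _ => Real.smoothTransition.contDiff.comp (contDiff_apply ℝ ℝ l)

/-- A function on the reduction whose support lies in the domain of the frame coordinates. -/
def frameBump (χ : C^∞⟮𝓘(ℝ, E), M; 𝓘(ℝ, ℝ), ℝ⟯) (g₀ : structureGroup n) :
    SmoothFun (homModel E n) (reduction E q n) :=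
  baseFun q n χ * SmoothFun.comp contDiff_prod_smoothTransition (C.frameEntry g₀)

theorem frameBump_ne_zero_iff (χ : C^∞⟮𝓘(ℝ, E), M; 𝓘(ℝ, ℝ), ℝ⟯) (g₀ : structureGroup n)
    (p : reduction E q n) :
    C.frameBump χ g₀ p ≠ 0 ↔ χ p.1.1 ≠ 0 ∧ ∀ l, 0 < C.frameEntry g₀ l p := by
  rw [frameBump, SmoothFun.mul_apply, mul_ne_zero_iff, baseFun_apply, SmoothFun.comp_apply,
    Finset.prod_ne_zero_iff]
  refine and_congr_right fun _ => ⟨fun h l => ?_, fun h l _ => ?_⟩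
  · by_contra! hl
    exact h l (Finset.mem_univ l) (Real.smoothTransition.zero_of_nonpos hl)
  · exact (Real.smoothTransition.pos_of_pos (h l)).ne'

/-- The bump function is nonzero only if all diagonal entries of g g₀⁻¹ are positive. This excludes
permutations and reflections, so g g₀⁻¹ multiplies by n complex numbers, which are read off from the
images of the first basis vectors. -/
theorem exists_conformal_of_frameBump_ne_zero (hq : IsElliptic E q)
    {χ : C^∞⟮𝓘(ℝ, E), M; 𝓘(ℝ, ℝ), ℝ⟯} (hχ : tsupport χ ⊆ C.source) (g₀ : structureGroup n)
    {p : reduction E q n} (hp : C.frameBump χ g₀ p ≠ 0) :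
    p.1.1 ∈ C.source ∧ (∀ i, C.frameCoord g₀ (Sum.inl (i, 0)) p ^ 2 +
      C.frameCoord g₀ (Sum.inl (i, 1)) p ^ 2 ≠ 0) ∧
      ∀ v, C.normalDiff p.1.1 v =
        conformal (fun l => C.frameCoord g₀ (Sum.inl l) p) (g₀.1 (p.1.2 v)) := by
  obtain ⟨h1, h2⟩ := (C.frameBump_ne_zero_iff χ g₀ p).1 hp
  have hps : p.1.1 ∈ C.source := by
    by_contra h
    exact h1 (image_eq_zero_of_notMem_tsupport fun h' => h (hχ h'))
  obtain ⟨g, hg⟩ := C.exists_structureGroup hq p hps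
  have h3 : ∀ l, C.frameEntry g₀ l p = (g * g₀⁻¹).1 (basisVector l) l.1 l.2 := fun l =>
    C.frameDeriv_coord (g := g.1) hg _ l
  have h4 : ∀ l, C.frameCoord g₀ (Sum.inl l) p = (g * g₀⁻¹).1 (basisVector (l.1, 0)) l.1 l.2 :=
    fun l => C.frameDeriv_coord (g := g.1) hg _ l
  have h5 := structureGroup_eq_conformal (g * g₀⁻¹) (fun i => by
    have := h2 (i, 0)
    rwa [h3] at this) (fun i => by
    have := h2 (i, 1)
    rwa [h3] at this)
  refine ⟨hps, fun i => ?_, fun v => ?_⟩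
  · have h6 : 0 < C.frameCoord g₀ (Sum.inl (i, 0)) p := h2 (i, 0)
    positivity
  · rw [hg]
    have h6 := h5 (g₀.1 (p.1.2 v))
    have h7 : (g * g₀⁻¹).1 (g₀.1 (p.1.2 v)) = g.1 (p.1.2 v) :=
      congrArg g.1 (g₀.1.symm_apply_apply _)
    rw [h7] at h6
    refine h6.trans ?_
    congr 1
    refine congrArg conformal (funext fun l => (h4 l).symm)

theorem dropNormal_frameCoord (g₀ : structureGroup n) (p : reduction E q n) :
    C.dropNormal (fun l => C.frameCoord g₀ l p) = C.coords p.1.1 := by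
  funext l
  obtain l | l := l
  · exact (C.coord_eq_zero _ p.2.1 l).symm
  · rfl

/-- The coordinates of frames near a given one. -/
def frameChart (hq : IsElliptic E q) {χ : C^∞⟮𝓘(ℝ, E), M; 𝓘(ℝ, ℝ), ℝ⟯}
    (hχ : tsupport χ ⊆ C.source) (g₀ : structureGroup n) (b : reduction E q n) :
    ParamChart (homModel E n) (reduction E q n) ((Fin n × Fin 2) ⊕ Fin C.dim) where
  coord := C.frameCoord g₀
  bump := C.frameBump χ g₀
  target := C.frameTarget
  isOpen_target := C.isOpen_frameTarget
  param := C.frameParam hq g₀ b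
  coord_param := by
    intro o ho l
    rw [frameParam, dif_pos ho]
    obtain l | l := l
    · refine (C.frameDeriv_coord (g := (conformalEquiv (fun l => o (Sum.inl l)) ho.2 * g₀).1)
        (fun v => C.normalDiff_act_frame hq _ (C.mem_source _ ho.1)
          (C.inv_dropNormal_mem_stratum hq ho.1) v) _ l).trans ?_
      have h1 : (conformalEquiv (fun l => o (Sum.inl l)) ho.2 * g₀).1
          (g₀.1.symm (basisVector (l.1, 0))) =
          conformal (fun l => o (Sum.inl l)) (basisVector (l.1, 0)) :=
        congrArg (conformal fun l => o (Sum.inl l)) (g₀.1.apply_symm_apply _)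
      rw [h1, conformal_basisVector]
    · exact C.right_inv _ ho.1 (Sum.inr l)
  mem_target := by
    intro p hp
    obtain ⟨h1, h2, -⟩ := C.exists_conformal_of_frameBump_ne_zero hq hχ g₀ hp
    refine ⟨?_, h2⟩
    have h3 : C.dropNormal (fun l => C.frameCoord g₀ l p) = C.coords p.1.1 :=
      C.dropNormal_frameCoord g₀ p
    rw [h3]
    exact C.mem_target _ h1
  param_coord := by
    intro p hp
    obtain ⟨h1, h2, h3⟩ := C.exists_conformal_of_frameBump_ne_zero hq hχ g₀ hp
    have h4 : C.dropNormal (fun l => C.frameCoord g₀ l p) = C.coords p.1.1 :=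
      C.dropNormal_frameCoord g₀ p
    have ht : (fun l => C.frameCoord g₀ l p) ∈ C.frameTarget :=
      ⟨by rw [h4]; exact C.mem_target _ h1, h2⟩
    have h5 : C.inv (C.dropNormal (fun l => C.frameCoord g₀ l p)) = p.1.1 := by
      rw [h4]
      exact C.left_inv _ h1
    rw [frameParam, dif_pos ht]
    have h6 := C.eq_act_frame hq (conformalEquiv (fun l => C.frameCoord g₀ (Sum.inl l) p) h2 * g₀)
      p h1 h3
    refine Eq.trans ?_ h6.symm
    congr 2
  contDiffOn_comp_param := C.contDiffOn_comp_frameParam hq g₀ b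

end AdaptedChart

end FrameChart

/-! ### Lifting sections of the elliptic tangent bundle to the reduction -/

section Lift

variable {E : Type*} [NormedAddCommGroup E] [NormedSpace ℝ E]
  {M : Type*} [TopologicalSpace M] [ChartedSpace E M]
  {R : M → Type*} [TopologicalSpace (TotalSpace ℝ R)]
  [∀ x, AddCommGroup (R x)] [∀ x, Module ℝ (R x)] [∀ x, TopologicalSpace (R x)]
  [FiberBundle ℝ R]
variable [FiniteDimensional ℝ E] [T2Space M] [IsManifold 𝓘(ℝ, E) ∞ M] {q : ∀ x, R x} {n : ℕ}

/-- In the product rule the terms with a derivative of κ_l carry the factor u_l, which vanishes on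
the stratum. -/
theorem frameDeriv_eq_sum {ι : Type} [Fintype ι] {k : C^∞⟮𝓘(ℝ, E), M; 𝓘(ℝ, ℝ), ℝ⟯}
    (hk : ∀ y ∈ stratum E q n, k y = 0) {u κ : ι → C^∞⟮𝓘(ℝ, E), M; 𝓘(ℝ, ℝ), ℝ⟯}
    (hu : ∀ l, ∀ y ∈ stratum E q n, u l y = 0) {p : reduction E q n}
    (h : ∀ᶠ y in 𝓝 p.1.1, k y = ∑ l, κ l y * u l y) (m : NormalModel n) :
    frameDeriv k m p = ∑ l, κ l p.1.1 * frameDeriv (u l) m p := by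
  obtain ⟨v, hv⟩ := p.2.2.1 m
  rw [frameDeriv_eq hk hv, Finset.sum_congr rfl fun l _ => by rw [frameDeriv_eq (hu l) hv]]
  have hd : ∀ f : C^∞⟮𝓘(ℝ, E), M; 𝓘(ℝ, ℝ), ℝ⟯,
      HasDerivAt (fun t => f (chartLine v t)) (differential f p.1.1 v) 0 := fun f =>
    hasDerivAt_chartLine (f.contMDiff.contMDiffAt.mdifferentiableAt (by simp)) v
  have h1 : HasDerivAt (fun t => ∑ l, κ l (chartLine v t) * u l (chartLine v t))
      (∑ l, κ l p.1.1 * differential (u l) p.1.1 v) 0 := by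
    refine HasDerivAt.fun_sum fun l _ => ?_
    have h2 := (hd (κ l)).mul (hd (u l))
    rw [chartLine_zero, hu l _ p.2.1, mul_zero, zero_add] at h2
    exact h2
  exact (hd k).unique (h1.congr_of_eventuallyEq ((tendsto_chartLine v).eventually h))

theorem frameDeriv_mul {k f g : C^∞⟮𝓘(ℝ, E), M; 𝓘(ℝ, ℝ), ℝ⟯}
    (hk : ∀ y ∈ stratum E q n, k y = 0) (hg : ∀ y ∈ stratum E q n, g y = 0) {p : reduction E q n}
    (h : ∀ᶠ y in 𝓝 p.1.1, k y = f y * g y) (m : NormalModel n) :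
    frameDeriv k m p = f p.1.1 * frameDeriv g m p := by
  have h1 := frameDeriv_eq_sum hk (κ := fun _ : Fin 1 => f) (u := fun _ : Fin 1 => g)
    (fun _ => hg) (by simpa using h) m
  simpa using h1

theorem frameDeriv_add {f g : C^∞⟮𝓘(ℝ, E), M; 𝓘(ℝ, ℝ), ℝ⟯}
    (hf : ∀ y ∈ stratum E q n, f y = 0) (hg : ∀ y ∈ stratum E q n, g y = 0) (p : reduction E q n)
    (m : NormalModel n) : frameDeriv (f + g) m p = frameDeriv f m p + frameDeriv g m p := by
  have h1 := frameDeriv_eq_sum (p := p) (k := f + g)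
    (fun y hy => by change f y + g y = 0; rw [hf y hy, hg y hy, add_zero])
    (κ := fun _ : Fin 2 => 1) (u := ![f, g]) (fun l => by fin_cases l; exacts [hf, hg])
    (Filter.Eventually.of_forall fun y => by simp) m
  simpa using h1

namespace AdaptedChart

variable (C : AdaptedChart E q n)

/-- Hadamard's lemma in adapted coordinates: the stratum is where the normal coordinates vanish. -/
theorem exists_eq_sum_mul {k : C^∞⟮𝓘(ℝ, E), M; 𝓘(ℝ, ℝ), ℝ⟯} (hq : IsElliptic E q)
    (hk : ∀ y ∈ stratum E q n, k y = 0) {x : M} (hx : x ∈ C.source) :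
    ∃ κ : Fin n × Fin 2 → C^∞⟮𝓘(ℝ, E), M; 𝓘(ℝ, ℝ), ℝ⟯,
      ∀ᶠ y in 𝓝 x, k y = ∑ l, κ l y * C.coord (Sum.inl l) y := by
  classical
  obtain ⟨η, hη, hη0, hη1, hηs⟩ := C.exists_contDiff_eventuallyEq C.isOpen_source subset_rfl hx
  have hF := hηs k k.contMDiff.contMDiffOn
  obtain ⟨κ, hκ, hsum⟩ := exists_eq_sum_coord_mul
    (Finset.univ.map (Function.Embedding.inl : Fin n × Fin 2 ↪ (Fin n × Fin 2) ⊕ Fin C.dim)) hF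
    (by
      intro o ho
      by_cases h0 : η o = 0
      · simp [h0]
      obtain ⟨hoT, -⟩ := hη0 o h0
      rw [hk _ (C.mem_stratum hq (C.mem_source _ hoT) fun l => ?_), mul_zero]
      rw [C.right_inv _ hoT]
      exact ho _ (by simp))
  refine ⟨fun l => C.ofCoords (hκ (Sum.inl l)), ?_⟩
  filter_upwards [C.contMDiff_coords.continuous.continuousAt.eventually hη1,
    C.isOpen_source.mem_nhds hx] with y hy hys
  have h2 : C.inv (C.coords y) = y := C.left_inv y hys
  have h3 := hsum (C.coords y)
  rw [hy, one_mul, h2, Finset.sum_map] at h3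
  rw [h3]
  exact Finset.sum_congr rfl fun l _ => mul_comm _ _

end AdaptedChart

/-- X z_i = ζ_i z_i vanishes at z = 0, so X is tangent to the stratum at its points. -/
theorem apply_eq_zero_of_mem_stratum (hq : IsElliptic E q) (X : ellipticFields E q)
    {k : C^∞⟮𝓘(ℝ, E), M; 𝓘(ℝ, ℝ), ℝ⟯} (hk : ∀ y ∈ stratum E q n, k y = 0) {x : M}
    (hx : x ∈ stratum E q n) : X.1 k x = 0 := by
  obtain ⟨C, hxC⟩ := exists_adaptedChart hq hx
  obtain ⟨κ, hκ⟩ := C.exists_eq_sum_mul hq hk hxC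
  obtain ⟨a, b, hab⟩ := C.exists_conformal X hxC
  have hX : ∀ l, X.1 (C.coord (Sum.inl l)) x = 0 := by
    rintro ⟨i, c⟩
    have h1 := hab.self_of_nhds i
    rw [C.coord_eq_zero x hx, C.coord_eq_zero x hx] at h1
    fin_cases c
    · refine h1.1.trans ?_; ring
    · refine h1.2.trans ?_; ring
  obtain ⟨v, hv⟩ := C.exists_differential_eq hxC fun l => X.1 (C.coord l) x
  have h2 : v ∈ tangentTo (stratum E q n) x :=
    (C.mem_tangentTo_stratum hq hxC hx v).2 fun l => by rw [hv, hX]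
  have h3 := differential_eq_zero_of_mem_tangentTo h2 isOpen_univ trivial
    k.contMDiff.contMDiffOn fun y hy => hk y hy.2
  rw [C.differential_eq hxC k.contMDiff.contMDiffAt] at h3
  simp only [hv] at h3
  rw [C.derivation_apply X.1 k hxC, h3]

/-- The tangent vector `v` of the reduction at `p` is the value of the natural lift of the vector
field `X`. -/
structure IsLift (X : ellipticFields E q) (p : reduction E q n)
    (v : SmoothFun (homModel E n) (reduction E q n) →ₗ[ℝ] ℝ) : Prop where
  derivation : IsPointDerivation p v
  base : ∀ f, v (baseFun q n f) = X.1 f p.1.1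
  frame : ∀ (k : C^∞⟮𝓘(ℝ, E), M; 𝓘(ℝ, ℝ), ℝ⟯) (hk : ∀ y ∈ stratum E q n, k y = 0)
    (m : NormalModel n), v (frameFun k hk m) = frameDeriv (X.1 k) m p

/-- Functions that agree over a neighbourhood of a point have the same derivatives at the frames
at this point. -/
theorem IsPointDerivation.congr_base {p : reduction E q n}
    {v : SmoothFun (homModel E n) (reduction E q n) →ₗ[ℝ] ℝ} (hv : IsPointDerivation p v)
    {f g : SmoothFun (homModel E n) (reduction E q n)} {U : Set M} (hU : U ∈ 𝓝 p.1.1)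
    (h : ∀ p' : reduction E q n, p'.1.1 ∈ U → f p' = g p') : v f = v g := by
  obtain ⟨V, hV, hVo, hpV⟩ := mem_nhds_iff.1 hU
  obtain ⟨χ, hs, h1⟩ := exists_cutoff (E := E) hVo hpV
  refine hv.congr (Θ := baseFun q n χ) ?_ fun p' hp' => h p' (hV ?_)
  · rw [baseFun_apply, h1.self_of_nhds]
    exact one_ne_zero
  · by_contra hn
    exact hp' (image_eq_zero_of_notMem_tsupport (f := χ) fun h' => hn (hs h'))

/-- When g₀ is the transition element of p itself, all entries that must be positive equal 1. -/
theorem AdaptedChart.frameBump_self (C : AdaptedChart E q n) {χ : C^∞⟮𝓘(ℝ, E), M; 𝓘(ℝ, ℝ), ℝ⟯}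
    {g₀ : structureGroup n} {p : reduction E q n} (hχ : χ p.1.1 ≠ 0)
    (hg : ∀ v, C.normalDiff p.1.1 v = g₀.1 (p.1.2 v)) : C.frameBump χ g₀ p ≠ 0 := by
  refine (C.frameBump_ne_zero_iff χ g₀ p).2 ⟨hχ, fun l => ?_⟩
  have h1 : C.frameEntry g₀ l p = g₀.1 (g₀.1.symm (basisVector l)) l.1 l.2 :=
    C.frameDeriv_coord (g := g₀.1) hg _ l
  rw [h1, g₀.1.apply_symm_apply]
  simp [basisVector]

theorem exists_frameChart (hq : IsElliptic E q) (p : reduction E q n) :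
    ∃ (C : AdaptedChart E q n) (χ : C^∞⟮𝓘(ℝ, E), M; 𝓘(ℝ, ℝ), ℝ⟯) (_ : tsupport χ ⊆ C.source)
      (g₀ : structureGroup n), p.1.1 ∈ C.source ∧
      (∀ v, C.normalDiff p.1.1 v = g₀.1 (p.1.2 v)) ∧ C.frameBump χ g₀ p ≠ 0 := by
  obtain ⟨C, hpC⟩ := exists_adaptedChart hq p.2.1
  obtain ⟨χ, hs, h1⟩ := exists_cutoff (E := E) C.isOpen_source hpC
  obtain ⟨g₀, hg⟩ := C.exists_structureGroup hq p hpC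
  refine ⟨C, χ, hs, g₀, hpC, hg, C.frameBump_self ?_ hg⟩
  rw [h1.self_of_nhds]
  exact one_ne_zero

/-- The frame coordinates are all of the two kinds of functions on which a lift is prescribed. -/
theorem IsLift.unique (hq : IsElliptic E q) {X : ellipticFields E q} {p : reduction E q n}
    {v v' : SmoothFun (homModel E n) (reduction E q n) →ₗ[ℝ] ℝ} (hv : IsLift X p v)
    (hv' : IsLift X p v') : v = v' := by
  obtain ⟨C, χ, hχ, g₀, -, -, hp⟩ := exists_frameChart hq p
  refine (C.frameChart hq hχ g₀ p).pointDerivation_ext hp hv.derivation hv'.derivation fun l => ?_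
  obtain l | l := l
  · have h0 : ∀ y ∈ stratum E q n, C.coord (Sum.inl l) y = 0 := fun y hy => C.coord_eq_zero y hy l
    exact (hv.frame _ h0 _).trans (hv'.frame _ h0 _).symm
  · exact (hv.base _).trans (hv'.base _).symm

theorem AdaptedChart.frameDeriv_apply_coord (C : AdaptedChart E q n) (hq : IsElliptic E q)
    (X : ellipticFields E q) {p : reduction E q n}
    {a b : Fin n → C^∞⟮𝓘(ℝ, E), M; 𝓘(ℝ, ℝ), ℝ⟯} (hab : ∀ᶠ y in 𝓝 p.1.1, ∀ i,
      X.1 (C.coord (Sum.inl (i, 0))) y =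
        a i y * C.coord (Sum.inl (i, 0)) y - b i y * C.coord (Sum.inl (i, 1)) y ∧
      X.1 (C.coord (Sum.inl (i, 1))) y =
        b i y * C.coord (Sum.inl (i, 0)) y + a i y * C.coord (Sum.inl (i, 1)) y)
    (m : NormalModel n) (i : Fin n) :
    frameDeriv (X.1 (C.coord (Sum.inl (i, 0)))) m p =
      a i p.1.1 * frameDeriv (C.coord (Sum.inl (i, 0))) m p -
        b i p.1.1 * frameDeriv (C.coord (Sum.inl (i, 1))) m p ∧
    frameDeriv (X.1 (C.coord (Sum.inl (i, 1)))) m p =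
      b i p.1.1 * frameDeriv (C.coord (Sum.inl (i, 0))) m p +
        a i p.1.1 * frameDeriv (C.coord (Sum.inl (i, 1))) m p := by
  have hX : ∀ l, ∀ y ∈ stratum E q n, X.1 (C.coord (Sum.inl l)) y = 0 := fun l y hy =>
    apply_eq_zero_of_mem_stratum hq X (fun y hy => C.coord_eq_zero y hy l) hy
  have h0 := frameDeriv_eq_sum (p := p) (hX (i, 0)) (κ := ![a i, -b i])
    (u := fun c : Fin 2 => C.coord (Sum.inl (i, c))) (fun c y hy => C.coord_eq_zero y hy _)
    (hab.mono fun y hy => by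
      rw [(hy i).1, Fin.sum_univ_two]
      change _ = a i y * _ + -b i y * _
      ring) m
  have h1 := frameDeriv_eq_sum (p := p) (hX (i, 1)) (κ := ![b i, a i])
    (u := fun c : Fin 2 => C.coord (Sum.inl (i, c))) (fun c y hy => C.coord_eq_zero y hy _)
    (hab.mono fun y hy => by
      rw [(hy i).2, Fin.sum_univ_two]
      rfl) m
  rw [Fin.sum_univ_two] at h0 h1
  refine ⟨h0.trans ?_, h1⟩
  change a i p.1.1 * _ + -b i p.1.1 * _ = _
  ring

/-- The prescribed values on the frame coordinates at p define a tangent vector. It remains to see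
that it takes the right values on all pulled-back functions and on the derivatives of all k that
vanish on the stratum; the latter reduce to the normal coordinates. -/
theorem exists_isLift (hq : IsElliptic E q) (X : ellipticFields E q) (p : reduction E q n) :
    ∃ v, IsLift X p v := by
  classical
  obtain ⟨C, χ, hχ, g₀, hpC, hg, hp⟩ := exists_frameChart hq p
  let Φ := C.frameChart hq hχ g₀ p
  have hp' : Φ.bump p ≠ 0 := hp
  obtain ⟨a, b, hab⟩ := C.exists_conformal X hpC
  have hzero : ∀ l, ∀ y ∈ stratum E q n, C.coord (Sum.inl l) y = 0 :=
    fun l y hy => C.coord_eq_zero y hy l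
  have hX0 : ∀ l, X.1 (C.coord (Sum.inl l)) p.1.1 = 0 := fun l =>
    apply_eq_zero_of_mem_stratum hq X (hzero l) p.2.1
  let c : (Fin n × Fin 2) ⊕ Fin C.dim → ℝ := Sum.elim
    (fun l => frameDeriv (X.1 (C.coord (Sum.inl l))) (g₀.1.symm (basisVector (l.1, 0))) p)
    fun l => X.1 (C.coord (Sum.inr l)) p.1.1
  obtain ⟨v, hv, hvc⟩ := Φ.exists_pointDerivation hp' c
  have hvw : ∀ l, v (Φ.coord l) = c l := fun l => by rw [hvc, Φ.apply_coord_eq hp']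
  have hbase : ∀ f, v (baseFun q n f) = X.1 f p.1.1 := by
    intro f
    -- In frame coordinates a pulled-back function depends on the coordinates along the stratum
    -- only.
    have h1 : (fun o => baseFun q n f (Φ.param o)) =ᶠ[𝓝 fun l => Φ.coord l p]
        (f ∘ C.inv) ∘ C.dropNormal := by
      filter_upwards [Φ.isOpen_target.mem_nhds (Φ.mem_target p hp')] with o ho
      have h2 : (Φ.param o).1 = C.frameParamHom g₀ o := C.frameParam_coe hq g₀ p ho
      rw [baseFun_apply, h2]
      rfl
    have h2 : C.dropNormal (fun l => Φ.coord l p) = C.coords p.1.1 := C.dropNormal_frameCoord g₀ p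
    have h3 : HasFDerivAt (f ∘ C.inv) (fderiv ℝ (f ∘ C.inv) (C.coords p.1.1))
        (C.dropNormal fun l => Φ.coord l p) := by
      rw [h2]
      exact ((C.contDiffAt_comp_inv f.contMDiff.contMDiffOn hpC).differentiableAt
        (by simp)).hasFDerivAt
    rw [hvc, h1.fderiv_eq, (h3.comp _ C.dropNormal.hasFDerivAt).fderiv, C.derivation_apply X.1 f hpC]
    change fderiv ℝ (f ∘ C.inv) (C.coords p.1.1) (C.dropNormal c) = _
    congr 1
    funext l
    obtain l | l := l
    · exact (hX0 l).symm
    · rfl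
  refine ⟨v, hv, hbase, ?_⟩
  have hbasis : ∀ (l : Fin n × Fin 2) (i : Fin n), frameDeriv (C.coord (Sum.inl l))
      (g₀.1.symm (basisVector (i, 0))) p = basisVector (i, 0) l.1 l.2 := fun l i => by
    rw [C.frameDeriv_coord (g := g₀.1) hg, g₀.1.apply_symm_apply]
  -- The chart is centred at p: its n complex frame coordinates are 1 there, so X z_i = ζ_i z_i
  -- gives the components ζ_i.
  have hc : ∀ i, c (Sum.inl (i, 0)) = a i p.1.1 ∧ c (Sum.inl (i, 1)) = b i p.1.1 := by
    intro i
    have h1 := C.frameDeriv_apply_coord hq X hab (g₀.1.symm (basisVector (i, 0))) i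
    rw [hbasis, hbasis] at h1
    simp [basisVector] at h1
    exact h1
  -- For fixed m, the derivative of a normal coordinate is a combination of two frame coordinates
  -- with constant coefficients, the components of g₀ m.
  have hcoord : ∀ l m, v (frameFun (C.coord (Sum.inl l)) (hzero l) m) =
      frameDeriv (X.1 (C.coord (Sum.inl l))) m p := by
    rintro ⟨i, d⟩ m
    have h1 := C.frameDeriv_apply_coord hq X hab m i
    rw [C.frameDeriv_coord (g := g₀.1) hg, C.frameDeriv_coord (g := g₀.1) hg] at h1
    have h2 : ∀ (d : Fin 2) (p' : reduction E q n), Φ.bump p' ≠ 0 →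
        frameDeriv (C.coord (Sum.inl (i, d))) m p' =
          conformal (fun l => Φ.coord (Sum.inl l) p') (g₀.1 m) i d := by
      intro d p' hp'
      obtain ⟨-, -, h3⟩ := C.exists_conformal_of_frameBump_ne_zero hq hχ g₀ hp'
      exact C.frameDeriv_coord (g := fun w => conformal (fun l => Φ.coord (Sum.inl l) p') (g₀.1 w))
        h3 m (i, d)
    fin_cases d
    · have h3 := hv.congr (f := frameFun (C.coord (Sum.inl (i, 0))) (hzero (i, 0)) m)
        (g := g₀.1 m i 0 • Φ.coord (Sum.inl (i, 0)) - g₀.1 m i 1 • Φ.coord (Sum.inl (i, 1))) hp'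
        fun p' hp' => by
          refine (h2 0 p' hp').trans ?_
          rw [conformal_apply_zero, SmoothFun.sub_apply, SmoothFun.smul_apply, SmoothFun.smul_apply]
          ring
      refine h3.trans (Eq.trans ?_ h1.1.symm)
      rw [map_sub, map_smul, map_smul, hvw, hvw, (hc i).1, (hc i).2, smul_eq_mul, smul_eq_mul]
      ring
    · have h3 := hv.congr (f := frameFun (C.coord (Sum.inl (i, 1))) (hzero (i, 1)) m)
        (g := g₀.1 m i 1 • Φ.coord (Sum.inl (i, 0)) + g₀.1 m i 0 • Φ.coord (Sum.inl (i, 1))) hp'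
        fun p' hp' => by
          refine (h2 1 p' hp').trans ?_
          rw [conformal_apply_one, SmoothFun.add_apply, SmoothFun.smul_apply, SmoothFun.smul_apply]
          ring
      refine h3.trans (Eq.trans ?_ h1.2.symm)
      rw [map_add, map_smul, map_smul, hvw, hvw, (hc i).1, (hc i).2, smul_eq_mul, smul_eq_mul]
      ring
  intro k hk m
  -- For k = Σ κ_l z_l, both X κ_l · z_l and κ_l · X z_l have a factor vanishing on the stratum.
  -- Differentiating along frames matches the Leibniz rule for v.
  obtain ⟨κ, hκ⟩ := C.exists_eq_sum_mul hq hk hpC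
  have h1 : v (frameFun k hk m) =
      v (∑ l, baseFun q n (κ l) * frameFun (C.coord (Sum.inl l)) (hzero l) m) := by
    refine hv.congr_base (U := {y | ∀ᶠ z in 𝓝 y, k z = ∑ l, κ l z * C.coord (Sum.inl l) z})
      (eventually_eventually_nhds.2 hκ) fun p' hp' => ?_
    rw [SmoothFun.sum_apply]
    exact frameDeriv_eq_sum hk hzero hp' m
  have h2 : ∀ᶠ y in 𝓝 p.1.1, X.1 k y = ∑ l : (Fin n × Fin 2) ⊕ (Fin n × Fin 2),
      Sum.elim (fun l => X.1 (κ l)) κ l y *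
        Sum.elim (fun l => C.coord (Sum.inl l)) (fun l => X.1 (C.coord (Sum.inl l))) l y := by
    filter_upwards [eventually_eventually_nhds.2 hκ] with y hy
    have hev : ∀ (f : Fin n × Fin 2 → C^∞⟮𝓘(ℝ, E), M; 𝓘(ℝ, ℝ), ℝ⟯) (y : M),
        (∑ l, f l) y = ∑ l, f l y := fun f y =>
      map_sum (⟨⟨fun g => g y, rfl⟩, fun _ _ => rfl⟩ : C^∞⟮𝓘(ℝ, E), M; 𝓘(ℝ, ℝ), ℝ⟯ →+ ℝ) f _
    have h3 : X.1 k y = X.1 (∑ l, κ l * C.coord (Sum.inl l)) y := by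
      refine derivation_congr X.1 (hy.mono fun z hz => ?_)
      rw [hz, hev]
      rfl
    rw [h3, map_sum, hev, Fintype.sum_sum_type, ← Finset.sum_add_distrib]
    refine Finset.sum_congr rfl fun l _ => ?_
    rw [Derivation.leibniz]
    change κ l y * X.1 (C.coord (Sum.inl l)) y + C.coord (Sum.inl l) y * X.1 (κ l) y =
      X.1 (κ l) y * C.coord (Sum.inl l) y + κ l y * X.1 (C.coord (Sum.inl l)) y
    ring
  have h3 := frameDeriv_eq_sum (p := p)
    (fun y hy => apply_eq_zero_of_mem_stratum hq X hk hy) (by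
      rintro (l | l)
      · exact hzero l
      · exact fun y hy => apply_eq_zero_of_mem_stratum hq X (hzero l) hy) h2 m
  rw [h1, h3, map_sum, Fintype.sum_sum_type, ← Finset.sum_add_distrib]
  refine Finset.sum_congr rfl fun l _ => ?_
  have h4 : v (baseFun q n (κ l)) = X.1 (κ l) p.1.1 := hbase (κ l)
  rw [hv.leibniz, hcoord, h4]
  change κ l p.1.1 * frameDeriv (X.1 (C.coord (Sum.inl l))) m p +
    frameDeriv (C.coord (Sum.inl l)) m p * X.1 (κ l) p.1.1 =
    X.1 (κ l) p.1.1 * frameDeriv (C.coord (Sum.inl l)) m p +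
      κ l p.1.1 * frameDeriv (X.1 (C.coord (Sum.inl l))) m p
  ring

end Lift

/-! ### The lift on the fibres of the elliptic tangent bundle -/

section FiberLift

variable {E : Type*} [NormedAddCommGroup E] [NormedSpace ℝ E]
  {M : Type*} [TopologicalSpace M] [ChartedSpace E M]
  {R : M → Type*} [TopologicalSpace (TotalSpace ℝ R)]
  [∀ x, AddCommGroup (R x)] [∀ x, Module ℝ (R x)] [∀ x, TopologicalSpace (R x)]
  [FiberBundle ℝ R]
variable [FiniteDimensional ℝ E] [T2Space M] [IsManifold 𝓘(ℝ, E) ∞ M] {q : ∀ x, R x} {n : ℕ}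

namespace IsLift

variable {X Y : ellipticFields E q} {p : reduction E q n}
  {v w : SmoothFun (homModel E n) (reduction E q n) →ₗ[ℝ] ℝ}

theorem add (hq : IsElliptic E q) (hv : IsLift X p v) (hw : IsLift Y p w) :
    IsLift (X + Y) p (v + w) where
  derivation := hv.derivation.add hw.derivation
  base f := by
    rw [LinearMap.add_apply, hv.base, hw.base]
    rfl
  frame k hk m := by
    rw [LinearMap.add_apply, hv.frame, hw.frame, ← frameDeriv_add
      (fun y hy => apply_eq_zero_of_mem_stratum hq X hk hy)
      (fun y hy => apply_eq_zero_of_mem_stratum hq Y hk hy)]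
    rfl

theorem smul (hq : IsElliptic E q) (hv : IsLift X p v) (f : C^∞⟮𝓘(ℝ, E), M; 𝓘(ℝ, ℝ), ℝ⟯) :
    IsLift (f • X) p (f p.1.1 • v) where
  derivation := hv.derivation.smul _
  base g := by
    rw [LinearMap.smul_apply, hv.base]
    rfl
  frame k hk m := by
    rw [LinearMap.smul_apply, hv.frame, smul_eq_mul]
    exact (frameDeriv_mul (fun y hy => apply_eq_zero_of_mem_stratum hq (f • X) hk hy)
      (fun y hy => apply_eq_zero_of_mem_stratum hq X hk hy)
      (Filter.Eventually.of_forall fun y => rfl) m).symm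

/-- The lift depends only on the value of the section at the point. -/
theorem zero_of_valueAt_eq_zero (hq : IsElliptic E q) (hX : valueAt E q p.1.1 X = 0) :
    IsLift X p 0 := by
  have h1 : X ∈ vanishingSections E q p.1.1 := (Submodule.Quotient.mk_eq_zero _).1 hX
  refine Submodule.smul_induction_on h1 (fun f hf Y _ => ?_) fun Y Z hY hZ => ?_
  · obtain ⟨v, hv⟩ := exists_isLift hq Y p
    have h2 := hv.smul hq f
    rwa [show f p.1.1 = 0 from hf, zero_smul] at h2
  · have h2 := hY.add hq hZ
    rwa [add_zero] at h2

/-- A section of the elliptic tangent bundle with vanishing lift vanishes. -/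
theorem valueAt_eq_zero (hq : IsElliptic E q) (h : IsLift X p 0) : valueAt E q p.1.1 X = 0 := by
  obtain ⟨C, χ, hχ, g₀, hpC, hg, hp⟩ := exists_frameChart hq p
  obtain ⟨a, b, hab⟩ := C.exists_conformal X hpC
  have h0 : ∀ l, ∀ y ∈ stratum E q n, C.coord (Sum.inl l) y = 0 :=
    fun l y hy => C.coord_eq_zero y hy l
  have h1 : ∀ i, a i p.1.1 = 0 ∧ b i p.1.1 = 0 := by
    intro i
    have h2 := C.frameDeriv_apply_coord hq X hab (g₀.1.symm (basisVector (i, 0))) i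
    rw [C.frameDeriv_coord (g := g₀.1) hg, C.frameDeriv_coord (g := g₀.1) hg,
      g₀.1.apply_symm_apply, ← h.frame _ (h0 (i, 0)), ← h.frame _ (h0 (i, 1))] at h2
    simp [basisVector] at h2
    exact ⟨h2.1.symm, h2.2.symm⟩
  exact C.valueAt_eq_zero X hpC hab (fun i => (h1 i).1) (fun i => (h1 i).2) fun l =>
    (h.base (C.coord (Sum.inr l))).symm

end IsLift

variable (hq : IsElliptic E q)

/-- The tangent vector of the reduction that lifts the section `X`. -/
def lift (X : ellipticFields E q) (p : reduction E q n) :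
    SmoothFun (homModel E n) (reduction E q n) →ₗ[ℝ] ℝ := Classical.choose (exists_isLift hq X p)

theorem isLift_lift (X : ellipticFields E q) (p : reduction E q n) : IsLift X p (lift hq X p) :=
  Classical.choose_spec (exists_isLift hq X p)

theorem lift_add (X Y : ellipticFields E q) (p : reduction E q n) :
    lift hq (X + Y) p = lift hq X p + lift hq Y p :=
  (isLift_lift hq _ p).unique hq ((isLift_lift hq X p).add hq (isLift_lift hq Y p))

theorem lift_smul (f : C^∞⟮𝓘(ℝ, E), M; 𝓘(ℝ, ℝ), ℝ⟯) (X : ellipticFields E q)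
    (p : reduction E q n) : lift hq (f • X) p = f p.1.1 • lift hq X p :=
  (isLift_lift hq _ p).unique hq ((isLift_lift hq X p).smul hq f)

theorem lift_eq_zero_iff {X : ellipticFields E q} {p : reduction E q n} :
    lift hq X p = 0 ↔ valueAt E q p.1.1 X = 0 := by
  refine ⟨fun h => ?_, fun h => ?_⟩
  · have h1 := isLift_lift hq X p
    rw [h] at h1
    exact h1.valueAt_eq_zero hq
  · exact (isLift_lift hq X p).unique hq (.zero_of_valueAt_eq_zero hq h)

theorem lift_eq_iff {X Y : ellipticFields E q} {p : reduction E q n} :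
    lift hq X p = lift hq Y p ↔ valueAt E q p.1.1 X = valueAt E q p.1.1 Y := by
  have h1 : lift hq X p = lift hq (X - Y) p + lift hq Y p := by rw [← lift_add, sub_add_cancel]
  rw [h1, add_eq_right, lift_eq_zero_iff, map_sub, sub_eq_zero]

theorem valueAt_surjective (x : M) : Function.Surjective (valueAt E q x) :=
  Submodule.mkQ_surjective _

/-- The lift of an element of the fibre of the elliptic tangent bundle. -/
def fiberLift (p : reduction E q n) (ξ : EllipticFiber E q p.1.1) :
    SmoothFun (homModel E n) (reduction E q n) →ₗ[ℝ] ℝ :=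
  lift hq (Classical.choose (valueAt_surjective p.1.1 ξ)) p

theorem fiberLift_valueAt (X : ellipticFields E q) (p : reduction E q n) :
    fiberLift hq p (valueAt E q p.1.1 X) = lift hq X p :=
  (lift_eq_iff hq).2 (Classical.choose_spec (valueAt_surjective p.1.1 (valueAt E q p.1.1 X)))

theorem fiberLift_add (p : reduction E q n) (ξ η : EllipticFiber E q p.1.1) :
    fiberLift hq p (ξ + η) = fiberLift hq p ξ + fiberLift hq p η := by
  obtain ⟨X, rfl⟩ := valueAt_surjective p.1.1 ξ
  obtain ⟨Y, rfl⟩ := valueAt_surjective p.1.1 η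
  rw [← map_add, fiberLift_valueAt, fiberLift_valueAt, fiberLift_valueAt, lift_add]

theorem fiberLift_smul (p : reduction E q n) (c : ℝ) (ξ : EllipticFiber E q p.1.1) :
    fiberLift hq p (c • ξ) = c • fiberLift hq p ξ := by
  obtain ⟨X, rfl⟩ := valueAt_surjective p.1.1 ξ
  have h1 := valueAt_smul E q p.1.1 (algebraMap ℝ C^∞⟮𝓘(ℝ, E), M; 𝓘(ℝ, ℝ), ℝ⟯ c) X
  have h2 : (algebraMap ℝ C^∞⟮𝓘(ℝ, E), M; 𝓘(ℝ, ℝ), ℝ⟯ c) p.1.1 = c := rfl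
  rw [h2] at h1
  rw [← h1, fiberLift_valueAt, fiberLift_valueAt, lift_smul, h2]

theorem fiberLift_injective (p : reduction E q n) : Function.Injective (fiberLift hq p) := by
  intro ξ η h
  obtain ⟨X, rfl⟩ := valueAt_surjective p.1.1 ξ
  obtain ⟨Y, rfl⟩ := valueAt_surjective p.1.1 η
  rwa [fiberLift_valueAt, fiberLift_valueAt, lift_eq_iff] at h

theorem isPointDerivation_fiberLift (p : reduction E q n) (ξ : EllipticFiber E q p.1.1) :
    IsPointDerivation p (fiberLift hq p ξ) := (isLift_lift hq _ p).derivation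

theorem frameDeriv_act {k : C^∞⟮𝓘(ℝ, E), M; 𝓘(ℝ, ℝ), ℝ⟯} (hk : ∀ y ∈ stratum E q n, k y = 0)
    (g : structureGroup n) (m : NormalModel n) (p : reduction E q n) :
    frameDeriv k m (act E q g p) = frameDeriv k (g.1 m) p := by
  obtain ⟨v, hv⟩ := p.2.2.1 (g.1 m)
  rw [frameDeriv_eq hk hv]
  refine frameDeriv_eq hk ?_
  change g.1.symm (p.1.2 v) = m
  rw [hv]
  exact g.1.symm_apply_apply m

/-- The pushforward of the lift at p is a lift at the translated frame: pulled-back functions are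
invariant, and translation by g only replaces m by g m in the derivatives along frames. Uniqueness
finishes the proof. -/
theorem lift_act (X : ellipticFields E q) (g : structureGroup n) (p : reduction E q n)
    (h : SmoothFun (homModel E n) (reduction E q n)) :
    lift hq X (act E q g p) h = lift hq X p (actPullback E q g h) := by
  let w : SmoothFun (homModel E n) (reduction E q n) →ₗ[ℝ] ℝ :=
    { toFun := fun h => lift hq X p (actPullback E q g h)
      map_add' := fun f h => (lift hq X p).map_add (actPullback E q g f) (actPullback E q g h)
      map_smul' := fun c h => (lift hq X p).map_smul c (actPullback E q g h) }
  have hv := isLift_lift hq X p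
  have hw : IsLift X (act E q g p) w :=
    { derivation := ⟨fun f h => hv.derivation.leibniz (actPullback E q g f) (actPullback E q g h)⟩
      base := fun f => hv.base f
      frame := fun k hk m => by
        rw [frameDeriv_act (fun y hy => apply_eq_zero_of_mem_stratum hq X hk hy), ← hv.frame k hk]
        refine congrArg (lift hq X p) ?_
        ext p'
        exact frameDeriv_act hk g m p' }
  exact LinearMap.congr_fun ((isLift_lift hq X _).unique hq hw) h

theorem fiberLift_act (g : structureGroup n) (p : reduction E q n)
    (ξ : EllipticFiber E q p.1.1) (h : SmoothFun (homModel E n) (reduction E q n)) :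
    fiberLift hq (act E q g p) ξ h = fiberLift hq p ξ (actPullback E q g h) := by
  obtain ⟨X, rfl⟩ := valueAt_surjective p.1.1 ξ
  have h1 : fiberLift hq (act E q g p) (valueAt E q p.1.1 X) = lift hq X (act E q g p) :=
    fiberLift_valueAt hq X (act E q g p)
  rw [fiberLift_valueAt, h1, lift_act]

end FiberLift

/-! ### The map to the Atiyah algebroid -/

section SectionLift

variable {E : Type*} [NormedAddCommGroup E] [NormedSpace ℝ E]
  {M : Type*} [TopologicalSpace M] [ChartedSpace E M]
  {R : M → Type*} [TopologicalSpace (TotalSpace ℝ R)]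
  [∀ x, AddCommGroup (R x)] [∀ x, Module ℝ (R x)] [∀ x, TopologicalSpace (R x)]
  [FiberBundle ℝ R]
variable [FiniteDimensional ℝ E] [T2Space M] [IsManifold 𝓘(ℝ, E) ∞ M] {q : ∀ x, R x} {n : ℕ}
variable (hq : IsElliptic E q)

/-- On the frame coordinates of one chart the lifts take the values of smooth functions, namely
derivatives along frames and pullbacks built from X. -/
theorem exists_eq_lift (X : ellipticFields E q) (p : reduction E q n)
    (h : SmoothFun (homModel E n) (reduction E q n)) :
    ∃ Θ g : SmoothFun (homModel E n) (reduction E q n), Θ p ≠ 0 ∧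
      ∀ p', Θ p' ≠ 0 → lift hq X p' h = g p' := by
  obtain ⟨C, χ, hχ, g₀, -, -, hp⟩ := exists_frameChart hq p
  have h0 : ∀ l, ∀ y ∈ stratum E q n, C.coord (Sum.inl l) y = 0 :=
    fun l y hy => C.coord_eq_zero y hy l
  refine (C.frameChart hq hχ g₀ p).exists_eq_of_coord hp (fun p => (isLift_lift hq X p).derivation)
    (Sum.elim (fun l => frameFun (X.1 (C.coord (Sum.inl l)))
      (fun y hy => apply_eq_zero_of_mem_stratum hq X (h0 l) hy) (g₀.1.symm (basisVector (l.1, 0))))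
      fun l => baseFun q n (X.1 (C.coord (Sum.inr l)))) ?_ h
  rintro p' (l | l)
  · exact (isLift_lift hq X p').frame _ (h0 l) _
  · exact (isLift_lift hq X p').base _

theorem mul_cutoff_ne_zero {Θ : SmoothFun (homModel E n) (reduction E q n)}
    {p : reduction E q n} (hp : Θ p ≠ 0) {U : Set M} (hU : U ∈ 𝓝 p.1.1) :
    ∃ Θ' : SmoothFun (homModel E n) (reduction E q n), Θ' p ≠ 0 ∧
      ∀ p', Θ' p' ≠ 0 → Θ p' ≠ 0 ∧ p'.1.1 ∈ U := by
  obtain ⟨V, hV, hVo, hpV⟩ := mem_nhds_iff.1 hU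
  obtain ⟨χ, hs, h1⟩ := exists_cutoff (E := E) hVo hpV
  refine ⟨Θ * baseFun q n χ, mul_ne_zero hp ?_, fun p' hp' => ⟨left_ne_zero_of_mul hp', hV ?_⟩⟩
  · change χ p.1.1 ≠ 0
    rw [h1.self_of_nhds]
    exact one_ne_zero
  · by_contra hn
    exact right_ne_zero_of_mul hp' (image_eq_zero_of_notMem_tsupport (f := χ) fun h' => hn (hs h'))

theorem fiberLift_mem (s : restrictedSections E q (stratum E q n))
    (h : SmoothFun (homModel E n) (reduction E q n)) :
    (fun p : reduction E q n => fiberLift hq p (s.1 (projection E q n p)) h) ∈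
      smoothFunctions (homModel E n) (reduction E q n) := by
  refine mem_smoothFunctions_of_local fun p => ?_
  obtain ⟨X, U, hU, hpU, hX⟩ := s.2 (projection E q n p)
  obtain ⟨Θ, g, hΘ, hg⟩ := exists_eq_lift hq X p h
  obtain ⟨Θ', hΘ', h'⟩ := mul_cutoff_ne_zero hΘ (hU.mem_nhds hpU)
  refine ⟨Θ', g, hΘ', fun p' hp' => ?_⟩
  rw [hX _ (h' p' hp').2, ← hg p' (h' p' hp').1]
  exact LinearMap.congr_fun (fiberLift_valueAt hq X p') h

/-- The vector field on the reduction that lifts a section of the restriction of the elliptic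
tangent bundle. -/
def sectionField (s : restrictedSections E q (stratum E q n)) :
    VectorFields (homModel E n) (reduction E q n) :=
  Derivation.mk'
    { toFun := fun h => ⟨fun p => fiberLift hq p (s.1 (projection E q n p)) h, fiberLift_mem hq s h⟩
      map_add' := fun f g => SmoothFun.ext fun p =>
        (fiberLift hq p (s.1 (projection E q n p))).map_add f g
      map_smul' := fun c g => SmoothFun.ext fun p =>
        (fiberLift hq p (s.1 (projection E q n p))).map_smul c g }
    fun f g => SmoothFun.ext fun p =>
      (isPointDerivation_fiberLift hq p (s.1 (projection E q n p))).leibniz f g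

theorem pointDerivation_sectionField (s : restrictedSections E q (stratum E q n))
    (p : reduction E q n) : pointDerivation (sectionField hq s) p =
      fiberLift hq p (s.1 (projection E q n p)) := rfl

theorem isLift_sectionField (s : restrictedSections E q (stratum E q n)) {p : reduction E q n}
    {X : ellipticFields E q} (hX : s.1 (projection E q n p) = valueAt E q p.1.1 X) :
    IsLift X p (pointDerivation (sectionField hq s) p) := by
  rw [pointDerivation_sectionField, hX]
  have h1 : fiberLift hq p (valueAt E q p.1.1 X) = lift hq X p := fiberLift_valueAt hq X p
  rw [h1]
  exact isLift_lift hq X p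

theorem sectionField_mem (s : restrictedSections E q (stratum E q n)) :
    sectionField hq s ∈ atiyahSections E q n := fun g h =>
  SmoothFun.ext fun p => (fiberLift_act hq g p (s.1 (projection E q n p)) h).symm

/-- The map from the sections of the restriction of the elliptic tangent bundle to the sections of
the Atiyah algebroid. -/
def atiyahMap : ↥(restrictedSections E q (stratum E q n)) →ₗ[SmoothFun 𝓘(ℝ, E) (stratum E q n)]
    ↥(atiyahSections E q n) where
  toFun s := ⟨sectionField hq s, sectionField_mem hq s⟩
  map_add' s t := Subtype.ext (Derivation.ext fun h => SmoothFun.ext fun p =>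
    LinearMap.congr_fun
      (fiberLift_add hq p (s.1 (projection E q n p)) (t.1 (projection E q n p))) h)
  map_smul' f s := Subtype.ext (Derivation.ext fun h => SmoothFun.ext fun p =>
    LinearMap.congr_fun
      (fiberLift_smul hq p (f (projection E q n p)) (s.1 (projection E q n p))) h)

theorem exists_projection_eq (hq : IsElliptic E q) (x : stratum E q n) :
    ∃ p : reduction E q n, projection E q n p = x := by
  obtain ⟨C, hx⟩ := exists_adaptedChart hq x.2
  exact ⟨C.frame hq hx x.2, rfl⟩

theorem atiyahMap_injective : Function.Injective (atiyahMap (n := n) hq) := by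
  intro s t h
  refine Subtype.ext (funext fun x => ?_)
  obtain ⟨p, rfl⟩ := exists_projection_eq hq x
  refine fiberLift_injective hq p ?_
  exact congrArg (fun D : atiyahSections E q n => pointDerivation D.1 p) h

end SectionLift

/-! ### Surjectivity -/

section Surjective

variable {E : Type*} [NormedAddCommGroup E] [NormedSpace ℝ E]
  {M : Type*} [TopologicalSpace M] [ChartedSpace E M]
  {R : M → Type*} [TopologicalSpace (TotalSpace ℝ R)]
  [∀ x, AddCommGroup (R x)] [∀ x, Module ℝ (R x)] [∀ x, TopologicalSpace (R x)]
  [FiberBundle ℝ R]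
variable [FiniteDimensional ℝ E] [T2Space M] [IsManifold 𝓘(ℝ, E) ∞ M] {q : ∀ x, R x} {n : ℕ}
variable (hq : IsElliptic E q)

namespace AdaptedChart

variable (C : AdaptedChart E q n)

/-- The frame coordinates of the frame given by the normal coordinates. -/
def frameSection (o : (Fin n × Fin 2) ⊕ Fin C.dim → ℝ) : (Fin n × Fin 2) ⊕ Fin C.dim → ℝ :=
  Sum.elim (fun l => if l.2 = 0 then 1 else 0) fun l => o (Sum.inr l)

theorem contDiff_frameSection : ContDiff ℝ ∞ C.frameSection := by
  refine contDiff_pi.2 ?_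
  rintro (l | l)
  · exact contDiff_const
  · exact contDiff_apply ℝ ℝ (Sum.inr l)

theorem frameCoord_frame {x : M} (hx : x ∈ C.source) (hxs : x ∈ stratum E q n) :
    (fun l => C.frameCoord 1 l (C.frame hq hx hxs)) = C.frameSection (C.coords x) := by
  funext l
  obtain ⟨i, d⟩ | l := l
  · refine (C.frameDeriv_coord (p := C.frame hq hx hxs) (g := id) (fun v => rfl) _ (i, d)).trans ?_
    change basisVector (i, 0) i d = if d = 0 then 1 else 0
    simp [basisVector]
  · rfl

/-- Along the section of P given by the normal coordinates, W becomes a function of the coordinates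
along the stratum; composing with global coordinate functions extends it to M. -/
theorem exists_ellipticField_coeff {x : M} (hx : x ∈ C.source) (hxs : x ∈ stratum E q n)
    {χ : C^∞⟮𝓘(ℝ, E), M; 𝓘(ℝ, ℝ), ℝ⟯} (hχ : tsupport χ ⊆ C.source) (h1 : ∀ᶠ y in 𝓝 x, χ y = 1)
    (W : SmoothFun (homModel E n) (reduction E q n)) :
    ∃ f : C^∞⟮𝓘(ℝ, E), M; 𝓘(ℝ, ℝ), ℝ⟯, ∀ᶠ y in 𝓝 x, ∀ (hy : y ∈ C.source)
      (hys : y ∈ stratum E q n), f y = W (C.frame hq hy hys) := by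
  let p₀ := C.frame hq hx hxs
  let Φ := C.frameChart hq hχ 1 p₀
  have hbump : ∀ {y : M} (hy : y ∈ C.source) (hys : y ∈ stratum E q n), χ y ≠ 0 →
      Φ.bump (C.frame hq hy hys) ≠ 0 := fun hy hys h =>
    C.frameBump_self (p := C.frame hq hy hys) h fun v => rfl
  have h0 : Φ.bump p₀ ≠ 0 := hbump hx hxs (by rw [h1.self_of_nhds]; exact one_ne_zero)
  obtain ⟨η, -, -, -, hη, -, -, hs⟩ := Φ.exists_cutoff (Φ.mem_target p₀ h0)
  have hF := (hs _ (Φ.contDiffOn_comp_param W)).comp C.contDiff_frameSection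
  refine ⟨C.ofCoords hF, ?_⟩
  have h2 : Filter.Tendsto (fun y => C.frameSection (C.coords y)) (𝓝 x)
      (𝓝 fun l => Φ.coord l p₀) := by
    have h3 : (fun l => Φ.coord l p₀) = C.frameSection (C.coords x) := C.frameCoord_frame hq hx hxs
    rw [h3]
    exact (C.contDiff_frameSection.continuous.comp C.contMDiff_coords.continuous).continuousAt
  filter_upwards [h2.eventually hη, h1] with y hy hy1 hyC hys
  have h4 : (fun l => Φ.coord l (C.frame hq hyC hys)) = C.frameSection (C.coords y) :=
    C.frameCoord_frame hq hyC hys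
  have h5 := Φ.param_coord _ (hbump hyC hys (by rw [hy1]; exact one_ne_zero))
  rw [h4] at h5
  change η (C.frameSection (C.coords y)) * W (Φ.param (C.frameSection (C.coords y))) = _
  rw [hy, one_mul, h5]

end AdaptedChart

/-- The values of D on the frame coordinates, along the section of P given by the normal
coordinates, are used as coefficients of X. The lift of X then equals D along this section, and
G-invariance carries the equality to the other frames. -/
theorem exists_lift_eq (D : atiyahSections E q n) {x : M} (hxs : x ∈ stratum E q n) :
    ∃ X : ellipticFields E q, ∀ᶠ y in 𝓝 x, ∀ p : reduction E q n, p.1.1 = y →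
      lift hq X p = pointDerivation D.1 p := by
  obtain ⟨C, hx⟩ := exists_adaptedChart hq hxs
  obtain ⟨χ, hχ, h1⟩ := exists_cutoff (E := E) C.isOpen_source hx
  choose f hf using fun l => C.exists_ellipticField_coeff hq hx hxs hχ h1 (D.1 (C.frameCoord 1 l))
  let a := fun i => f (Sum.inl (i, 0))
  let b := fun i => f (Sum.inl (i, 1))
  let t := fun l => f (Sum.inr l)
  let X := C.ellipticField hχ a b t
  refine ⟨X, ?_⟩
  have hframe : ∀ᶠ y in 𝓝 x, ∀ (hy : y ∈ C.source) (hys : y ∈ stratum E q n),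
      lift hq X (C.frame hq hy hys) = pointDerivation D.1 (C.frame hq hy hys) := by
    filter_upwards [Filter.eventually_all.2 hf, eventually_eventually_nhds.2 h1] with y hfy hχy hy hys
    let p := C.frame hq hy hys
    have hX := isLift_lift hq X p
    have hbump : (C.frameChart hq hχ 1 p).bump p ≠ 0 :=
      C.frameBump_self (p := p) (by
        change χ y ≠ 0
        rw [hχy.self_of_nhds]
        exact one_ne_zero) fun v => rfl
    refine (C.frameChart hq hχ 1 p).pointDerivation_ext hbump hX.derivation
      (isPointDerivation_pointDerivation D.1 p) fun l => ?_
    have hc : ∀ l, pointDerivation D.1 p ((C.frameChart hq hχ 1 p).coord l) = f l y :=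
      fun l => (hfy l hy hys).symm
    have hcoord : ∀ l, ∀ᶠ z in 𝓝 y, X.1 (C.coord l) z = C.coefficients a b t l z := by
      intro l
      filter_upwards [hχy, C.isOpen_source.mem_nhds hy] with z hz hzs
      have h2 : X.1 (C.coord l) z = χ z * C.coefficients a b t l z := C.field_coord χ hχ _ l hzs
      rw [h2, hz, one_mul]
    have hab : ∀ᶠ z in 𝓝 p.1.1, ∀ i,
        X.1 (C.coord (Sum.inl (i, 0))) z =
          a i z * C.coord (Sum.inl (i, 0)) z - b i z * C.coord (Sum.inl (i, 1)) z ∧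
        X.1 (C.coord (Sum.inl (i, 1))) z =
          b i z * C.coord (Sum.inl (i, 0)) z + a i z * C.coord (Sum.inl (i, 1)) z := by
      filter_upwards [Filter.eventually_all.2 hcoord] with z hz i
      exact ⟨hz _, hz _⟩
    have hu : ∀ (i : Fin n) (d : Fin 2), frameDeriv (C.coord (Sum.inl (i, d)))
        (basisVector (i, 0)) p = if d = 0 then 1 else 0 := fun i d =>
      congrFun (C.frameCoord_frame hq hy hys) (Sum.inl (i, d))
    rw [hc]
    obtain ⟨i, d⟩ | l := l
    · have h0 : ∀ y ∈ stratum E q n, C.coord (Sum.inl (i, d)) y = 0 :=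
        fun y hy => C.coord_eq_zero y hy _
      refine (hX.frame _ h0 (basisVector (i, 0))).trans ?_
      have h2 := C.frameDeriv_apply_coord hq X hab (basisVector (i, 0)) i
      rw [hu, hu] at h2
      fin_cases d
      · refine h2.1.trans ?_
        simp [a]
        rfl
      · refine h2.2.trans ?_
        simp [b]
        rfl
    · exact (hX.base _).trans (hcoord (Sum.inr l)).self_of_nhds
  -- Every frame over y is a translate of the distinguished one, and both sides are invariant under
  -- translation.
  filter_upwards [hframe, C.isOpen_source.mem_nhds hx] with y hy hyC p hp
  subst hp
  obtain ⟨g, hg⟩ := C.exists_structureGroup hq p hyC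
  rw [C.eq_act_frame hq g p hyC hg]
  ext h
  rw [lift_act, hy hyC p.2.1]
  exact congrArg (fun k : SmoothFun (homModel E n) (reduction E q n) =>
    k (C.frame hq hyC p.2.1)) (D.2 g h)

/-- Local sections with lift D have the same values in the fibres of 𝒜 where they overlap, since
lifting is injective on fibres; so the pointwise values form a section over the stratum. -/
theorem atiyahMap_surjective : Function.Surjective (atiyahMap (n := n) hq) := by
  intro D
  choose X hX using fun x : stratum E q n => exists_lift_eq hq D x.2
  refine ⟨⟨fun x => valueAt E q x (X x), fun x => ⟨X x, ?_⟩⟩, ?_⟩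
  · obtain ⟨U, hU, hUo, hxU⟩ := mem_nhds_iff.1 (hX x)
    refine ⟨U, hUo, hxU, fun y hy => ?_⟩
    obtain ⟨p, rfl⟩ := exists_projection_eq hq y
    refine (lift_eq_iff hq (p := p)).1 ?_
    rw [hU hy p rfl, (hX (projection E q n p)).self_of_nhds p rfl]
  · refine Subtype.ext (Derivation.ext fun h => SmoothFun.ext fun p => ?_)
    have h1 := fiberLift_valueAt hq (X (projection E q n p)) p
    rw [(hX (projection E q n p)).self_of_nhds p rfl] at h1
    exact LinearMap.congr_fun h1 h

end Surjective

/-! ### Brackets and anchors -/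

section BracketAnchor

variable {E : Type*} [NormedAddCommGroup E] [NormedSpace ℝ E]
  {M : Type*} [TopologicalSpace M] [ChartedSpace E M]
  {R : M → Type*} [TopologicalSpace (TotalSpace ℝ R)]
  [∀ x, AddCommGroup (R x)] [∀ x, Module ℝ (R x)] [∀ x, TopologicalSpace (R x)]
  [FiberBundle ℝ R]
variable [FiniteDimensional ℝ E] [T2Space M] [IsManifold 𝓘(ℝ, E) ∞ M] {q : ∀ x, R x} {n : ℕ}
variable (hq : IsElliptic E q)

/-- D sends the function on P attached to f or k to the one attached to X f or X k, and likewise for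
D' and Y. These relations pass to commutators; they are needed over a neighbourhood because the
results are differentiated again. -/
theorem IsLift.lie (hq : IsElliptic E q) {X Y : ellipticFields E q}
    {D D' : VectorFields (homModel E n) (reduction E q n)} {U : Set M}
    (hD : ∀ p : reduction E q n, p.1.1 ∈ U → IsLift X p (pointDerivation D p))
    (hD' : ∀ p : reduction E q n, p.1.1 ∈ U → IsLift Y p (pointDerivation D' p))
    {p : reduction E q n} (hp : U ∈ 𝓝 p.1.1) : IsLift ⁅X, Y⁆ p (pointDerivation ⁅D, D'⁆ p) where
  derivation := isPointDerivation_pointDerivation _ _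
  base f := by
    have hpU := mem_of_mem_nhds hp
    have h1 : pointDerivation D p (D' (baseFun q n f)) = X.1 (Y.1 f) p.1.1 := by
      rw [← (hD p hpU).base]
      exact (hD p hpU).derivation.congr_base hp fun p' hp' => (hD' p' hp').base f
    have h2 : pointDerivation D' p (D (baseFun q n f)) = Y.1 (X.1 f) p.1.1 := by
      rw [← (hD' p hpU).base]
      exact (hD' p hpU).derivation.congr_base hp fun p' hp' => (hD p' hp').base f
    change ⁅D, D'⁆ (baseFun q n f) p = ⁅X.1, Y.1⁆ f p.1.1
    rw [Derivation.commutator_apply, Derivation.commutator_apply]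
    exact congrArg₂ (· - ·) h1 h2
  frame k hk m := by
    have hpU := mem_of_mem_nhds hp
    have hX : ∀ {k : C^∞⟮𝓘(ℝ, E), M; 𝓘(ℝ, ℝ), ℝ⟯}, (∀ y ∈ stratum E q n, k y = 0) →
        ∀ y ∈ stratum E q n, X.1 k y = 0 := fun hk y hy => apply_eq_zero_of_mem_stratum hq X hk hy
    have hY : ∀ {k : C^∞⟮𝓘(ℝ, E), M; 𝓘(ℝ, ℝ), ℝ⟯}, (∀ y ∈ stratum E q n, k y = 0) →
        ∀ y ∈ stratum E q n, Y.1 k y = 0 := fun hk y hy => apply_eq_zero_of_mem_stratum hq Y hk hy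
    have h1 : pointDerivation D p (D' (frameFun k hk m)) = frameDeriv (X.1 (Y.1 k)) m p := by
      rw [← (hD p hpU).frame _ (hY hk)]
      exact (hD p hpU).derivation.congr_base hp fun p' hp' => (hD' p' hp').frame k hk m
    have h2 : pointDerivation D' p (D (frameFun k hk m)) = frameDeriv (Y.1 (X.1 k)) m p := by
      rw [← (hD' p hpU).frame _ (hX hk)]
      exact (hD' p hpU).derivation.congr_base hp fun p' hp' => (hD p' hp').frame k hk m
    have h3 : ⁅X, Y⁆.1 k = X.1 (Y.1 k) - Y.1 (X.1 k) :=
      Derivation.commutator_apply (D1 := X.1) (D2 := Y.1) k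
    have h4 := frameDeriv_add (f := ⁅X, Y⁆.1 k) (g := Y.1 (X.1 k))
      (fun y hy => apply_eq_zero_of_mem_stratum hq ⁅X, Y⁆ hk hy) (hY (hX hk)) p m
    rw [h3, sub_add_cancel, ← h3] at h4
    change ⁅D, D'⁆ (frameFun k hk m) p = _
    rw [Derivation.commutator_apply, eq_sub_of_add_eq h4.symm]
    exact congrArg₂ (· - ·) h1 h2

theorem atiyahMap_lie {s t u : restrictedSections E q (stratum E q n)}
    (hu : atiyahMap hq u = ⁅atiyahMap hq s, atiyahMap hq t⁆) : IsRestrictedBracket E q s t u := by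
  rintro x X Y ⟨U, hU, hxU, hX⟩ ⟨V, hV, hxV, hY⟩
  refine ⟨U ∩ V, hU.inter hV, ⟨hxU, hxV⟩, fun y hy => ?_⟩
  obtain ⟨p, rfl⟩ := exists_projection_eq hq y
  have h1 := IsLift.lie hq (D := sectionField hq s) (D' := sectionField hq t) (U := U ∩ V)
    (fun p' hp' => isLift_sectionField hq s (hX _ hp'.1))
    (fun p' hp' => isLift_sectionField hq t (hY _ hp'.2)) (p := p)
    ((hU.inter hV).mem_nhds hy)
  have h2 : sectionField hq u = ⁅sectionField hq s, sectionField hq t⁆ := congrArg Subtype.val hu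
  rw [← h2, pointDerivation_sectionField] at h1
  refine fiberLift_injective hq p (h1.unique hq ?_)
  have h3 : fiberLift hq p (valueAt E q p.1.1 ⁅X, Y⁆) = lift hq ⁅X, Y⁆ p :=
    fiberLift_valueAt hq ⁅X, Y⁆ p
  have h4 := isLift_lift hq ⁅X, Y⁆ p
  rwa [← h3] at h4

theorem exists_sectionField_projPullback (s : restrictedSections E q (stratum E q n))
    (h : SmoothFun 𝓘(ℝ, E) (stratum E q n)) (x : stratum E q n) :
    ∃ (f : C^∞⟮𝓘(ℝ, E), M; 𝓘(ℝ, ℝ), ℝ⟯) (U : Set M), IsOpen U ∧ (x : M) ∈ U ∧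
      ∀ p : reduction E q n, p.1.1 ∈ U →
        sectionField hq s (projPullback E q n h) p = f p.1.1 := by
  obtain ⟨V, hV, hxV, k, hk, hhk⟩ := h.2 x
  obtain ⟨g, W, hW, hxW, hWV, hg⟩ := exists_global_extension E hV hxV hk
  obtain ⟨X, U, hU, hxU, hX⟩ := s.2 x
  refine ⟨X.1 g, U ∩ W, hU.inter hW, ⟨hxU, hxW⟩, fun p hp => ?_⟩
  have h1 := isLift_sectionField hq s (p := p) (hX _ hp.1)
  rw [← h1.base]
  refine h1.derivation.congr_base (hW.mem_nhds hp.2) fun p' hp' => ?_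
  exact (hhk (projection E q n p') (hWV hp')).trans (hg _ hp').symm

/-- The vector fields that lift sections of the elliptic tangent bundle are projectable. -/
theorem exists_sectionField_projection (s : restrictedSections E q (stratum E q n)) :
    ∃ Z : VectorFields 𝓘(ℝ, E) (stratum E q n), ∀ (h : SmoothFun 𝓘(ℝ, E) (stratum E q n))
      (p : reduction E q n),
      Z h (projection E q n p) = sectionField hq s (projPullback E q n h) p := by
  -- No smoothness of this choice of frames is needed: the derivative of a pulled-back function
  -- along the lifted field is locally itself pulled back from M, so it is the same at all frames
  -- over a point.
  choose σ hσ using fun x : stratum E q n => exists_projection_eq hq x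
  have hσ' : ∀ x, (σ x).1.1 = x.1 := fun x => congrArg Subtype.val (hσ x)
  have hmem : ∀ h : SmoothFun 𝓘(ℝ, E) (stratum E q n),
      (fun x => sectionField hq s (projPullback E q n h) (σ x)) ∈
        smoothFunctions 𝓘(ℝ, E) (stratum E q n) := by
    intro h x
    obtain ⟨f, U, hU, hxU, hf⟩ := exists_sectionField_projPullback hq s h x
    refine ⟨U, hU, hxU, f, f.contMDiff.contMDiffOn, fun y hy => ?_⟩
    refine (hf (σ y) ?_).trans (congrArg f (hσ' y))
    rwa [hσ' y]
  refine ⟨Derivation.mk'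
    { toFun := fun h => ⟨fun x => sectionField hq s (projPullback E q n h) (σ x), hmem h⟩
      map_add' := fun f g => SmoothFun.ext fun x =>
        (pointDerivation (sectionField hq s) (σ x)).map_add (projPullback E q n f)
          (projPullback E q n g)
      map_smul' := fun c g => SmoothFun.ext fun x =>
        (pointDerivation (sectionField hq s) (σ x)).map_smul c (projPullback E q n g) }
    fun f g => SmoothFun.ext fun x => ?_, fun h p => ?_⟩
  · have h1 := (isPointDerivation_pointDerivation (sectionField hq s) (σ x)).leibniz
      (projPullback E q n f) (projPullback E q n g)
    have h2 : ∀ f : SmoothFun 𝓘(ℝ, E) (stratum E q n), projPullback E q n f (σ x) = f x :=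
      fun f => congrArg f (hσ x)
    rw [h2, h2] at h1
    exact h1
  · obtain ⟨f, U, hU, hpU, hf⟩ := exists_sectionField_projPullback hq s h (projection E q n p)
    have h1 : (σ (projection E q n p)).1.1 = p.1.1 := hσ' _
    refine Eq.trans (hf (σ (projection E q n p)) ?_) ((congrArg f h1).trans (hf p hpU).symm)
    rw [h1]
    exact hpU

theorem exists_anchor (s : restrictedSections E q (stratum E q n)) :
    ∃ Z : VectorFields 𝓘(ℝ, E) (stratum E q n),
      IsRestrictedAnchor E q s Z ∧ IsAtiyahAnchor E q n (atiyahMap hq s) Z := by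
  obtain ⟨Z, hZ⟩ := exists_sectionField_projection hq s
  refine ⟨Z, ?_, fun h => SmoothFun.ext fun p => (hZ h p).symm⟩
  rintro x X ⟨U, -, hxU, hX⟩ f
  obtain ⟨p, rfl⟩ := exists_projection_eq hq x
  rw [hZ]
  exact (isLift_sectionField hq s (hX _ hxU)).base f

/-- The isomorphism of the restriction of the elliptic tangent bundle to the deepest stratum and
the Atiyah algebroid of the structure group reduction. -/
def lieAlgebroidIso (n : ℕ) : LieAlgebroidIso E q n where
  toEquiv := LinearEquiv.ofBijective (atiyahMap hq) ⟨atiyahMap_injective hq, atiyahMap_surjective hq⟩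
  map_bracket _ _ := atiyahMap_lie hq (LinearEquiv.apply_symm_apply
    (LinearEquiv.ofBijective (atiyahMap hq) ⟨atiyahMap_injective hq, atiyahMap_surjective hq⟩) _)
  map_anchor s := exists_anchor hq s

end BracketAnchor

end EllipticDivisor

end

theorem mainTheorem6 {E : Type*} [NormedAddCommGroup E] [NormedSpace ℝ E] [FiniteDimensional ℝ E]
    {M : Type*} [TopologicalSpace M] [T2Space M] [SecondCountableTopology M] [ChartedSpace E M]
    [IsManifold 𝓘(ℝ, E) ∞ M]
    {R : M → Type*} [TopologicalSpace (TotalSpace ℝ R)]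
    [∀ x, AddCommGroup (R x)] [∀ x, Module ℝ (R x)] [∀ x, TopologicalSpace (R x)]
    [FiberBundle ℝ R] [VectorBundle ℝ ℝ R] [ContMDiffVectorBundle ∞ ℝ R 𝓘(ℝ, E)]
    (q : ∀ x, R x) (hq : EllipticDivisor.IsElliptic E q)
    (n : ℕ) (hn : EllipticDivisor.HasIntersectionNumber E q n) :
    Nonempty (EllipticDivisor.LieAlgebroidIso E q n) := by
  exact ⟨EllipticDivisor.lieAlgebroidIso hq n⟩
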